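/- Let $\mathcal A$ and $\mathcal B$ be abelian categories and let $\Phi:\mathcal A\to\mathcal B$ and $\Psi:\mathcal B\to\mathcal A$ be additive contravariant functors forming a right adjoint pair, i.e. there are natural bijections $\operatorname{Hom}_{\mathcal B}(B,\Phi A)\cong\operatorname{Hom}_{\mathcal A}(A,\Psi B)$, with units $\eta_A:A\to\Psi\Phi A$ and $\xi_B:B\to\Phi\Psi B$. Let $*,\dagger\in\{\varnothing,+,-,b\}$. Assume that there is a triangulated subcategory $\mathcal P$ of the homotopy category $K^*(\mathcal A)$ such that every complex in $K^*(\mathcal A)$ admits a quasi-isomorphism from a complex in $\mathcal P$, and $\Phi(P)$ is exact for every exact $P\in\mathcal P$; and that there is a triangulated subcategory $\mathcal Q$ of $K^\dagger(\mathcal B)$ with the same properties for $\Psi$. Thus the derived functors $\mathbf R^*\Phi$ and $\mathbf R^\dagger\Psi$ exist, with $\mathbf R^*\Phi X=\Phi P$ for $P\in\mathcal P$ quasi-isomorphic to $X$, and similarly for $\Psi$. An object $A$ of $\mathcal A$ is called $\Phi$-acyclic if $H^i(\mathbf R^*\Phi A)=0$ for all $i\neq0$; $\Psi$-acyclic objects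 of $\mathcal B$ are defined similarly. Assume: * every object of $\mathcal A$ is a quotient of a $\Phi$-acyclic object $L$ such that $\Phi L$ is $\Psi$-acyclic, and every object of $\mathcal B$ is a quotient of a $\Psi$-acyclic object $L'$ such that $\Psi L'$ is $\Phi$-acyclic; * $\Phi$ and $\Psi$ have cohomological dimension at most one, i.e. $H^i(\mathbf R^*\Phi A)=0$ and $H^i(\mathbf R^\dagger\Psi B)=0$ for all $A\in\mathcal A$, $B\in\mathcal B$ and $|i|>1$. Then the total derived functors $\mathbf R\Phi:\mathcal D(\mathcal A)\to\mathcal D(\mathcal B)$ and $\mathbf R\Psi:\mathcal D(\mathcal B)\to\mathcal D(\mathcal A)$ of the unbounded derived categories exist, and $(\Phi,\Psi)$ induces a right adjoint pair $(\mathbf R\Phi,\mathbf R\Psi)$, with units $\hat\eta_X:X\to\mathbf R\Psi\mathbf R\Phi X$ and $\hat\xi_Y:Y\to\mathbf R\Phi\mathbf R\Psi Y$. (That it is induced means: for a complex $K$ over $\mathcal A$, $\hat\eta_K$ and the termwise unit $\eta_K:K\to\Psi\Phi K$ have the same composite to $\mathbf R\Psi(\Phi K)$ along the natural maps $\mathbf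 R\Psi\mathbf R\Phi K\to\mathbf R\Psi(\Phi K)$ and $\Psi\Phi K\to\mathbf R\Psi(\Phi K)$; similarly for $\hat\xi$ and $\xi$.) Write $R^i\Phi=H^i(\mathbf R\Phi(-))$ and $R^i\Psi=H^i(\mathbf R\Psi(-))$. Let $\mathcal D_{\mathcal A}$ be the full subcategory of the $\mathcal D$-reflexive objects of $\mathcal A$, i.e. those $A$, regarded as complexes in degree zero, for which $\hat\eta_A$ is an isomorphism; let $\mathcal D_{\mathcal B}$ be the full subcategory of the $B$ in $\mathcal B$ for which $\hat\xi_B$ is an isomorphism. Then $R^1\Phi$ maps $\mathcal D_{\mathcal A}$ to $\mathcal D_{\mathcal B}$, $R^1\Psi$ maps $\mathcal D_{\mathcal B}$ to $\mathcal D_{\mathcal A}$, and these restrictions form a left adjoint pair of contravariant functors, i.e. there are bijections $\operatorname{Hom}(R^1\Phi A,B)\cong\operatorname{Hom}(R^1\Psi B,A)$, natural in $A\in\mathcal D_{\mathcal A}$ and $B\in\mathcal D_{\mathcal B}$, whose units are the natural maps $$\gamma_A=H^0(\hat\eta_A)^{-1}\circ R^0\Psi(\pi_{\mathbf R\Phi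 A}):R^1\Psi R^1\Phi A\to A,\qquad \theta_B=H^0(\hat\xi_B)^{-1}\circ R^0\Phi(\pi_{\mathbf R\Psi B}):R^1\Phi R^1\Psi B\to B.$$ Here $\pi_{\mathbf R\Phi A}:\mathbf R\Phi A\to(R^1\Phi A)[-1]$ is the truncation morphism, i.e. the morphism inducing the identity of $R^1\Phi A$ on $H^1$, and $R^0\Psi((R^1\Phi A)[-1])$ is identified with $R^1\Psi R^1\Phi A$ through the compatibility of $\mathbf R\Psi$ with shifts; $\pi_{\mathbf R\Psi B}$ and the corresponding identification are defined in the same way. -/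

import Mathlib

open CategoryTheory CategoryTheory.Limits Opposite

universe w₁ w₂ v₁ v₂ u₁ u₂

noncomputable section

namespace DerivedDuality

/-! A contravariant functor from `𝒜` to `ℬ` is a functor `Φ : 𝒜ᵒᵖ ⥤ ℬ`.  A right adjoint pair
`(Φ, Ψ)`, i.e. natural bijections `Hom(B, Φ A) ≃ Hom(A, Ψ B)`, is an adjunction
`Φ.rightOp ⊣ Ψ`; its unit consists of maps `η_A : A ⟶ Ψ Φ A`.  The adjunction
`adj.rightOp : Ψ.rightOp ⊣ Φ` expresses the same bijections with the roles of the two functors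
exchanged, and its unit consists of the maps `ξ_B : B ⟶ Φ Ψ B`. -/

variable {𝒜 : Type u₁} [Category.{v₁} 𝒜] [Abelian 𝒜]
  {ℬ : Type u₂} [Category.{v₂} ℬ] [Abelian ℬ]

/-! ### Extension of contravariant functors to complexes -/

/-- The term by term extension of a contravariant functor to cochain complexes:
`(Φ K)ⁿ = Φ (K⁻ⁿ)`, with differentials the images of the differentials of `K`. -/
def onComplexes (Φ : 𝒜ᵒᵖ ⥤ ℬ) [Φ.Additive] :
    (CochainComplex 𝒜 ℤ)ᵒᵖ ⥤ CochainComplex ℬ ℤ :=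
  (CochainComplex.opEquivalence 𝒜).functor ⋙ Φ.mapHomologicalComplex (ComplexShape.up ℤ)

lemma onComplexes_X (Φ : 𝒜ᵒᵖ ⥤ ℬ) [Φ.Additive] (K : CochainComplex 𝒜 ℤ) (n : ℤ) :
    ((onComplexes Φ).obj (op K)).X n = Φ.obj (op (K.X (-n))) := rfl

lemma onComplexes_d (Φ : 𝒜ᵒᵖ ⥤ ℬ) [Φ.Additive] (K : CochainComplex 𝒜 ℤ) (i j : ℤ) :
    ((onComplexes Φ).obj (op K)).d i j = Φ.map (K.d (-j) (-i)).op := rfl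

lemma onComplexes_map_f (Φ : 𝒜ᵒᵖ ⥤ ℬ) [Φ.Additive] {K L : CochainComplex 𝒜 ℤ} (φ : K ⟶ L)
    (n : ℤ) : ((onComplexes Φ).map φ.op).f n = Φ.map (φ.f (-n)).op := rfl

/-- The term by term extension to a complex `K` of the unit `η : 𝟭 ⟶ Ψ Φ`. In degree `n` it is
`η : Kⁿ ⟶ Ψ Φ (Kⁿ)`, followed by the identification `Kⁿ = K⁻⁽⁻ⁿ⁾`. -/
def unitOnComplexes {Φ : 𝒜ᵒᵖ ⥤ ℬ} {Ψ : ℬᵒᵖ ⥤ 𝒜} [Φ.Additive] [Ψ.Additive]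
    (adj : Φ.rightOp ⊣ Ψ) (K : CochainComplex 𝒜 ℤ) :
    K ⟶ (onComplexes Ψ).obj (op ((onComplexes Φ).obj (op K))) where
  f n := adj.unit.app (K.X n) ≫
    Ψ.map (Φ.map (K.XIsoOfEq (by simp : n = - -n)).hom.op).op
  comm' i j _ := by
    change (adj.unit.app (K.X i) ≫ Ψ.map (Φ.map (K.XIsoOfEq _).hom.op).op) ≫
      Ψ.map (Φ.map (K.d (- -i) (- -j)).op).op = K.d i j ≫ adj.unit.app (K.X j) ≫
        Ψ.map (Φ.map (K.XIsoOfEq _).hom.op).op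
    have h := adj.unit.naturality_assoc (K.d i j)
      (Ψ.map (Φ.map (K.XIsoOfEq (by simp : j = - -j)).hom.op).op)
    dsimp at h
    rw [h, Category.assoc, ← Ψ.map_comp, ← op_comp, ← Φ.map_comp, ← op_comp,
      ← Ψ.map_comp, ← op_comp, ← Φ.map_comp, ← op_comp,
      HomologicalComplex.XIsoOfEq_hom_comp_d, HomologicalComplex.d_comp_XIsoOfEq_hom]

/-- The identification of `Φ K` with `(Φ (K[-1]))[-1]`, which is the identity in each degree. -/
def shiftOnComplexes (Φ : 𝒜ᵒᵖ ⥤ ℬ) [Φ.Additive] (K : CochainComplex 𝒜 ℤ) :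
    (onComplexes Φ).obj (op K) ⟶
      ((onComplexes Φ).obj (op (K⟦(-1 : ℤ)⟧)))⟦(-1 : ℤ)⟧ where
  f n := Φ.map (K.XIsoOfEq (by lia : -(n + -1) + -1 = -n)).hom.op
  comm' i j _ := by
    change Φ.map (K.XIsoOfEq _).hom.op ≫ ((-1 : ℤ).negOnePow •
        Φ.map ((-1 : ℤ).negOnePow • K.d (-(j + -1) + -1) (-(i + -1) + -1)).op) =
      Φ.map (K.d (-j) (-i)).op ≫ Φ.map (K.XIsoOfEq _).hom.op
    rw [← Φ.map_comp, ← op_comp, HomologicalComplex.XIsoOfEq_hom_comp_d]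
    simp [← Φ.map_comp, ← op_comp]

lemma shiftOnComplexes_naturality (Φ : 𝒜ᵒᵖ ⥤ ℬ) [Φ.Additive] {K L : CochainComplex 𝒜 ℤ}
    (f : K ⟶ L) :
    (onComplexes Φ).map f.op ≫ shiftOnComplexes Φ K =
      shiftOnComplexes Φ L ≫ ((onComplexes Φ).map (f⟦(-1 : ℤ)⟧').op)⟦(-1 : ℤ)⟧' := by
  ext n
  change Φ.map (f.f (-n)).op ≫ Φ.map (K.XIsoOfEq _).hom.op =
    Φ.map (L.XIsoOfEq _).hom.op ≫ Φ.map (f.f (-(n + -1) + -1)).op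
  simp only [← Φ.map_comp, ← op_comp]
  have h (m k : ℤ) (hmk : m = k) :
      (K.XIsoOfEq hmk).hom ≫ f.f k = f.f m ≫ (L.XIsoOfEq hmk).hom := by
    subst hmk
    simp
  rw [h]

/-! ### Acyclic objects and cohomological dimension -/

/-- The four boundedness conditions on complexes. -/
inductive Boundedness
  | unbounded
  | plus
  | minus
  | bounded

/-- The complexes over `𝒜` that belong to `K(𝒜)`, `K⁺(𝒜)`, `K⁻(𝒜)`, `Kᵇ(𝒜)`, respectively. -/
def Boundedness.Holds (b : Boundedness) (K : CochainComplex 𝒜 ℤ) : Prop :=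
  match b with
  | .unbounded => True
  | .plus => ∃ n : ℤ, K.IsStrictlyGE n
  | .minus => ∃ n : ℤ, K.IsStrictlyLE n
  | .bounded => (∃ n : ℤ, K.IsStrictlyGE n) ∧ ∃ n : ℤ, K.IsStrictlyLE n

/-- `𝓟` is a triangulated subcategory of `K*(𝒜)` (with `*` given by `b`) by which the derived
functor `R*Φ` can be computed: every complex in `K*(𝒜)` admits a quasi-isomorphism from an object
of `𝓟`, and `Φ P` is exact for all exact complexes `P` in `𝓟`. -/
structure IsResolving (Φ : 𝒜ᵒᵖ ⥤ ℬ) [Φ.Additive] (b : Boundedness)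
    (𝓟 : ObjectProperty (HomotopyCategory 𝒜 (ComplexShape.up ℤ))) : Prop where
  isTriangulated : 𝓟.IsTriangulated
  holds (P : CochainComplex 𝒜 ℤ) (hP : 𝓟 ((HomotopyCategory.quotient _ _).obj P)) : b.Holds P
  exists_quasiIso (K : CochainComplex 𝒜 ℤ) (hK : b.Holds K) :
    ∃ (P : CochainComplex 𝒜 ℤ) (f : P ⟶ K),
      𝓟 ((HomotopyCategory.quotient _ _).obj P) ∧ QuasiIso f
  acyclic (P : CochainComplex 𝒜 ℤ) (hP : 𝓟 ((HomotopyCategory.quotient _ _).obj P))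
    (hP' : P.Acyclic) : ((onComplexes Φ).obj (op P)).Acyclic

/-- `Hⁱ(R*Φ A) = 0`, where `R*Φ A = Φ P` for any `P` in `𝓟` that is quasi-isomorphic to `A`. -/
def DerivedVanishesAt (Φ : 𝒜ᵒᵖ ⥤ ℬ) [Φ.Additive]
    (𝓟 : ObjectProperty (HomotopyCategory 𝒜 (ComplexShape.up ℤ))) (A : 𝒜) (i : ℤ) : Prop :=
  ∀ (P : CochainComplex 𝒜 ℤ) (f : P ⟶ (HomologicalComplex.single 𝒜 (ComplexShape.up ℤ) 0).obj A),
    𝓟 ((HomotopyCategory.quotient _ _).obj P) → QuasiIso f →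
      IsZero (((onComplexes Φ).obj (op P)).homology i)

/-- An object `A` is `Φ`-acyclic if `Hⁱ(R*Φ A) = 0` for all `i ≠ 0`. -/
def IsAcyclicObject (Φ : 𝒜ᵒᵖ ⥤ ℬ) [Φ.Additive]
    (𝓟 : ObjectProperty (HomotopyCategory 𝒜 (ComplexShape.up ℤ))) (A : 𝒜) : Prop :=
  ∀ i : ℤ, i ≠ 0 → DerivedVanishesAt Φ 𝓟 A i

/-- `Φ` has cohomological dimension `≤ n` if `Hⁱ(R*Φ A) = 0` for all `A` and all `|i| > n`. -/
def CohomologicalDimensionLE (Φ : 𝒜ᵒᵖ ⥤ ℬ) [Φ.Additive]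
    (𝓟 : ObjectProperty (HomotopyCategory 𝒜 (ComplexShape.up ℤ))) (n : ℤ) : Prop :=
  ∀ (A : 𝒜) (i : ℤ), n < |i| → DerivedVanishesAt Φ 𝓟 A i

/-- `𝒜` has enough `Ψ`-`Φ`-acyclic objects: every object of `𝒜` is a quotient of a `Φ`-acyclic
object `L` such that `Φ L` is `Ψ`-acyclic. -/
def EnoughAcyclic (Φ : 𝒜ᵒᵖ ⥤ ℬ) (Ψ : ℬᵒᵖ ⥤ 𝒜) [Φ.Additive] [Ψ.Additive]
    (𝓟 : ObjectProperty (HomotopyCategory 𝒜 (ComplexShape.up ℤ)))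
    (𝓠 : ObjectProperty (HomotopyCategory ℬ (ComplexShape.up ℤ))) : Prop :=
  ∀ A : 𝒜, ∃ (L : 𝒜) (p : L ⟶ A), Epi p ∧
    IsAcyclicObject Φ 𝓟 L ∧ IsAcyclicObject Ψ 𝓠 (Φ.obj (op L))

/-! ### Total derived functors -/

variable [HasDerivedCategory.{w₁} 𝒜] [HasDerivedCategory.{w₂} ℬ]

/-- The contravariant functor `K ↦ Φ K` from complexes over `𝒜` to the derived category of `ℬ`. -/
abbrev toDerived (Φ : 𝒜ᵒᵖ ⥤ ℬ) [Φ.Additive] : (CochainComplex 𝒜 ℤ)ᵒᵖ ⥤ DerivedCategory ℬ :=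
  onComplexes Φ ⋙ DerivedCategory.Q

/-- The class of quasi-isomorphisms, in the opposite of the category of complexes over `𝒜`. -/
abbrev quasiIsoOp (𝒜 : Type u₁) [Category.{v₁} 𝒜] [Abelian 𝒜] :
    MorphismProperty (CochainComplex 𝒜 ℤ)ᵒᵖ :=
  (HomologicalComplex.quasiIso 𝒜 (ComplexShape.up ℤ)).op

/-- The functor `RΦ : D(𝒜)ᵒᵖ ⥤ D(ℬ)`, equipped with the natural maps `α_K : Φ K ⟶ RΦ K`, is the
total (right) derived functor of the contravariant functor `Φ`. -/
abbrev IsTotalDerived {Φ : 𝒜ᵒᵖ ⥤ ℬ} [Φ.Additive]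
    (RΦ : (DerivedCategory 𝒜)ᵒᵖ ⥤ DerivedCategory ℬ)
    (α : toDerived Φ ⟶ (DerivedCategory.Q (C := 𝒜)).op ⋙ RΦ) : Prop :=
  RΦ.IsRightDerivedFunctor α (quasiIsoOp 𝒜)

/-- The functors `RⁱΦ = Hⁱ(RΦ(-))` on the abelian category `𝒜`, where objects of `𝒜` are regarded
as complexes concentrated in degree zero. -/
def cohomologyOn (RΦ : (DerivedCategory 𝒜)ᵒᵖ ⥤ DerivedCategory ℬ) (i : ℤ) : 𝒜ᵒᵖ ⥤ ℬ :=
  (DerivedCategory.singleFunctor 𝒜 0).op ⋙ RΦ ⋙ DerivedCategory.homologyFunctor ℬ i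

/-- The adjunction `(RΦ, RΨ)` is induced by the adjunction `(Φ, Ψ)`: for all complexes `K` over `𝒜`
the unit `η̂_K : K ⟶ RΨ RΦ K` and the term by term unit `η_K : K ⟶ Ψ Φ K` become equal in
`Hom(K, RΨ Φ K)` (the first followed by `RΨ(α_K)`, the second followed by `β_{Φ K}`). -/
def UnitCompatible {Φ : 𝒜ᵒᵖ ⥤ ℬ} {Ψ : ℬᵒᵖ ⥤ 𝒜} [Φ.Additive] [Ψ.Additive]
    (adj : Φ.rightOp ⊣ Ψ)
    {RΦ : (DerivedCategory 𝒜)ᵒᵖ ⥤ DerivedCategory ℬ}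
    (α : toDerived Φ ⟶ (DerivedCategory.Q (C := 𝒜)).op ⋙ RΦ)
    {RΨ : (DerivedCategory ℬ)ᵒᵖ ⥤ DerivedCategory 𝒜}
    (β : toDerived Ψ ⟶ (DerivedCategory.Q (C := ℬ)).op ⋙ RΨ)
    (Radj : RΦ.rightOp ⊣ RΨ) : Prop :=
  ∀ K : CochainComplex 𝒜 ℤ,
    Radj.unit.app (DerivedCategory.Q.obj K) ≫ RΨ.map (α.app (op K)).op =
      DerivedCategory.Q.map (unitOnComplexes adj K) ≫
        β.app (op ((onComplexes Φ).obj (op K)))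

/-- An object `A` of `𝒜` is `𝒟`-reflexive if `η̂_A : A ⟶ RΨ RΦ A` is an isomorphism. -/
def reflexiveObjects
    {RΦ : (DerivedCategory 𝒜)ᵒᵖ ⥤ DerivedCategory ℬ}
    {RΨ : (DerivedCategory ℬ)ᵒᵖ ⥤ DerivedCategory 𝒜}
    (Radj : RΦ.rightOp ⊣ RΨ) : ObjectProperty 𝒜 :=
  fun A ↦ IsIso (Radj.unit.app ((DerivedCategory.singleFunctor 𝒜 0).obj A))

/-! ### The natural maps `γ` and `θ` -/

/-- The natural map `RΦ X ⟶ (RΦ (X[-1]))[-1]` (in fact an isomorphism) which expresses that `RΦ`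
commutes with the shift: it is induced by the identifications `Φ K = (Φ (K[-1]))[-1]`. -/
def shiftDerived {Φ : 𝒜ᵒᵖ ⥤ ℬ} [Φ.Additive]
    (RΦ : (DerivedCategory 𝒜)ᵒᵖ ⥤ DerivedCategory ℬ)
    (α : toDerived Φ ⟶ (DerivedCategory.Q (C := 𝒜)).op ⋙ RΦ) [IsTotalDerived RΦ α] :
    RΦ ⟶ (shiftFunctor (DerivedCategory 𝒜) (-1 : ℤ)).op ⋙ RΦ ⋙
      shiftFunctor (DerivedCategory ℬ) (-1 : ℤ) :=
  RΦ.rightDerivedDesc α (quasiIsoOp 𝒜) _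
    { app := fun K ↦
        DerivedCategory.Q.map (shiftOnComplexes Φ K.unop) ≫
          (DerivedCategory.Q.commShiftIso (-1 : ℤ)).hom.app _ ≫
          (α.app (op (K.unop⟦(-1 : ℤ)⟧)) ≫
            RΦ.map ((DerivedCategory.Q.commShiftIso (-1 : ℤ)).inv.app K.unop).op)⟦(-1 : ℤ)⟧'
      naturality := fun K L f ↦ by
        dsimp
        rw [← DerivedCategory.Q.map_comp_assoc]
        erw [shiftOnComplexes_naturality Φ f.unop]
        have h₁ := (DerivedCategory.Q.commShiftIso (-1 : ℤ)).hom.naturality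
          ((onComplexes Φ).map (f.unop⟦(-1 : ℤ)⟧').op)
        have h₂ := α.naturality (f.unop⟦(-1 : ℤ)⟧').op
        have h₃ := (DerivedCategory.Q.commShiftIso (-1 : ℤ)).inv.naturality f.unop
        dsimp at h₁ h₂ h₃
        rw [Functor.map_comp, Category.assoc, Category.assoc, Category.assoc,
          reassoc_of% h₁, ← Functor.map_comp, ← Functor.map_comp, reassoc_of% h₂, Category.assoc,
          ← Functor.map_comp, ← Functor.map_comp, ← op_comp, ← op_comp, h₃] }

/-- For an object `M` of `𝒜`, the identification `R¹Φ M ⟶ H⁰(RΦ (M[-1]))`. -/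
def shiftCohomology {Φ : 𝒜ᵒᵖ ⥤ ℬ} [Φ.Additive]
    (RΦ : (DerivedCategory 𝒜)ᵒᵖ ⥤ DerivedCategory ℬ)
    (α : toDerived Φ ⟶ (DerivedCategory.Q (C := 𝒜)).op ⋙ RΦ) [IsTotalDerived RΦ α] (M : 𝒜) :
    (cohomologyOn RΦ 1).obj (op M) ⟶ (DerivedCategory.homologyFunctor ℬ 0).obj
      (RΦ.obj (op (((DerivedCategory.singleFunctor 𝒜 0).obj M)⟦(-1 : ℤ)⟧))) :=
  (DerivedCategory.homologyFunctor ℬ 1).map ((shiftDerived RΦ α).app _) ≫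
    ((DerivedCategory.homologyFunctor ℬ 0).shiftIso (-1 : ℤ) 1 0 (by simp)).hom.app _

/-- For an object `M` of `𝒜`, the canonical isomorphism `H¹(M[-1]) ≅ M`. -/
def homologyShiftSingle (M : 𝒜) :
    (DerivedCategory.homologyFunctor 𝒜 1).obj
      (((DerivedCategory.singleFunctor 𝒜 0).obj M)⟦(-1 : ℤ)⟧) ≅ M :=
  ((DerivedCategory.homologyFunctor 𝒜 0).shiftIso (-1 : ℤ) 1 0 (by simp)).app _ ≪≫
    (DerivedCategory.singleFunctorCompHomologyFunctorIso 𝒜 0).app M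

/-- The map `γ : R¹Ψ R¹Φ A ⟶ A` satisfies `γ = H⁰(η̂_A)⁻¹ ∘ R⁰Ψ(π)`, where
`π : RΦ A ⟶ σ_{>0} RΦ A = (R¹Φ A)[-1]` is the morphism which induces the identity of
`R¹Φ A = H¹(RΦ A)` on `H¹`, and where `R¹Ψ R¹Φ A` is identified with `R⁰Ψ((R¹Φ A)[-1])`. -/
def IsNaturalMap {Ψ : ℬᵒᵖ ⥤ 𝒜} [Ψ.Additive]
    {RΦ : (DerivedCategory 𝒜)ᵒᵖ ⥤ DerivedCategory ℬ}
    {RΨ : (DerivedCategory ℬ)ᵒᵖ ⥤ DerivedCategory 𝒜}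
    (β : toDerived Ψ ⟶ (DerivedCategory.Q (C := ℬ)).op ⋙ RΨ) [IsTotalDerived RΨ β]
    (Radj : RΦ.rightOp ⊣ RΨ) (A : 𝒜)
    (γ : (cohomologyOn RΨ 1).obj (op ((cohomologyOn RΦ 1).obj (op A))) ⟶ A) : Prop :=
  ∃ π : RΦ.obj (op ((DerivedCategory.singleFunctor 𝒜 0).obj A)) ⟶
      ((DerivedCategory.singleFunctor ℬ 0).obj ((cohomologyOn RΦ 1).obj (op A)))⟦(-1 : ℤ)⟧,
    (DerivedCategory.homologyFunctor ℬ 1).map π ≫ (homologyShiftSingle _).hom = 𝟙 _ ∧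
    γ ≫ (DerivedCategory.singleFunctorCompHomologyFunctorIso 𝒜 0).inv.app A ≫
        (DerivedCategory.homologyFunctor 𝒜 0).map
          (Radj.unit.app ((DerivedCategory.singleFunctor 𝒜 0).obj A)) =
      shiftCohomology RΨ β ((cohomologyOn RΦ 1).obj (op A)) ≫
        (DerivedCategory.homologyFunctor 𝒜 0).map (RΨ.map π.op)

end DerivedDuality
end

universe v₃ u₃

set_option linter.unusedSectionVars false

noncomputable section

namespace DerivedDuality

section

variable {𝒜 : Type u₁} [Category.{v₁} 𝒜] [Abelian 𝒜]
  {ℬ : Type u₂} [Category.{v₂} ℬ] [Abelian ℬ]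

/-! ### Objects adapted to a left exact contravariant functor -/

/-! An adapted object plays the role of an acyclic one: `Φ` keeps all short exact sequences ending
in it exact. As right adjoints, `Φ` and `Ψ` are left exact, and the subcategories `𝓟`, `𝓠` matter
only through three facts, collected in `DualityData`: every object is a quotient of an adapted one;
subobjects of adapted objects are adapted, which is where cohomological dimension at most one
enters; and every `Ψ B` is adapted to `Φ`. They are obtained by applying `Φ` to complexes `B ⟶ X ⟶
C` that resolve an object.

By the first two facts even an unbounded complex has a resolution of length one by complexes with
adapted terms, and `Φ` preserves quasi-isomorphisms between such complexes. So `RΦ` exists and is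
computed by them (`IsDeriving`). It is moreover an absolute Kan extension, so the termwise units
induce derived units, and the triangle identities pass to `RΦ` and `RΨ`. By the third fact, `ΨΦ E`
computes `RΨ RΦ E` when `E` has adapted terms, so that `η̂_E` is invertible exactly when `E ⟶ ΨΦ E`
is a quasi-isomorphism.

For an object `A` there is a triangle `Φ A ⟶ RΦ A ⟶ (R¹Φ A)[-1]`. Let `A` be reflexive. Then `RΦ A`
is reflexive by the triangle identity. Since `R²Ψ (R¹Φ A) = 0`, the unit `A ⟶ ΨΦ A` is an
epimorphism; this forces `ξ_{Φ A}` to be invertible, so `Φ A` is reflexive too. Hence so is the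
third vertex, and `R¹Φ A` with it (`reflexive_cohomologyOn`).

The triangle identities for `γ` and `θ` are `H¹` of consequences of those for `η̂` and `ξ̂`. The
comparison uses that the derived units commute with the shift (`unit_shift`) and that a morphism
from degrees `≤ n` to degrees `≥ n` is detected by `Hⁿ`. -/

/-- An object `L` is adapted to the contravariant functor `Φ` if `Φ` preserves the exactness of
all short exact sequences `0 ⟶ B ⟶ X ⟶ L ⟶ 0`. -/
def Adapted (Φ : 𝒜ᵒᵖ ⥤ ℬ) : ObjectProperty 𝒜 :=
  fun L ↦ ∀ ⦃B X : 𝒜⦄ (i : B ⟶ X) (p : X ⟶ L) (w : i ≫ p = 0),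
    (ShortComplex.mk i p w).ShortExact → Epi (Φ.map i.op)

section

variable {Φ : 𝒜ᵒᵖ ⥤ ℬ}

lemma Adapted.of_iso {L L' : 𝒜} (hL : Adapted Φ L) (e : L ≅ L') : Adapted Φ L' := by
  intro B X i p w h
  refine hL i (p ≫ e.inv) (by rw [reassoc_of% w, zero_comp]) ?_
  let e' : ShortComplex.mk i p w ≅ ShortComplex.mk i (p ≫ e.inv)
      (by rw [reassoc_of% w, zero_comp]) :=
    ShortComplex.isoMk (Iso.refl _) (Iso.refl _) e.symm (by simp) (by simp)
  exact ShortComplex.shortExact_of_iso e' h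

lemma adapted_of_isZero {L : 𝒜} (hL : IsZero L) : Adapted Φ L := by
  intro B X i p w h
  have : Mono i := h.mono_f
  have : Epi i := h.exact.epi_f (hL.eq_of_tgt _ _)
  have : IsIso i := isIso_of_mono_of_epi i
  infer_instance

/-- The class of adapted objects is closed under extensions. -/
lemma Adapted.of_shortExact {S : ShortComplex 𝒜} (hS : S.ShortExact)
    (h₁ : Adapted Φ S.X₁) (h₃ : Adapted Φ S.X₃) : Adapted Φ S.X₂ := by
  intro B X i p w h
  have : Mono i := h.mono_f
  have : Epi p := h.epi_g
  have : Mono S.f := hS.mono_f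
  have : Epi S.g := hS.epi_g
  -- The preimage of `S.X₁` in `X` splits `i` into two monomorphisms, with cokernels `S.X₁` and
  -- `S.X₃`. `Φ` sends both to epimorphisms.
  let j : B ⟶ pullback p S.f := pullback.lift i 0 (by simp [w])
  have hj : j ≫ pullback.fst p S.f = i := pullback.lift_fst _ _ _
  have hj' : j ≫ pullback.snd p S.f = 0 := pullback.lift_snd _ _ _
  have : Mono j := mono_of_mono_fac hj
  have e₁ : Epi (Φ.map j.op) := by
    refine h₁ j (pullback.snd p S.f) hj' ?_
    refine { exact := ?_ }
    refine ShortComplex.exact_of_f_is_kernel _ (KernelFork.IsLimit.ofι _ _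
      (fun {A} k hk ↦ h.exact.lift (k ≫ pullback.fst _ _) ?_) (fun {A} k hk ↦ ?_)
      (fun {A} k hk m hm ↦ ?_))
    · dsimp at hk ⊢
      rw [Category.assoc, pullback.condition, reassoc_of% hk, zero_comp]
    · ext
      · dsimp; rw [Category.assoc, hj]
        exact h.exact.lift_f _ _
      · dsimp at hk ⊢
        simp [hj', hk]
    · dsimp at hm ⊢
      rw [← cancel_mono j, hm, ← cancel_mono (pullback.fst p S.f), Category.assoc, hj]
      exact (h.exact.lift_f _ _).symm
  have e₂ : Epi (Φ.map (pullback.fst p S.f).op) := by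
    refine h₃ (pullback.fst p S.f) (p ≫ S.g)
      (by rw [pullback.condition_assoc, S.zero, comp_zero]) ?_
    have : Epi (p ≫ S.g) := epi_comp _ _
    refine { exact := ?_ }
    refine ShortComplex.exact_of_f_is_kernel _ (KernelFork.IsLimit.ofι _ _
      (fun {A} k hk ↦ pullback.lift k (hS.exact.lift (k ≫ p) ?_) ?_) (fun {A} k hk ↦ ?_)
      (fun {A} k hk m hm ↦ ?_))
    · simpa using hk
    · exact (hS.exact.lift_f _ _).symm
    · exact pullback.lift_fst _ _ _
    · dsimp at hm ⊢
      rw [← cancel_mono (pullback.fst p S.f), hm, pullback.lift_fst]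
  rw [← hj, op_comp, Φ.map_comp]
  exact epi_comp _ _

variable [Φ.Additive]

lemma Adapted.biprod {L L' : 𝒜} (hL : Adapted Φ L) (hL' : Adapted Φ L') : Adapted Φ (L ⊞ L') :=
  Adapted.of_shortExact (S := ShortComplex.mk (biprod.inl : L ⟶ L ⊞ L') biprod.snd (by simp))
    (ShortComplex.Splitting.ofHasBinaryBiproduct L L').shortExact hL hL'

variable [PreservesFiniteLimits Φ]

lemma mono_map_op {X Y : 𝒜} (f : X ⟶ Y) [Epi f] : Mono (Φ.map f.op) := inferInstance

lemma shortExact_op_map {S : ShortComplex 𝒜} (hS : S.ShortExact) (h₃ : Adapted Φ S.X₃) :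
    (S.op.map Φ).ShortExact where
  exact := hS.op.exact.map_of_mono_of_preservesKernel Φ hS.op.mono_f inferInstance
  mono_f := by
    have := hS.epi_g
    exact mono_map_op S.g
  epi_g := h₃ S.f S.g S.zero hS

/-- Let `X₁ ⟶ X₂ ⟶ X₃ ⟶ L ⟶ 0` be an exact sequence. If `L` is adapted to `Φ`, then
`Φ X₃ ⟶ Φ X₂ ⟶ Φ X₁` is exact. -/
lemma exact_op_map {X₁ X₂ X₃ L : 𝒜} {f : X₁ ⟶ X₂} {g : X₂ ⟶ X₃} {p : X₃ ⟶ L} [Epi p]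
    {w : f ≫ g = 0} (hS : (ShortComplex.mk f g w).Exact) {w' : g ≫ p = 0}
    (hT : (ShortComplex.mk g p w').Exact) (hL : Adapted Φ L) :
    ((ShortComplex.mk f g w).op.map Φ).Exact := by
  -- Split `g` at its image `I`. Left exactness handles `X₁ ⟶ X₂ ⟶ I ⟶ 0`, and adaptedness of `L`
  -- makes `Φ X₃ ⟶ Φ I` an epimorphism, so that replacing `I` by `X₃` does not affect exactness.
  obtain ⟨I, π, ι, _, _, rfl⟩ : ∃ (I : 𝒜) (π : X₂ ⟶ I) (ι : I ⟶ X₃),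
      Epi π ∧ Mono ι ∧ π ≫ ι = g :=
    ⟨_, Abelian.factorThruImage g, Abelian.image.ι g, inferInstance, inferInstance,
      Abelian.image.fac g⟩
  have w₁ : f ≫ π = 0 := by rw [← cancel_mono ι, Category.assoc, w, zero_comp]
  have w₂ : ι ≫ p = 0 := by rw [← cancel_epi π, ← Category.assoc, w', comp_zero]
  have h₁ : (ShortComplex.mk f π w₁).Exact := by
    let φ : ShortComplex.mk f π w₁ ⟶ ShortComplex.mk f (π ≫ ι) w :=
      { τ₁ := 𝟙 _, τ₂ := 𝟙 _, τ₃ := ι }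
    have : Epi φ.τ₁ := by dsimp [φ]; infer_instance
    have : IsIso φ.τ₂ := by dsimp [φ]; infer_instance
    have : Mono φ.τ₃ := by dsimp [φ]; infer_instance
    exact (ShortComplex.exact_iff_of_epi_of_isIso_of_mono φ).2 hS
  have h₂ : (ShortComplex.mk ι p w₂).ShortExact := by
    refine { exact := ?_ }
    let φ : ShortComplex.mk (π ≫ ι) p w' ⟶ ShortComplex.mk ι p w₂ :=
      { τ₁ := π, τ₂ := 𝟙 _, τ₃ := 𝟙 _ }
    have : Epi φ.τ₁ := by dsimp [φ]; infer_instance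
    have : IsIso φ.τ₂ := by dsimp [φ]; infer_instance
    have : Mono φ.τ₃ := by dsimp [φ]; infer_instance
    exact (ShortComplex.exact_iff_of_epi_of_isIso_of_mono φ).1 hT
  have h₃ : ((ShortComplex.mk f π w₁).op.map Φ).Exact := by
    have : Mono (ShortComplex.mk f π w₁).op.f := inferInstanceAs (Mono π.op)
    exact h₁.op.map_of_mono_of_preservesKernel Φ inferInstance inferInstance
  let φ : ((ShortComplex.mk f (π ≫ ι) w).op.map Φ) ⟶ ((ShortComplex.mk f π w₁).op.map Φ) :=
    { τ₁ := Φ.map ι.op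
      τ₂ := 𝟙 (Φ.obj (op X₂))
      τ₃ := 𝟙 (Φ.obj (op X₁))
      comm₁₂ := by
        change Φ.map ι.op ≫ Φ.map π.op = Φ.map (π ≫ ι).op ≫ 𝟙 _
        simp
      comm₂₃ := by
        change 𝟙 _ ≫ Φ.map f.op = Φ.map f.op ≫ 𝟙 _
        simp }
  have : Epi φ.τ₁ := hL _ _ _ h₂
  have : IsIso φ.τ₂ := inferInstanceAs (IsIso (𝟙 _))
  have : Mono φ.τ₃ := inferInstanceAs (Mono (𝟙 _))
  exact (ShortComplex.exact_iff_of_epi_of_isIso_of_mono φ).2 h₃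

/-- Let `N` be a complex and `Nᵏ ⟶ L` a cokernel of the differential `Nᵏ⁻¹ ⟶ Nᵏ`. If `N` is exact in
degree `k - 1 = -n` and `L` is adapted to `Φ`, then `Φ N` is exact in degree `n`. -/
lemma exactAt_onComplexes {N : CochainComplex 𝒜 ℤ} (n k : ℤ) (hk : -n + 1 = k) {L : 𝒜}
    (p : N.X k ⟶ L) [Epi p] (w : N.d (-n) k ≫ p = 0)
    (h₁ : N.ExactAt (-n)) (h₂ : (ShortComplex.mk _ _ w).Exact) (hL : Adapted Φ L) :
    ((onComplexes Φ).obj (op N)).ExactAt n := by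
  obtain rfl : k = -(n - 1) := by lia
  rw [HomologicalComplex.exactAt_iff' _ (n - 1) n (n + 1) (by simp) (by simp)]
  rw [HomologicalComplex.exactAt_iff' _ (-(n + 1)) (-n) (-(n - 1)) (by simp; lia)
    (by simp; lia)] at h₁
  exact exact_op_map (p := p) h₁ h₂ hL

end

end

section

variable {𝒜 : Type u₁} [Category.{v₁} 𝒜] [Abelian 𝒜]
  {ℬ : Type u₂} [Category.{v₂} ℬ] [Abelian ℬ]

/-! ### Contravariant functors and mapping cones -/

lemma acyclic_mappingCone_iff {K L : CochainComplex 𝒜 ℤ} (f : K ⟶ L) :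
    (CochainComplex.mappingCone f).Acyclic ↔ QuasiIso f := by
  rw [← HomotopyCategory.quotient_obj_mem_subcategoryAcyclic_iff_acyclic]
  have h := HomotopyCategory.mappingCone_triangleh_distinguished f
  have := (HomotopyCategory.subcategoryAcyclic 𝒜).trW_iff_of_distinguished _ h
  refine this.symm.trans ?_
  rw [← HomotopyCategory.quasiIso_eq_trW_subcategoryAcyclic]
  exact HomotopyCategory.quotient_map_mem_quasiIso_iff f

lemma exactAt_shift_iff (K : CochainComplex 𝒜 ℤ) (n a a' : ℤ) (h : n + a = a') :
    (K⟦n⟧).ExactAt a ↔ K.ExactAt a' := by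
  rw [HomologicalComplex.exactAt_iff_isZero_homology,
    HomologicalComplex.exactAt_iff_isZero_homology]
  exact ((CochainComplex.ShiftSequence.shiftIso 𝒜 n a a' h).app K).isZero_iff

/-- The short complex `L ⟶ cone f ⟶ K[1]`. -/
abbrev coneShortComplex {K L : CochainComplex 𝒜 ℤ} (f : K ⟶ L) :
    ShortComplex (CochainComplex 𝒜 ℤ) :=
  CochainComplex.mappingCone.triangleRotateShortComplex f

lemma coneShortComplex_shortExact {K L : CochainComplex 𝒜 ℤ} (f : K ⟶ L) :
    (coneShortComplex f).ShortExact :=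
  HomologicalComplex.shortExact_of_degreewise_shortExact _
    (fun n ↦ (CochainComplex.mappingCone.triangleRotateShortComplexSplitting f n).shortExact)

/-- Isomorphisms in degrees `n` and `n + 1` identify the cycles. Nothing is assumed in degree `n -
1`, so the map on homology is only an epimorphism, which suffices here. -/
lemma exactAt_of_isIso_f {K L : CochainComplex 𝒜 ℤ} (φ : K ⟶ L) (n m : ℤ) (h : n + 1 = m)
    [IsIso (φ.f n)] [IsIso (φ.f m)] (hK : K.ExactAt n) : L.ExactAt n := by
  rw [HomologicalComplex.exactAt_iff' _ (n - 1) n m (by simp) (by simp [h]),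
    ShortComplex.exact_iff_isZero_homology] at hK ⊢
  let ψ := (HomologicalComplex.shortComplexFunctor' 𝒜 (ComplexShape.up ℤ) (n - 1) n m).map φ
  have : IsIso ψ.τ₂ := inferInstanceAs (IsIso (φ.f n))
  have : IsIso ψ.τ₃ := inferInstanceAs (IsIso (φ.f m))
  exact IsZero.of_epi (ShortComplex.homologyMap ψ) hK

lemma isIso_ιTruncLE_f (K : CochainComplex 𝒜 ℤ) (n i : ℤ) (hi : i < n) :
    IsIso ((K.ιTruncLE n).f i) := by
  obtain ⟨j, rfl⟩ : ∃ j : ℕ, n - j = i := ⟨(n - i).toNat, by lia⟩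
  -- The truncation replaces a term by its cycles only in the boundary degree `j = 0`, that is `i =
  -- n`.
  have hj : ¬ (ComplexShape.embeddingUpIntLE n).BoundaryLE j := by
    rw [ComplexShape.boundaryLE_embeddingUpIntLE_iff]
    lia
  have : IsIso ((HomologicalComplex.πTruncGE K.op
      (ComplexShape.embeddingUpIntLE n).op).f (n - j)) := by
    have := HomologicalComplex.isIso_restrictionToTruncGE' K.op
      (ComplexShape.embeddingUpIntLE n).op j hj
    exact (ComplexShape.Embedding.isIso_liftExtend_f_iff _ _ _ rfl).2 this
  change IsIso ((HomologicalComplex.πTruncGE K.op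
      (ComplexShape.embeddingUpIntLE n).op).f (n - j)).unop
  infer_instance

section

variable {Φ : 𝒜ᵒᵖ ⥤ ℬ} [Φ.Additive]

instance (K : CochainComplex 𝒜 ℤ) : IsIso (shiftOnComplexes Φ K) := by
  have (n : ℤ) : IsIso ((shiftOnComplexes Φ K).f n) := by
    change IsIso (Φ.map (K.XIsoOfEq (by lia : -(n + -1) + -1 = -n)).hom.op)
    infer_instance
  exact HomologicalComplex.Hom.isIso_of_components _

instance : (onComplexes Φ).Additive where
  map_add {K L f g} := by
    ext n
    change Φ.map ((f.unop + g.unop).f (-n)).op = Φ.map (f.unop.f (-n)).op + Φ.map (g.unop.f (-n)).op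
    simp

lemma onComplexes_map_eq_of_homotopy {K L : CochainComplex 𝒜 ℤ} {f g : K ⟶ L}
    (h : Homotopy f g) :
    Nonempty (Homotopy ((onComplexes Φ).map f.op) ((onComplexes Φ).map g.op)) :=
  ⟨Φ.mapHomotopy (CochainComplex.homotopyOp h)⟩

lemma exactAt_onComplexes_shift_iff (K : CochainComplex 𝒜 ℤ) (n m : ℤ) (h : n + 1 = m) :
    ((onComplexes Φ).obj (op (K⟦(1 : ℤ)⟧))).ExactAt m ↔
      ((onComplexes Φ).obj (op K)).ExactAt n := by
  let e : (onComplexes Φ).obj (op (K⟦(1 : ℤ)⟧)) ≅ ((onComplexes Φ).obj (op K))⟦(-1 : ℤ)⟧ :=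
    asIso (shiftOnComplexes Φ (K⟦(1 : ℤ)⟧)) ≪≫
      (shiftFunctor _ (-1 : ℤ)).mapIso ((onComplexes Φ).mapIso
        ((shiftShiftNeg K (1 : ℤ)).symm.op))
  rw [← exactAt_shift_iff _ (-1) m n (by lia)]
  exact ⟨fun h ↦ h.of_iso e, fun h ↦ h.of_iso e.symm⟩

lemma onComplexes_shortExact [PreservesFiniteLimits Φ] {S : ShortComplex (CochainComplex 𝒜 ℤ)}
    (hS : S.ShortExact) (h : ∀ n, Adapted Φ (S.X₃.X n)) :
    (S.op.map (onComplexes Φ)).ShortExact :=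
  HomologicalComplex.shortExact_of_degreewise_shortExact _ (fun n ↦
    shortExact_op_map (hS.map_of_exact (HomologicalComplex.eval 𝒜 (ComplexShape.up ℤ) (-n))) (h _))

lemma onComplexes_coneShortComplex_shortExact {K L : CochainComplex 𝒜 ℤ} (f : K ⟶ L) :
    ((coneShortComplex f).op.map (onComplexes Φ)).ShortExact :=
  HomologicalComplex.shortExact_of_degreewise_shortExact _ (fun n ↦
    ((CochainComplex.mappingCone.triangleRotateShortComplexSplitting f (-n)).op.map Φ).shortExact)

lemma adapted_mappingCone [PreservesFiniteLimits Φ] {K L : CochainComplex 𝒜 ℤ} (f : K ⟶ L) (n m : ℤ)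
    (h : n + 1 = m) (hK : Adapted Φ (K.X m)) (hL : Adapted Φ (L.X n)) :
    Adapted Φ ((CochainComplex.mappingCone f).X n) :=
  (hK.biprod hL).of_iso (HomologicalComplex.homotopyCofiber.XIsoBiprod f n m h).symm

lemma isZero_mappingCone {K L : CochainComplex 𝒜 ℤ} (f : K ⟶ L) (n m : ℤ)
    (h : n + 1 = m) (hK : IsZero (K.X m)) (hL : IsZero (L.X n)) :
    IsZero ((CochainComplex.mappingCone f).X n) :=
  IsZero.of_iso (by
    rw [biprod_isZero_iff]
    exact ⟨hK, hL⟩) (HomologicalComplex.homotopyCofiber.XIsoBiprod f n m h)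

/-! ### Vanishing of cohomology implies adaptedness -/

/-- As `N` vanishes in degree `j`, the term in degree `i` is the cokernel of the differential `N⁻ⁿ ⟶
N⁻ⁿ⁺¹`, so only this single term has to be adapted. -/
lemma exactAt_onComplexes_of_acyclic [PreservesFiniteLimits Φ] {N : CochainComplex 𝒜 ℤ}
    (hN : N.Acyclic) (n i j : ℤ) (hi : -n + 2 = i) (hj : -n + 3 = j)
    (h₁ : Adapted Φ (N.X i)) (h₂ : IsZero (N.X j)) :
    ((onComplexes Φ).obj (op N)).ExactAt n := by
  have h₃ := hN i
  rw [HomologicalComplex.exactAt_iff' _ (-n + 1) i j (by simp; lia) (by simp; lia)] at h₃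
  have : Epi (N.d (-n + 1) i) := h₃.epi_f (h₂.eq_of_tgt _ _)
  refine exactAt_onComplexes n (-n + 1) rfl (N.d (-n + 1) i) (by simp) (hN _) ?_ h₁
  have h₄ := hN (-n + 1)
  rwa [HomologicalComplex.exactAt_iff' _ (-n) (-n + 1) i (by simp) (by simp; lia)] at h₄

/-- Truncating `P` at `0` alters terms of `Φ P` only in degrees `≤ 0`. For `n = 1` the degree `n -
1` may therefore change, but exactness at `n` survives this. -/
lemma exactAt_onComplexes_truncLE (P : CochainComplex 𝒜 ℤ) (n : ℤ) (hn : 0 < n)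
    (h : ((onComplexes Φ).obj (op P)).ExactAt n) :
    ((onComplexes Φ).obj (op (P.truncLE 0))).ExactAt n := by
  let φ := (onComplexes Φ).map (P.ιTruncLE 0).op
  have hφ (m : ℤ) (hm : 0 < m) : IsIso (φ.f m) := by
    have := isIso_ιTruncLE_f P 0 (-m) (by lia)
    change IsIso (Φ.map ((P.ιTruncLE 0).f (-m)).op)
    infer_instance
  have := hφ n hn
  have := hφ (n + 1) (by lia)
  exact exactAt_of_isIso_f φ n (n + 1) rfl h

/-- Let `P ⟶ K` be a quasi-isomorphism, where `K` is concentrated in degrees `≤ 0`.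
For `n = 1`, or for `n = 2` if `K⁰` is adapted to `Φ`, the complex `Φ K` is exact in degree `n`
if `Φ P` is. -/
lemma exactAt_onComplexes_of_quasiIso [PreservesFiniteLimits Φ] {P K : CochainComplex 𝒜 ℤ}
    (f : P ⟶ K) [QuasiIso f] [K.IsStrictlyLE 0] (n i : ℤ) (hn : 0 < n) (hn' : n ≤ 2)
    (hi : -n + 2 = i) (h₁ : Adapted Φ (K.X i)) (h : ((onComplexes Φ).obj (op P)).ExactAt n) :
    ((onComplexes Φ).obj (op K)).ExactAt n := by
  have : P.IsLE 0 := by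
    rw [CochainComplex.isLE_iff]
    intro j hj
    rw [← quasiIsoAt_iff_exactAt' f j]
    · infer_instance
    · exact CochainComplex.exactAt_of_isLE K 0 j hj
  -- Nothing is known about the terms of `P`; truncation makes those in positive degrees vanish, so
  -- that they do not disturb the top of the cone.
  let f' := P.ιTruncLE 0 ≫ f
  have hf' : (CochainComplex.mappingCone f').Acyclic := by
    rw [acyclic_mappingCone_iff]
    infer_instance
  have h₂ : ((onComplexes Φ).obj (op (CochainComplex.mappingCone f'))).ExactAt n := by
    -- In degree `i ≥ 0` the cone is `0 ⊞ Kⁱ`, since `P` has been truncated; in degree `i + 1 ≥ 1`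
    -- it is zero. Both bounds come from `n ≤ 2`.
    refine exactAt_onComplexes_of_acyclic hf' n i (i + 1) hi (by lia) ?_ ?_
    · exact adapted_mappingCone f' i (i + 1) rfl
        (adapted_of_isZero (CochainComplex.isZero_of_isStrictlyLE _ 0 _ (by lia))) h₁
    · exact isZero_mappingCone f' (i + 1) (i + 2) (by lia)
        (CochainComplex.isZero_of_isStrictlyLE _ 0 _ (by lia))
        (CochainComplex.isZero_of_isStrictlyLE _ 0 _ (by lia))
  have hS := onComplexes_coneShortComplex_shortExact (Φ := Φ) f'
  have h₃ := (exactAt_onComplexes_shift_iff _ n (n + 1) rfl).2 (exactAt_onComplexes_truncLE P n hn h)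
  rw [HomologicalComplex.exactAt_iff_isZero_homology] at h₂ h₃ ⊢
  exact (hS.homology_exact₃ n (n + 1) rfl).isZero_X₂ (h₂.eq_of_src _ _) (h₃.eq_of_tgt _ _)

end

end

section

variable {𝒜 : Type u₁} [Category.{v₁} 𝒜] [Abelian 𝒜] {ℬ : Type u₂} [Category.{v₂} ℬ] [Abelian ℬ]

/-! ### Complexes with three terms -/

open ZeroObject

section ThreeTerm

variable {A B C : 𝒜} (f : A ⟶ B) (g : B ⟶ C) (w : f ≫ g = 0)

/-- The terms of the complex `A ⟶ B ⟶ C` in degrees `-2`, `-1`, `0`. -/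
def threeTermX (A B C : 𝒜) : ℤ → 𝒜
  | .negSucc 1 => A
  | .negSucc 0 => B
  | .ofNat 0 => C
  | _ => 0

/-- The differentials of the complex `A ⟶ B ⟶ C` in degrees `-2`, `-1`, `0`. -/
def threeTermD : ∀ i j : ℤ, threeTermX A B C i ⟶ threeTermX A B C j
  | .negSucc 1, .negSucc 0 => f
  | .negSucc 0, .ofNat 0 => g
  | _, _ => 0

lemma threeTermD_eq_zero (i j : ℤ) (h : i + 1 ≠ j) : threeTermD f g i j = 0 := by
  match i, j with
  | .ofNat _, _ => rfl
  | .negSucc (_ + 2), _ => rfl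
  | .negSucc 0, .ofNat 0 => exact (h rfl).elim
  | .negSucc 0, .ofNat (_ + 1) => rfl
  | .negSucc 0, .negSucc _ => rfl
  | .negSucc 1, .negSucc 0 => exact (h rfl).elim
  | .negSucc 1, .negSucc (_ + 1) => rfl
  | .negSucc 1, .ofNat _ => rfl

/-- The complex `A ⟶ B ⟶ C` in degrees `-2`, `-1`, `0`. -/
def threeTerm : CochainComplex 𝒜 ℤ where
  X := threeTermX A B C
  d := threeTermD f g
  shape i j hij := threeTermD_eq_zero f g i j hij
  d_comp_d' i j k hij hjk := by
    obtain rfl : i + 1 = j := hij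
    obtain rfl : i + 1 + 1 = k := hjk
    by_cases hi : i = -2
    · subst hi
      exact w
    · have : threeTermD f g i (i + 1) = 0 ∨ threeTermD f g (i + 1) (i + 1 + 1) = 0 := by
        by_cases hi' : i = -1
        · subst hi'
          exact Or.inr rfl
        · left
          match i with
          | .ofNat _ => rfl
          | .negSucc (_ + 2) => rfl
          | .negSucc 0 => exact (hi' rfl).elim
          | .negSucc 1 => exact (hi rfl).elim
      obtain h | h := this <;> simp [h]

lemma isZero_threeTerm_X (i : ℤ) (h : i ≠ -2) (h' : i ≠ -1) (h'' : i ≠ 0) :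
    IsZero ((threeTerm f g w).X i) := by
  change IsZero (threeTermX A B C i)
  unfold threeTermX
  split <;> first | exact isZero_zero _ | lia

instance : (threeTerm f g w).IsStrictlyLE 0 := by
  rw [CochainComplex.isStrictlyLE_iff]
  intro i hi
  exact isZero_threeTerm_X f g w i (by lia) (by lia) (by lia)

instance : (threeTerm f g w).IsStrictlyGE (-2) := by
  rw [CochainComplex.isStrictlyGE_iff]
  intro i hi
  exact isZero_threeTerm_X f g w i (by lia) (by lia) (by lia)

/-- Being bounded, the complex belongs to `K*` for each of the four choices of `*`, so it always has
a resolution in `𝓟`. -/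
lemma holds_threeTerm (b : Boundedness) : b.Holds (threeTerm f g w) := by
  cases b
  · trivial
  · exact ⟨-2, inferInstance⟩
  · exact ⟨0, inferInstance⟩
  · exact ⟨⟨-2, inferInstance⟩, 0, inferInstance⟩

/-- The augmentation of the complex `A ⟶ B ⟶ C`. -/
def threeTermAugmentation {D : 𝒜} (p : C ⟶ D) (w' : g ≫ p = 0) :
    threeTerm f g w ⟶ (HomologicalComplex.single 𝒜 (ComplexShape.up ℤ) 0).obj D :=
  HomologicalComplex.mkHomToSingle (K := threeTerm f g w) (j := 0) p (by
    intro i hi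
    obtain rfl : i = -1 := by
      change i + 1 = 0 at hi
      lia
    exact w')

lemma threeTermAugmentation_f {D : 𝒜} (p : C ⟶ D) (w' : g ≫ p = 0) :
    (threeTermAugmentation f g w p w').f 0 =
      (show (threeTerm f g w).X 0 ⟶ D from p) ≫
        (HomologicalComplex.singleObjXSelf (ComplexShape.up ℤ) 0 D).inv :=
  HomologicalComplex.mkHomToSingle_f _ _

lemma quasiIso_threeTermAugmentation [Mono f] (h : (ShortComplex.mk f g w).Exact)
    {D : 𝒜} (p : C ⟶ D) [Epi p] (w' : g ≫ p = 0) (h' : (ShortComplex.mk g p w').Exact) :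
    QuasiIso (threeTermAugmentation f g w p w') where
  quasiIsoAt n := by
    by_cases hn : n = 0
    · subst hn
      rw [quasiIsoAt_iff' _ (-1) 0 1 (by simp) (by simp),
        ShortComplex.quasiIso_iff_of_zeros']
      · refine ⟨?_, ?_⟩
        · refine (ShortComplex.exact_iff_of_iso ?_).2 h'
          refine ShortComplex.isoMk (Iso.refl _) (Iso.refl _)
            (HomologicalComplex.singleObjXSelf (ComplexShape.up ℤ) 0 D) ?_ ?_
          · exact (Category.id_comp _).trans (Category.comp_id _).symm
          · refine (Category.id_comp _).trans ?_
            change p = (threeTermAugmentation f g w p w').f 0 ≫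
              (HomologicalComplex.singleObjXSelf (ComplexShape.up ℤ) 0 D).hom
            rw [threeTermAugmentation_f, Category.assoc, Iso.inv_hom_id]
            exact (Category.comp_id p).symm
        · change Epi ((threeTermAugmentation f g w p w').f 0)
          rw [threeTermAugmentation_f]
          have : Epi (p ≫ (HomologicalComplex.singleObjXSelf (ComplexShape.up ℤ) 0 D).inv) :=
            inferInstance
          exact this
      · exact (isZero_threeTerm_X f g w 1 (by lia) (by lia) (by lia)).eq_of_tgt _ _
      · exact (HomologicalComplex.isZero_single_obj_X (ComplexShape.up ℤ) 0 D (-1) (by lia)).eq_of_src _ _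
      · exact (HomologicalComplex.isZero_single_obj_X (ComplexShape.up ℤ) 0 D 1 (by lia)).eq_of_tgt _ _
    · rw [quasiIsoAt_iff_exactAt']
      · by_cases h₁ : n = -1
        · subst h₁
          rw [HomologicalComplex.exactAt_iff' _ (-2) (-1) 0 (by simp) (by simp)]
          exact h
        · by_cases h₂ : n = -2
          · subst h₂
            rw [HomologicalComplex.exactAt_iff' _ (-3) (-2) (-1) (by simp) (by simp)]
            refine (ShortComplex.exact_iff_mono _ ?_).2 ?_
            · exact (isZero_threeTerm_X f g w (-3) (by lia) (by lia) (by lia)).eq_of_src _ _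
            · assumption
          · exact HomologicalComplex.ExactAt.of_isZero (isZero_threeTerm_X f g w n h₂ h₁ hn)
      · exact HomologicalComplex.exactAt_single_obj _ _ _ _ hn

end ThreeTerm

/-! ### Adapted objects from the vanishing of derived functors -/

section

variable {Φ : 𝒜ᵒᵖ ⥤ ℬ} [Φ.Additive] [PreservesFiniteLimits Φ] {b : Boundedness}
  {𝓟 : ObjectProperty (HomotopyCategory 𝒜 (ComplexShape.up ℤ))}

/-- If `A ⟶ B ⟶ C` is a complex resolving `D` such that `Hⁿ(R*Φ D) = 0`, then `Φ` of this
complex is exact in degree `n` for `n = 1`, or for `n = 2` if `C` is adapted to `Φ`. -/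
lemma exactAt_onComplexes_threeTerm (h𝓟 : IsResolving Φ b 𝓟) {A B C D : 𝒜}
    (f : A ⟶ B) (g : B ⟶ C) (p : C ⟶ D) (w : f ≫ g = 0) (w' : g ≫ p = 0) [Mono f] [Epi p]
    (h : (ShortComplex.mk f g w).Exact) (h' : (ShortComplex.mk g p w').Exact)
    (n i : ℤ) (hn : 0 < n) (hn' : n ≤ 2) (hi : -n + 2 = i)
    (h₁ : Adapted Φ ((threeTerm f g w).X i)) (h₂ : DerivedVanishesAt Φ 𝓟 D n) :
    ((onComplexes Φ).obj (op (threeTerm f g w))).ExactAt n := by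
  obtain ⟨P, q, hP, _⟩ := h𝓟.exists_quasiIso _ (holds_threeTerm f g w b)
  have := quasiIso_threeTermAugmentation f g w h p w' h'
  refine exactAt_onComplexes_of_quasiIso q n i hn hn' hi h₁ ?_
  rw [HomologicalComplex.exactAt_iff_isZero_homology]
  exact h₂ P (q ≫ threeTermAugmentation f g w p w') hP inferInstance

/-- For `0 ⟶ B ⟶ X ⟶ L ⟶ 0`, the complex `B ⟶ X` in degrees `-1` and `0` resolves `L`. Exactness of
`Φ X ⟶ Φ B ⟶ 0` at `Φ B` is then the vanishing of `H¹(R*Φ L)`. -/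
lemma Adapted.of_isAcyclicObject (h𝓟 : IsResolving Φ b 𝓟) {L : 𝒜}
    (hL : IsAcyclicObject Φ 𝓟 L) : Adapted Φ L := by
  intro B X i p w h
  have : Epi p := h.epi_g
  have : Mono i := h.mono_f
  have h₀ : ((onComplexes Φ).obj (op (threeTerm (0 : (0 : 𝒜) ⟶ B) i (by simp)))).ExactAt 1 := by
    refine exactAt_onComplexes_threeTerm h𝓟 _ i p _ w ?_ h.exact 1 1 (by lia) (by lia) (by lia) ?_
      (hL 1 (by lia))
    · exact (ShortComplex.exact_iff_mono _ rfl).2 inferInstance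
    · exact adapted_of_isZero (isZero_threeTerm_X _ _ _ _ (by lia) (by lia) (by lia))
  rw [HomologicalComplex.exactAt_iff' _ 0 1 2 (by simp) (by simp)] at h₀
  exact h₀.epi_f ((Φ.map_isZero (isZero_zero _).op).eq_of_tgt _ _)

/-- If `Φ` has cohomological dimension at most one, then subobjects of adapted objects
are adapted. -/
lemma Adapted.of_mono (h𝓟 : IsResolving Φ b 𝓟) (hΦ : CohomologicalDimensionLE Φ 𝓟 1)
    {A L : 𝒜} (j : A ⟶ L) [Mono j] (hL : Adapted Φ L) : Adapted Φ A := by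
  intro B X i p w h
  have : Epi p := h.epi_g
  have : Mono i := h.mono_f
  have w' : i ≫ p ≫ j = 0 := by simp [reassoc_of% w]
  -- The complex `B ⟶ X ⟶ L`, with `L` in degree `0`, resolves `L / A`. Its dual ends in `Φ X ⟶ Φ B
  -- ⟶ 0` in degrees `1`, `2`, `3`, and `H²(R*Φ (L / A)) = 0` by the dimension hypothesis.
  have h₀ : ((onComplexes Φ).obj (op (threeTerm i (p ≫ j) w'))).ExactAt 2 := by
    refine exactAt_onComplexes_threeTerm h𝓟 i (p ≫ j) (cokernel.π (p ≫ j)) _ (by simp) ?_ ?_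
      2 0 (by lia) (by lia) (by lia) hL (hΦ _ 2 (by simp))
    · rw [ShortComplex.exact_iff_exact_up_to_refinements]
      intro T x hx
      dsimp at x hx
      rw [← Category.assoc, ← zero_comp (f := j), cancel_mono] at hx
      exact h.exact.exact_up_to_refinements x hx
    · exact ShortComplex.exact_cokernel (p ≫ j)
  rw [HomologicalComplex.exactAt_iff' _ 1 2 3 (by simp) (by simp)] at h₀
  exact h₀.epi_f ((Φ.map_isZero (isZero_threeTerm_X i (p ≫ j) w' (-3)
    (by lia) (by lia) (by lia)).op).eq_of_tgt _ _)

end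

/-- The consequences of the assumptions on an adjoint pair of contravariant functors by which
the derived adjunction is constructed. -/
structure DualityData (Φ : 𝒜ᵒᵖ ⥤ ℬ) (Ψ : ℬᵒᵖ ⥤ 𝒜) : Prop where
  preservesFiniteLimits : PreservesFiniteLimits Φ
  exists_epi (A : 𝒜) : ∃ (L : 𝒜) (p : L ⟶ A), Epi p ∧ Adapted Φ L
  of_mono {A L : 𝒜} (j : A ⟶ L) [Mono j] (hL : Adapted Φ L) : Adapted Φ A
  adapted_obj (B : ℬ) : Adapted Φ (Ψ.obj (op B))

/-- For the last property, an epimorphism `L' ⟶ B` with `Ψ L'` acyclic for `Φ` yields a monomorphism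
`Ψ B ⟶ Ψ L'` into an adapted object. -/
lemma dualityData {Φ : 𝒜ᵒᵖ ⥤ ℬ} {Ψ : ℬᵒᵖ ⥤ 𝒜} [Φ.Additive] [Ψ.Additive]
    (adj : Φ.rightOp ⊣ Ψ) {b : Boundedness}
    {𝓟 : ObjectProperty (HomotopyCategory 𝒜 (ComplexShape.up ℤ))}
    {𝓠 : ObjectProperty (HomotopyCategory ℬ (ComplexShape.up ℤ))}
    (h𝓟 : IsResolving Φ b 𝓟) (h𝒜 : EnoughAcyclic Φ Ψ 𝓟 𝓠) (hℬ : EnoughAcyclic Ψ Φ 𝓠 𝓟)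
    (hΦ : CohomologicalDimensionLE Φ 𝓟 1) : DualityData Φ Ψ := by
  have adj' : Ψ.rightOp ⊣ Φ := adj.rightOp
  have : PreservesLimits Φ := adj'.rightAdjoint_preservesLimits
  have : PreservesLimits Ψ := adj.rightAdjoint_preservesLimits
  have : PreservesFiniteLimits Φ := inferInstance
  refine ⟨this, fun A ↦ ?_, fun j _ hL ↦ hL.of_mono h𝓟 hΦ j, fun B ↦ ?_⟩
  · obtain ⟨L, p, hp, hL, _⟩ := h𝒜 A
    exact ⟨L, p, hp, .of_isAcyclicObject h𝓟 hL⟩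
  · obtain ⟨L, p, hp, _, hL⟩ := hℬ B
    have : Mono (Ψ.map p.op) := inferInstance
    exact Adapted.of_mono h𝓟 hΦ (Ψ.map p.op) (.of_isAcyclicObject h𝓟 hL)

end

section

variable {𝒜 : Type u₁} [Category.{v₁} 𝒜] [Abelian 𝒜] {ℬ : Type u₂} [Category.{v₂} ℬ] [Abelian ℬ]

/-! ### Complexes with adapted terms -/

lemma quasiIso_g_of_acyclic {S : ShortComplex (CochainComplex 𝒜 ℤ)} (hS : S.ShortExact)
    (h : S.X₁.Acyclic) : QuasiIso S.g where
  quasiIsoAt n := by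
    have h' (i : ℤ) := (HomologicalComplex.exactAt_iff_isZero_homology _ _).1 (h i)
    rw [quasiIsoAt_iff_isIso_homologyMap]
    have : Mono (HomologicalComplex.homologyMap S.g n) :=
      (hS.homology_exact₂ n).mono_g ((h' n).eq_of_src _ _)
    have : Epi (HomologicalComplex.homologyMap S.g n) :=
      (hS.homology_exact₃ n (n + 1) rfl).epi_f ((h' (n + 1)).eq_of_tgt _ _)
    exact isIso_of_mono_of_epi _

lemma quasiIso_f_of_acyclic {S : ShortComplex (CochainComplex 𝒜 ℤ)} (hS : S.ShortExact)
    (h : S.X₃.Acyclic) : QuasiIso S.f where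
  quasiIsoAt n := by
    have h' (i : ℤ) := (HomologicalComplex.exactAt_iff_isZero_homology _ _).1 (h i)
    rw [quasiIsoAt_iff_isIso_homologyMap]
    have : Epi (HomologicalComplex.homologyMap S.f n) :=
      (hS.homology_exact₂ n).epi_f ((h' n).eq_of_tgt _ _)
    have : Mono (HomologicalComplex.homologyMap S.f n) :=
      (hS.homology_exact₁ (n - 1) n (by simp)).mono_g ((h' (n - 1)).eq_of_src _ _)
    exact isIso_of_mono_of_epi _

lemma acyclic_X₁_of_quasiIso_g {S : ShortComplex (CochainComplex 𝒜 ℤ)} (hS : S.ShortExact)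
    [QuasiIso S.g] : S.X₁.Acyclic := by
  intro n
  rw [HomologicalComplex.exactAt_iff_isZero_homology]
  refine (hS.homology_exact₁ (n - 1) n (by simp)).isZero_X₂ ?_ ?_
  · rw [← cancel_epi (HomologicalComplex.homologyMap S.g (n - 1)), comp_zero]
    exact hS.comp_δ (n - 1) n (by simp)
  · rw [← cancel_mono (HomologicalComplex.homologyMap S.g n), zero_comp,
      ← HomologicalComplex.homologyMap_comp, S.zero, HomologicalComplex.homologyMap_zero]

/-- The property of complexes of having terms adapted to `Φ`. -/
def AdaptedTerms (Φ : 𝒜ᵒᵖ ⥤ ℬ) : ObjectProperty (CochainComplex 𝒜 ℤ) :=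
  fun K ↦ ∀ n, Adapted Φ (K.X n)

/-- The complex with zero differentials whose term in degree `n` is `L (n - 1)`. -/
def shiftedGraded (L : ℤ → 𝒜) : CochainComplex 𝒜 ℤ where
  X n := L (n - 1)
  d _ _ := 0

section

variable {Φ : 𝒜ᵒᵖ ⥤ ℬ} {Ψ : ℬᵒᵖ ⥤ 𝒜} [Φ.Additive] (h : DualityData Φ Ψ)

include h

/-- Choose adapted covers `L n ⟶ Kⁿ` and take the cone of the identity of the graded object `G`. Its
degree `n` term is `L n ⊞ L (n - 1)`, mapped to `Kⁿ` by the cover and by the differential applied to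
the previous cover. The first component alone is an epimorphism. -/
lemma DualityData.exists_contractible_epi (K : CochainComplex 𝒜 ℤ) :
    ∃ (P : CochainComplex 𝒜 ℤ) (p : P ⟶ K), Epi p ∧ P.Acyclic ∧ AdaptedTerms Φ P := by
  have := h.preservesFiniteLimits
  choose L q hq hL using fun n ↦ h.exists_epi (K.X n)
  let G := shiftedGraded L
  let a : CochainComplex.HomComplex.Cochain G K (-1) :=
    CochainComplex.HomComplex.Cochain.mk (fun i j hij ↦ q (i - 1) ≫
      (K.XIsoOfEq (by lia : i - 1 = j)).hom)
  let β : G ⟶ K :=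
    { f n := a.v n (n - 1) (by lia) ≫ K.d (n - 1) n
      comm' i j hij := by
        rw [Category.assoc, K.d_comp_d, comp_zero]
        exact zero_comp.symm }
  -- Since `G` has zero differential, the coboundary of `a` reduces to `a` followed by the
  -- differential of `K`, which is `β`.
  have ha : CochainComplex.HomComplex.δ (-1) 0 a =
      CochainComplex.HomComplex.Cochain.ofHom (𝟙 G ≫ β) := by
    ext n
    rw [CochainComplex.HomComplex.δ_v (-1) 0 (by simp) a n n (by simp) (n - 1) (n + 1) rfl (by simp)]
    have : G.d n (n + 1) = 0 := rfl
    rw [this, zero_comp, smul_zero, add_zero]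
    simp [β]
  refine ⟨CochainComplex.mappingCone (𝟙 G), CochainComplex.mappingCone.desc _ a β ha, ?_, ?_, ?_⟩
  · have (n : ℤ) : Epi ((CochainComplex.mappingCone.desc (𝟙 G) a β ha).f n) := by
      have h₁ := CochainComplex.mappingCone.inl_v_desc_f (𝟙 G) a β ha (n + 1) n (by lia)
      have : Epi (a.v (n + 1) n (by lia)) := by
        have := hq (n + 1 - 1)
        have : Epi (q (n + 1 - 1) ≫ (K.XIsoOfEq (by lia : n + 1 - 1 = n)).hom) := inferInstance
        exact this
      rw [← h₁] at this
      exact epi_of_epi ((CochainComplex.mappingCone.inl (𝟙 G)).v (n + 1) n _) _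
    exact HomologicalComplex.epi_of_epi_f _ this
  · rw [acyclic_mappingCone_iff]
    infer_instance
  · intro n
    exact adapted_mappingCone _ n (n + 1) rfl (hL _) (hL _)

/-- Every complex admits a quasi-isomorphism from a complex with adapted terms. -/
lemma DualityData.exists_resolution (K : CochainComplex 𝒜 ℤ) :
    ∃ (E : CochainComplex 𝒜 ℤ) (f : E ⟶ K), AdaptedTerms Φ E ∧ QuasiIso f := by
  have := h.preservesFiniteLimits
  obtain ⟨P, p, _, _, hP⟩ := h.exists_contractible_epi K
  -- The kernel of `p` again has adapted terms, as subobjects of those of `P`. The resolution thus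
  -- stops after one step, and the cone of `ker p ⟶ P` works without any boundedness.
  let S := ShortComplex.mk (kernel.ι p) p (by simp)
  have hS : S.ShortExact :=
    { exact := ShortComplex.exact_kernel p
      mono_f := inferInstanceAs (Mono (kernel.ι p))
      epi_g := by assumption }
  refine ⟨_, CochainComplex.mappingCone.descShortComplex S, fun n ↦ ?_,
    CochainComplex.mappingCone.quasiIso_descShortComplex hS⟩
  exact adapted_mappingCone _ n (n + 1) rfl
    (h.of_mono ((kernel.ι p).f (n + 1)) (hP _)) (hP _)

/-- The cokernel of each differential of `N` is, by exactness, the image of the next one, hence a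
subobject of an adapted term and so adapted. -/
lemma DualityData.acyclic_onComplexes {N : CochainComplex 𝒜 ℤ} (hN : N.Acyclic)
    (hN' : AdaptedTerms Φ N) : ((onComplexes Φ).obj (op N)).Acyclic := by
  have := h.preservesFiniteLimits
  intro n
  let g := N.d (-n + 1) (-n + 2)
  have w : N.d (-n) (-n + 1) ≫ Abelian.factorThruImage g = 0 := by
    rw [← cancel_mono (Abelian.image.ι g), Category.assoc, Abelian.image.fac, N.d_comp_d, zero_comp]
  refine exactAt_onComplexes n (-n + 1) rfl (Abelian.factorThruImage g) w (hN _) ?_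
    (h.of_mono (Abelian.image.ι g) (hN' _))
  have h₁ := hN (-n + 1)
  rw [HomologicalComplex.exactAt_iff' _ (-n) (-n + 1) (-n + 2) (by simp) (by simp; lia)] at h₁
  let φ : ShortComplex.mk _ _ w ⟶ N.sc' (-n) (-n + 1) (-n + 2) :=
    { τ₁ := 𝟙 _
      τ₂ := 𝟙 _
      τ₃ := Abelian.image.ι g
      comm₁₂ := (Category.id_comp _).trans (Category.comp_id _).symm
      comm₂₃ := (Category.id_comp _).trans (Abelian.image.fac g).symm }
  have : Epi φ.τ₁ := inferInstanceAs (Epi (𝟙 _))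
  have : IsIso φ.τ₂ := inferInstanceAs (IsIso (𝟙 _))
  have : Mono φ.τ₃ := inferInstanceAs (Mono (Abelian.image.ι g))
  exact (ShortComplex.exact_iff_of_epi_of_isIso_of_mono φ).2 h₁

/-- The extension of `Φ` to complexes preserves quasi-isomorphisms between complexes with
adapted terms. -/
lemma DualityData.quasiIso_onComplexes_map {K L : CochainComplex 𝒜 ℤ} (f : K ⟶ L) [QuasiIso f]
    (hK : AdaptedTerms Φ K) (hL : AdaptedTerms Φ L) : QuasiIso ((onComplexes Φ).map f.op) := by
  have := h.preservesFiniteLimits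
  obtain ⟨P, p, _, hP, hP'⟩ := h.exists_contractible_epi L
  -- Adding a contractible `P` turns `f` into an epimorphism. Both `K ⟶ K ⊞ P` and `K ⊞ P ⟶ L` sit
  -- in short exact sequences whose remaining term is acyclic with adapted terms, and `Φ` preserves
  -- these sequences.
  let M := K ⊞ P
  let q : K ⊞ P ⟶ L := biprod.desc f p
  have hM : AdaptedTerms Φ M := fun n ↦
    Adapted.of_iso ((hK n).biprod (hP' n))
      ((HomologicalComplex.eval 𝒜 (ComplexShape.up ℤ) n).mapBiprod K P).symm
  let S₁ := ShortComplex.mk (biprod.inl : K ⟶ M) biprod.snd (by simp)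
  have hS₁ : S₁.ShortExact := (ShortComplex.Splitting.ofHasBinaryBiproduct K P).shortExact
  let S₂ := ShortComplex.mk (kernel.ι q) q (by simp)
  have : Epi q := by
    have : Epi (biprod.inr ≫ q) := by simpa [q]
    exact epi_of_epi biprod.inr q
  have hS₂ : S₂.ShortExact :=
    { exact := ShortComplex.exact_kernel q
      mono_f := inferInstanceAs (Mono (kernel.ι q))
      epi_g := by assumption }
  have : QuasiIso S₁.f := quasiIso_f_of_acyclic hS₁ hP
  have hf : f = S₁.f ≫ S₂.g := by simp [S₁, S₂, q]
  have : QuasiIso S₂.g := by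
    have : QuasiIso (S₁.f ≫ S₂.g) := by rwa [← hf]
    exact quasiIso_of_comp_left S₁.f S₂.g
  have : QuasiIso ((onComplexes Φ).map S₂.g.op) :=
    quasiIso_f_of_acyclic (onComplexes_shortExact (Φ := Φ) hS₂ hL)
      (h.acyclic_onComplexes (acyclic_X₁_of_quasiIso_g hS₂)
        (fun n ↦ h.of_mono ((kernel.ι q).f n) (hM n)))
  have : QuasiIso ((onComplexes Φ).map S₁.f.op) :=
    quasiIso_g_of_acyclic (onComplexes_shortExact (Φ := Φ) hS₁ hP') (h.acyclic_onComplexes hP hP')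
  rw [hf, op_comp, Functor.map_comp]
  infer_instance

end

end

section

/-! ### Right derived functors of contravariant functors by means of resolutions -/

section

variable {𝒜 : Type u₁} [Category.{v₁} 𝒜] [Abelian 𝒜] [HasDerivedCategory.{w₁} 𝒜]
  {H : Type u₃} [Category.{v₃} H]

open DerivedCategory

/-- Two morphisms of complexes which become equal in the derived category are homotopic
after the composition with a quasi-isomorphism. -/
lemma exists_homotopy_of_Q_map_eq {K L : CochainComplex 𝒜 ℤ} {f g : K ⟶ L}
    (h : Q.map f = Q.map g) :
    ∃ (K' : CochainComplex 𝒜 ℤ) (s : K' ⟶ K), QuasiIso s ∧ Nonempty (Homotopy (s ≫ f) (s ≫ g)) := by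
  have h' : Qh.map ((HomotopyCategory.quotient _ _).map f) =
      Qh.map ((HomotopyCategory.quotient _ _).map g) := by
    rw [← cancel_mono ((quotientCompQhIso 𝒜).hom.app L)]
    erw [(quotientCompQhIso 𝒜).hom.naturality f, (quotientCompQhIso 𝒜).hom.naturality g, h]
  rw [MorphismProperty.map_eq_iff_precomp Qh
    (HomotopyCategory.quasiIso 𝒜 (ComplexShape.up ℤ))] at h'
  obtain ⟨Z, s, hs, hs'⟩ := h'
  obtain ⟨K', rfl⟩ := HomotopyCategory.quotient_obj_surjective Z
  obtain ⟨s, rfl⟩ := (HomotopyCategory.quotient _ _).map_surjective s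
  refine ⟨K', s, ?_, ⟨HomotopyCategory.homotopyOfEq _ _ (by simpa using hs')⟩⟩
  rw [HomotopyCategory.quotient_map_mem_quasiIso_iff] at hs
  exact hs

/-- `𝓔` is a class of complexes by which a contravariant functor `F` on complexes can
be derived. -/
structure IsDeriving (F : (CochainComplex 𝒜 ℤ)ᵒᵖ ⥤ H) (𝓔 : ObjectProperty (CochainComplex 𝒜 ℤ)) :
    Prop where
  exists_resolution (K : CochainComplex 𝒜 ℤ) :
    ∃ (E : CochainComplex 𝒜 ℤ) (f : E ⟶ K), 𝓔 E ∧ QuasiIso f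
  isIso_map {E E' : CochainComplex 𝒜 ℤ} (f : E ⟶ E') [QuasiIso f] (h : 𝓔 E) (h' : 𝓔 E') :
    IsIso (F.map f.op)
  map_eq {K L : CochainComplex 𝒜 ℤ} (f g : K ⟶ L) (h : Homotopy f g) : F.map f.op = F.map g.op

namespace IsDeriving

variable {F : (CochainComplex 𝒜 ℤ)ᵒᵖ ⥤ H} {𝓔 : ObjectProperty (CochainComplex 𝒜 ℤ)}

lemma comp {H' : Type*} [Category H'] (h : IsDeriving F 𝓔) (G : H ⥤ H') :
    IsDeriving (F ⋙ G) 𝓔 where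
  exists_resolution := h.exists_resolution
  isIso_map f _ hE hE' := by
    have := h.isIso_map f hE hE'
    exact inferInstanceAs (IsIso (G.map (F.map f.op)))
  map_eq f g hfg := G.congr_map (h.map_eq f g hfg)

variable (h : IsDeriving F 𝓔)

include h

/-- The two morphisms become homotopic after a quasi-isomorphism `K' ⟶ E`. Resolving `K'` within `𝓔`
makes `F` of the composite to `E` invertible, so it can be cancelled. -/
lemma map_eq_of_Q_map_eq {E K : CochainComplex 𝒜 ℤ} {f g : E ⟶ K} (hE : 𝓔 E)
    (hfg : Q.map f = Q.map g) : F.map f.op = F.map g.op := by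
  obtain ⟨K', s, _, ⟨hs⟩⟩ := exists_homotopy_of_Q_map_eq hfg
  obtain ⟨E', t, hE', _⟩ := h.exists_resolution K'
  have := h.isIso_map (t ≫ s) hE' hE
  rw [← cancel_mono (F.map (t ≫ s).op), ← F.map_comp, ← F.map_comp, ← op_comp, ← op_comp,
    Category.assoc, Category.assoc, op_comp, F.map_comp, h.map_eq _ _ hs, ← F.map_comp, ← op_comp]

/-- A morphism `Q E ⟶ Q K` in the derived category can be represented by a right fraction
`E ⟵ P ⟶ K` with `P` in `𝓔`. -/
lemma exists_fac {E K : CochainComplex 𝒜 ℤ} (a : Q.obj E ⟶ Q.obj K) :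
    ∃ (P : CochainComplex 𝒜 ℤ) (s : P ⟶ E) (f : P ⟶ K), 𝓔 P ∧ QuasiIso s ∧
      Q.map s ≫ a = Q.map f := by
  obtain ⟨X, s, _, f, rfl⟩ := right_fac a
  obtain ⟨P, t, hP, _⟩ := h.exists_resolution X
  have : QuasiIso s := by rwa [← isIso_Q_map_iff_quasiIso]
  exact ⟨P, t ≫ s, t ≫ f, hP, inferInstance, by simp⟩

lemma exists_obj_iso (X : DerivedCategory 𝒜) :
    ∃ E, 𝓔 E ∧ Nonempty (Q.obj E ≅ X) := by
  obtain ⟨E, f, hE, _⟩ := h.exists_resolution (Q.objPreimage X)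
  exact ⟨E, hE, ⟨asIso (Q.map f) ≪≫ Q.objObjPreimageIso X⟩⟩

/-- A fraction `E ⟵ P₀ ⟶ K` representing `a` gives a candidate for `v`. Any other fraction with apex
in `𝓔` is compared with it through a third apex in `𝓔`, mapping to both. -/
lemma exists_map {E K : CochainComplex 𝒜 ℤ} (hE : 𝓔 E) (a : Q.obj E ⟶ Q.obj K) :
    ∃ v : F.obj (op K) ⟶ F.obj (op E), ∀ ⦃P : CochainComplex 𝒜 ℤ⦄ (s : P ⟶ E) (f : P ⟶ K)
      (_ : 𝓔 P) (_ : QuasiIso s) (_ : Q.map s ≫ a = Q.map f), v ≫ F.map s.op = F.map f.op := by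
  obtain ⟨P₀, s₀, f₀, hP₀, _, h₀⟩ := h.exists_fac a
  have := h.isIso_map s₀ hP₀ hE
  refine ⟨F.map f₀.op ≫ inv (F.map s₀.op), fun P s f hP _ hf ↦ ?_⟩
  obtain ⟨P', t, w, hP', _, hw⟩ := h.exists_fac (Q.map s ≫ inv (Q.map s₀))
  have := h.isIso_map t hP' hP
  have h₁ : F.map (t ≫ s).op = F.map (w ≫ s₀).op :=
    h.map_eq_of_Q_map_eq hP' (by simp [← hw])
  have h₂ : F.map (t ≫ f).op = F.map (w ≫ f₀).op :=
    h.map_eq_of_Q_map_eq hP' (by simp [← hw, ← h₀, ← hf])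
  rw [op_comp, op_comp, F.map_comp, F.map_comp] at h₁ h₂
  rw [← cancel_mono (F.map t.op), Category.assoc, Category.assoc, h₁, IsIso.inv_hom_id_assoc, h₂]

/-- The map `F K ⟶ F E` given by a morphism `E ⟶ K` in the derived category. -/
def map {E K : CochainComplex 𝒜 ℤ} (hE : 𝓔 E) (a : Q.obj E ⟶ Q.obj K) :
    F.obj (op K) ⟶ F.obj (op E) :=
  (h.exists_map hE a).choose

lemma map_comp_map {E K P : CochainComplex 𝒜 ℤ} (hE : 𝓔 E) (hP : 𝓔 P) (a : Q.obj E ⟶ Q.obj K)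
    (s : P ⟶ E) (f : P ⟶ K) [QuasiIso s] (hs : Q.map s ≫ a = Q.map f) :
    h.map hE a ≫ F.map s.op = F.map f.op :=
  (h.exists_map hE a).choose_spec s f hP inferInstance hs

lemma map_id {E : CochainComplex 𝒜 ℤ} (hE : 𝓔 E) : h.map hE (𝟙 (Q.obj E)) = 𝟙 _ := by
  simpa using h.map_comp_map hE hE (𝟙 _) (𝟙 E) (𝟙 E) (by simp)

lemma map_comp {E K L : CochainComplex 𝒜 ℤ} (hE : 𝓔 E) (a : Q.obj E ⟶ Q.obj K) (m : K ⟶ L) :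
    F.map m.op ≫ h.map hE a = h.map hE (a ≫ Q.map m) := by
  obtain ⟨P, s, f, hP, _, hf⟩ := h.exists_fac a
  have := h.isIso_map s hP hE
  rw [← cancel_mono (F.map s.op), Category.assoc, h.map_comp_map hE hP a s f hf,
    h.map_comp_map hE hP (a ≫ Q.map m) s (f ≫ m) (by simp [reassoc_of% hf]), op_comp, F.map_comp]

/-- The value at `E` of a right derived functor of `F` is `F E`, for `E` in `𝓔`. -/
def cocone {E : CochainComplex 𝒜 ℤ} (hE : 𝓔 E) :
    Cocone (CostructuredArrow.proj (Q (C := 𝒜)).op (op (Q.obj E)) ⋙ F) where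
  pt := F.obj (op E)
  ι :=
    { app j := h.map hE j.hom.unop
      naturality j j' m := by
        have h₁ := h.map_comp hE j'.hom.unop m.left.unop
        have h₂ : j'.hom.unop ≫ Q.map m.left.unop = j.hom.unop :=
          Quiver.Hom.op_inj (CostructuredArrow.w m)
        rw [h₂] at h₁
        exact h₁.trans (Category.comp_id _).symm }

/-- The cocone `cocone` is a colimit. -/
def isColimitCocone {E : CochainComplex 𝒜 ℤ} (hE : 𝓔 E) : IsColimit (h.cocone hE) where
  desc c := c.ι.app (CostructuredArrow.mk (S := (Q (C := 𝒜)).op) (Y := op E) (𝟙 _))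
  fac c j := by
    -- A fraction representing the structure morphism of `j` supplies an object `jP` that receives
    -- morphisms both from `j` and from the identity of `Q E`. Compatibility of `c` with these two
    -- arrows gives the factorization.
    obtain ⟨P, s, f, hP, _, hf⟩ := h.exists_fac j.hom.unop
    have := h.isIso_map s hP hE
    let jP : CostructuredArrow (Q (C := 𝒜)).op (op (Q.obj E)) :=
      CostructuredArrow.mk (Y := op P) (inv (Q.map s)).op
    let m₁ : CostructuredArrow.mk (S := (Q (C := 𝒜)).op) (Y := op E) (𝟙 _) ⟶ jP :=
      CostructuredArrow.homMk s.op (Quiver.Hom.unop_inj (by simp [jP]))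
    let m₂ : j ⟶ jP :=
      CostructuredArrow.homMk f.op (Quiver.Hom.unop_inj (by simp [jP, ← hf]))
    have h₁ := c.w m₁
    have h₂ := c.w m₂
    change F.map s.op ≫ c.ι.app jP = _ at h₁
    change F.map f.op ≫ c.ι.app jP = _ at h₂
    change h.map hE j.hom.unop ≫ _ = _
    rw [← h₁, ← h₂, ← h.map_comp_map hE hP _ s f hf]
    exact (Category.assoc _ _ _).symm
  uniq c m hm := by
    have h₁ := hm (CostructuredArrow.mk (S := (Q (C := 𝒜)).op) (Y := op E) (𝟙 _))
    rw [← h₁]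
    change m = h.map hE (𝟙 _) ≫ m
    rw [h.map_id hE]
    exact (Category.id_comp m).symm

lemma hasPointwiseRightDerivedFunctor :
    F.HasPointwiseRightDerivedFunctor (quasiIsoOp 𝒜) := by
  intro X
  obtain ⟨E, f, hE, hf⟩ := h.exists_resolution X.unop
  rw [F.hasPointwiseRightDerivedFunctorAt_iff_of_mem (quasiIsoOp 𝒜) f.op hf,
    F.hasPointwiseRightDerivedFunctorAt_iff (Q (C := 𝒜)).op]
  exact ⟨_, h.isColimitCocone hE⟩

lemma hasRightDerivedFunctor : F.HasRightDerivedFunctor (quasiIsoOp 𝒜) := by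
  have := h.hasPointwiseRightDerivedFunctor
  infer_instance

variable (RF : (DerivedCategory 𝒜)ᵒᵖ ⥤ H) (α : F ⟶ (Q (C := 𝒜)).op ⋙ RF)

/-- Both `F E` and `RF (Q E)` are colimits of the same diagram, and `α` is the comparison map on the
component of the identity. -/
lemma isIso_app [RF.IsRightDerivedFunctor α (quasiIsoOp 𝒜)] {E : CochainComplex 𝒜 ℤ}
    (hE : 𝓔 E) : IsIso (α.app (op E)) := by
  have := h.hasPointwiseRightDerivedFunctor
  have h₁ : IsColimit ((Functor.LeftExtension.mk RF α).coconeAt (op (Q.obj E))) :=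
    Functor.isPointwiseLeftKanExtensionOfHasPointwiseRightDerivedFunctor RF α
      (quasiIsoOp 𝒜) (op (Q.obj E))
  let e : F.obj (op E) ≅ RF.obj (op (Q.obj E)) :=
    (h.isColimitCocone hE).coconePointUniqueUpToIso h₁
  have h₂ : α.app (op E) = e.hom := by
    have := (h.isColimitCocone hE).comp_coconePointUniqueUpToIso_hom h₁
      (CostructuredArrow.mk (S := (Q (C := 𝒜)).op) (Y := op E) (𝟙 _))
    change h.map hE (𝟙 _) ≫ e.hom = α.app (op E) ≫ RF.map (𝟙 _) at this
    rw [h.map_id hE, Category.id_comp, RF.map_id] at this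
    exact (this.trans (Category.comp_id _)).symm
  rw [h₂]
  infer_instance

/-- The comparison with the total derived functor is invertible at every `Q E` with `E` in `𝓔`,
because both units are, and such objects exhaust the derived category up to isomorphism. -/
lemma isRightDerivedFunctor (hα : ∀ E, 𝓔 E → IsIso (α.app (op E))) :
    RF.IsRightDerivedFunctor α (quasiIsoOp 𝒜) := by
  have := h.hasRightDerivedFunctor
  let α₀ := F.totalRightDerivedUnit (Q (C := 𝒜)).op (quasiIsoOp 𝒜)
  rw [Functor.isRightDerivedFunctor_iff_isIso_rightDerivedDesc _ α₀]
  have (X : (DerivedCategory 𝒜)ᵒᵖ) :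
      IsIso ((Functor.rightDerivedDesc _ α₀ (quasiIsoOp 𝒜) RF α).app X) := by
    obtain ⟨E, hE, ⟨e⟩⟩ := h.exists_obj_iso X.unop
    have := hα E hE
    have := h.isIso_app _ α₀ hE
    rw [← NatTrans.isIso_app_iff_of_iso _ e.op.symm]
    have h₁ := Functor.rightDerived_fac_app _ α₀ (quasiIsoOp 𝒜) RF α (op E)
    have : IsIso (α₀.app (op E) ≫
      (Functor.rightDerivedDesc _ α₀ (quasiIsoOp 𝒜) RF α).app (op (Q.obj E))) := by
      erw [h₁]
      infer_instance
    exact IsIso.of_isIso_comp_left (α₀.app (op E)) _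
  exact NatIso.isIso_of_isIso_app _

end IsDeriving

lemma isDeriving_toDerived {ℬ : Type u₂} [Category.{v₂} ℬ] [Abelian ℬ] [HasDerivedCategory.{w₂} ℬ]
    {Φ : 𝒜ᵒᵖ ⥤ ℬ} {Ψ : ℬᵒᵖ ⥤ 𝒜} [Φ.Additive] (h : DualityData Φ Ψ) :
    IsDeriving (toDerived Φ) (AdaptedTerms Φ) where
  exists_resolution := h.exists_resolution
  isIso_map f _ hE hE' := by
    have := h.quasiIso_onComplexes_map f hE hE'
    exact inferInstanceAs (IsIso (Q.map ((onComplexes Φ).map f.op)))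
  map_eq f g hfg := by
    obtain ⟨hfg'⟩ := onComplexes_map_eq_of_homotopy (Φ := Φ) hfg
    exact Q_map_eq_of_homotopy ℬ hfg'

end

end

section

variable {𝒜 : Type u₁} [Category.{v₁} 𝒜] [Abelian 𝒜] {ℬ : Type u₂} [Category.{v₂} ℬ] [Abelian ℬ]

/-! ### The derived adjunction -/

section

variable {Φ : 𝒜ᵒᵖ ⥤ ℬ} {Ψ : ℬᵒᵖ ⥤ 𝒜} [Φ.Additive] [Ψ.Additive] (adj : Φ.rightOp ⊣ Ψ)

lemma unitOnComplexes_naturality {K L : CochainComplex 𝒜 ℤ} (f : K ⟶ L) :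
    unitOnComplexes adj K ≫ (onComplexes Ψ).map ((onComplexes Φ).map f.op).op =
      f ≫ unitOnComplexes adj L := by
  ext n
  change (adj.unit.app (K.X n) ≫ Ψ.map (Φ.map (K.XIsoOfEq (by simp : n = - -n)).hom.op).op) ≫
    Ψ.map (Φ.map (f.f (- -n)).op).op = f.f n ≫ adj.unit.app (L.X n) ≫
      Ψ.map (Φ.map (L.XIsoOfEq (by simp : n = - -n)).hom.op).op
  have h (m : ℤ) (hm : n = m) :
      (adj.unit.app (K.X n) ≫ Ψ.map (Φ.map (K.XIsoOfEq hm).hom.op).op) ≫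
        Ψ.map (Φ.map (f.f m).op).op = f.f n ≫ adj.unit.app (L.X n) ≫
          Ψ.map (Φ.map (L.XIsoOfEq hm).hom.op).op := by
    subst hm
    simpa using (adj.unit.naturality (f.f n)).symm
  exact h _ (by simp)

lemma unit_comp_map_unit (A : 𝒜) :
    adj.rightOp.unit.app (Φ.obj (op A)) ≫ Φ.map (adj.unit.app A).op = 𝟙 _ :=
  Quiver.Hom.op_inj (adj.left_triangle_components A)

lemma unitOnComplexes_comp_map_unitOnComplexes (K : CochainComplex 𝒜 ℤ) :
    unitOnComplexes adj.rightOp ((onComplexes Φ).obj (op K)) ≫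
      (onComplexes Φ).map (unitOnComplexes adj K).op = 𝟙 _ := by
  ext n
  have h (m : ℤ) (hm : n = m) (hm' : -n = -m) :
      (adj.rightOp.unit.app (Φ.obj (op (K.X (-n)))) ≫
        Φ.map (Ψ.map ((((onComplexes Φ).obj (op K)).XIsoOfEq hm).hom :
          Φ.obj (op (K.X (-n))) ⟶ Φ.obj (op (K.X (-m)))).op).op) ≫
      Φ.map (adj.unit.app (K.X (-n)) ≫ Ψ.map (Φ.map (K.XIsoOfEq hm').hom.op).op).op = 𝟙 _ := by
    subst hm
    have (X : 𝒜) (u : Φ.obj (op X) ⟶ Φ.obj (op (Ψ.obj (op (Φ.obj (op X))))))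
        (v : X ⟶ Ψ.obj (op (Φ.obj (op X)))) (w : u ≫ Φ.map v.op = 𝟙 _) :
        (u ≫ Φ.map (Ψ.map (𝟙 (Φ.obj (op X))).op).op) ≫
          Φ.map (v ≫ Ψ.map (Φ.map (𝟙 X).op).op).op = 𝟙 _ := by
      simpa using w
    exact this _ _ _ (unit_comp_map_unit adj (K.X (-n)))
  exact h (- -n) (by simp) (by simp)

variable [HasDerivedCategory.{w₁} 𝒜] [HasDerivedCategory.{w₂} ℬ]
  (h : DualityData Φ Ψ)
  (RΦ : (DerivedCategory 𝒜)ᵒᵖ ⥤ DerivedCategory ℬ)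
  (α : toDerived Φ ⟶ (DerivedCategory.Q (C := 𝒜)).op ⋙ RΦ) [IsTotalDerived RΦ α]
  (RΨ : (DerivedCategory ℬ)ᵒᵖ ⥤ DerivedCategory 𝒜)
  (β : toDerived Ψ ⟶ (DerivedCategory.Q (C := ℬ)).op ⋙ RΨ)

include h in
/-- Total derived functors of contravariant functors are absolute. -/
lemma DualityData.isRightDerivedFunctor_comp {H : Type u₃} [Category.{v₃} H]
    (G : DerivedCategory ℬ ⥤ H) :
    (RΦ ⋙ G).IsRightDerivedFunctor (Functor.whiskerRight α G ≫ (Functor.associator _ _ _).hom)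
      (quasiIsoOp 𝒜) := by
  refine ((isDeriving_toDerived h).comp G).isRightDerivedFunctor _ _ (fun E hE ↦ ?_)
  have := (isDeriving_toDerived h).isIso_app RΦ α hE
  have : IsIso (G.map (α.app (op E)) ≫ 𝟙 _) := inferInstance
  exact this

/-- The morphisms `Q K ⟶ RΨ (Φ K)`, considered in the opposite category. -/
def unitToDerived : toDerived Φ ⋙ RΨ.rightOp ⟶ (DerivedCategory.Q (C := 𝒜)).op ⋙ 𝟭 _ where
  app K := (DerivedCategory.Q.map (unitOnComplexes adj K.unop) ≫
    β.app (op ((onComplexes Φ).obj K))).op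
  naturality K L f := by
    apply Quiver.Hom.unop_inj
    change (DerivedCategory.Q.map (unitOnComplexes adj L.unop) ≫
      β.app (op ((onComplexes Φ).obj L))) ≫
        RΨ.map (DerivedCategory.Q.map ((onComplexes Φ).map f)).op =
      DerivedCategory.Q.map f.unop ≫ DerivedCategory.Q.map (unitOnComplexes adj K.unop) ≫
        β.app (op ((onComplexes Φ).obj K))
    have h₁ := β.naturality ((onComplexes Φ).map f).op
    change DerivedCategory.Q.map ((onComplexes Ψ).map ((onComplexes Φ).map f).op) ≫
      β.app (op ((onComplexes Φ).obj K)) = β.app (op ((onComplexes Φ).obj L)) ≫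
        RΨ.map (DerivedCategory.Q.map ((onComplexes Φ).map f)).op at h₁
    rw [Category.assoc, ← h₁, ← Functor.map_comp_assoc, ← Functor.map_comp_assoc]
    congr 2
    exact unitOnComplexes_naturality adj f.unop

/-- The unit of the derived adjunction, considered in the opposite category. -/
def derivedUnitOp : RΦ ⋙ RΨ.rightOp ⟶ 𝟭 (DerivedCategory 𝒜)ᵒᵖ :=
  have := h.isRightDerivedFunctor_comp RΦ α RΨ.rightOp
  Functor.rightDerivedDesc _ (Functor.whiskerRight α RΨ.rightOp ≫ (Functor.associator _ _ _).hom)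
    (quasiIsoOp 𝒜) _ (unitToDerived adj RΨ β)

/-- The unit of the derived adjunction. -/
def derivedUnit : 𝟭 (DerivedCategory 𝒜) ⟶ RΦ.rightOp ⋙ RΨ where
  app X := ((derivedUnitOp adj h RΦ α RΨ β).app (op X)).unop
  naturality _ _ f :=
    Quiver.Hom.op_inj ((derivedUnitOp adj h RΦ α RΨ β).naturality f.op).symm

lemma derivedUnit_comp (K : CochainComplex 𝒜 ℤ) :
    (derivedUnit adj h RΦ α RΨ β).app (DerivedCategory.Q.obj K) ≫ RΨ.map (α.app (op K)).op =
      DerivedCategory.Q.map (unitOnComplexes adj K) ≫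
        β.app (op ((onComplexes Φ).obj (op K))) := by
  have := h.isRightDerivedFunctor_comp RΦ α RΨ.rightOp
  have h₁ := Functor.rightDerived_fac_app _
    (Functor.whiskerRight α RΨ.rightOp ≫ (Functor.associator _ _ _).hom)
    (quasiIsoOp 𝒜) _ (unitToDerived adj RΨ β) (op K)
  have h₂ := congr_arg Quiver.Hom.unop h₁
  change (derivedUnit adj h RΦ α RΨ β).app (DerivedCategory.Q.obj K) ≫
    𝟙 _ ≫ RΨ.map (α.app (op K)).op = _ at h₂
  rw [Category.id_comp] at h₂
  exact h₂

variable (h' : DualityData Ψ Φ) [IsTotalDerived RΨ β]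

/-- The composite is an endomorphism of the derived functor `RΦ`, so by the universal property it
may be tested after `α`. There the defining equations of both units reduce it to the termwise
triangle identity. -/
lemma derivedUnit_triangle (X : DerivedCategory 𝒜) :
    (derivedUnit adj.rightOp h' RΨ β RΦ α).app (RΦ.obj (op X)) ≫
      RΦ.map ((derivedUnit adj h RΦ α RΨ β).app X).op = 𝟙 _ := by
  let τ : RΦ ⟶ RΦ :=
    { app X := (derivedUnit adj.rightOp h' RΨ β RΦ α).app (RΦ.obj X) ≫
        RΦ.map ((derivedUnit adj h RΦ α RΨ β).app X.unop).op
      naturality X Y f := by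
        have h₁ := (derivedUnit adj.rightOp h' RΨ β RΦ α).naturality (RΦ.map f)
        have h₂ := (derivedUnit adj h RΦ α RΨ β).naturality f.unop
        dsimp at h₁ h₂ ⊢
        rw [reassoc_of% h₁, Category.assoc, ← RΦ.map_comp, ← RΦ.map_comp, ← op_comp, ← h₂]
        rfl }
  suffices τ = 𝟙 _ from congr_app this (op X)
  apply Functor.rightDerived_ext RΦ α (quasiIsoOp 𝒜)
  ext K
  have h₁ := (derivedUnit adj.rightOp h' RΨ β RΦ α).naturality (α.app K)
  have h₂ := derivedUnit_comp adj h RΦ α RΨ β K.unop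
  have h₃ := derivedUnit_comp adj.rightOp h' RΨ β RΦ α ((onComplexes Φ).obj K)
  have h₄ := α.naturality (unitOnComplexes adj K.unop).op
  dsimp [τ] at h₁ h₂ h₃ h₄ ⊢
  rw [reassoc_of% h₁, ← RΦ.map_comp, ← op_comp]
  erw [h₂]
  rw [op_comp, RΦ.map_comp]
  erw [reassoc_of% h₃, ← h₄]
  rw [← Functor.map_comp_assoc]
  erw [unitOnComplexes_comp_map_unitOnComplexes]
  simp

/-- The derived adjunction. -/
def derivedAdjunction : RΦ.rightOp ⊣ RΨ :=
  Adjunction.mkOfUnitCounit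
    { unit := derivedUnit adj h RΦ α RΨ β
      counit :=
        { app Y := ((derivedUnit adj.rightOp h' RΨ β RΦ α).app Y.unop).op
          naturality Y Y' f := Quiver.Hom.unop_inj
            ((derivedUnit adj.rightOp h' RΨ β RΦ α).naturality f.unop).symm }
      left_triangle := by
        ext X
        apply Quiver.Hom.unop_inj
        have := derivedUnit_triangle adj h RΦ α RΨ β h' X
        simpa using this
      right_triangle := by
        ext Y
        -- Taking opposites twice is definitionally the identity, so the second triangle identity is
        -- the first one with `Φ` and `Ψ` exchanged.
        have : adj.rightOp.rightOp = adj := rfl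
        have := derivedUnit_triangle adj.rightOp h' RΨ β RΦ α h Y.unop
        simpa using! this }

lemma unitCompatible_derivedAdjunction :
    UnitCompatible adj α β (derivedAdjunction adj h RΦ α RΨ β h') :=
  fun K ↦ derivedUnit_comp adj h RΦ α RΨ β K

lemma unitCompatible_derivedAdjunction_rightOp :
    UnitCompatible adj.rightOp β α (derivedAdjunction adj h RΦ α RΨ β h').rightOp :=
  fun K ↦ derivedUnit_comp adj.rightOp h' RΨ β RΦ α K

end

end

section

variable {𝒜 : Type u₁} [Category.{v₁} 𝒜] [Abelian 𝒜] {ℬ : Type u₂} [Category.{v₂} ℬ] [Abelian ℬ]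

/-! ### Compatibility of the derived adjunction with the shift -/

lemma onComplexes_XIsoOfEq_hom (Φ : 𝒜ᵒᵖ ⥤ ℬ) [Φ.Additive] (K : CochainComplex 𝒜 ℤ) {n m : ℤ}
    (h : n = m) :
    (((onComplexes Φ).obj (op K)).XIsoOfEq h).hom =
      Φ.map (K.XIsoOfEq (by rw [h] : -m = -n)).hom.op := by
  subst h
  exact (Φ.map_id _).symm

section

variable {Φ : 𝒜ᵒᵖ ⥤ ℬ} {Ψ : ℬᵒᵖ ⥤ 𝒜} [Φ.Additive] [Ψ.Additive] (adj : Φ.rightOp ⊣ Ψ)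

lemma unitOnComplexes_shift (K : CochainComplex 𝒜 ℤ) :
    unitOnComplexes adj (K⟦(-1 : ℤ)⟧) ≫
      shiftOnComplexes Ψ ((onComplexes Φ).obj (op (K⟦(-1 : ℤ)⟧))) ≫
        ((onComplexes Ψ).map (shiftOnComplexes Φ K).op)⟦(-1 : ℤ)⟧' =
      (unitOnComplexes adj K)⟦(-1 : ℤ)⟧' := by
  ext n
  change (adj.unit.app (K.X (n + -1)) ≫ Ψ.map (Φ.map ((K⟦(-1 : ℤ)⟧).XIsoOfEq _).hom.op).op) ≫
    Ψ.map (((onComplexes Φ).obj (op (K⟦(-1 : ℤ)⟧))).XIsoOfEq _).hom.op ≫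
      Ψ.map (Φ.map (K.XIsoOfEq _).hom.op).op =
    adj.unit.app (K.X (n + -1)) ≫ Ψ.map (Φ.map (K.XIsoOfEq _).hom.op).op
  rw [onComplexes_XIsoOfEq_hom]
  -- No signs occur: besides the unit, all maps are transports along equalities of degrees, which
  -- compose to a single one.
  have (X Y Z T : 𝒜) (u : X ⟶ Ψ.obj (op (Φ.obj (op X)))) (f : X = Y) (g : Y = Z) (k : Z = T) :
      (u ≫ Ψ.map (Φ.map (eqToHom f).op).op) ≫ Ψ.map (Φ.map (eqToHom g).op).op ≫
          Ψ.map (Φ.map (eqToHom k).op).op =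
        u ≫ Ψ.map (Φ.map (eqToHom (f.trans (g.trans k))).op).op := by
    subst f g k
    simp
  exact this _ _ _ _ _ (congrArg K.X (by lia : n + -1 = - -n + -1))
    (congrArg K.X (by lia : - -n + -1 = -(-(n + -1) + -1) + -1))
    (congrArg K.X (by lia : -(-(n + -1) + -1) + -1 = -(-(n + -1))))

variable [HasDerivedCategory.{w₁} 𝒜] [HasDerivedCategory.{w₂} ℬ]
  (h : DualityData Φ Ψ)
  (RΦ : (DerivedCategory 𝒜)ᵒᵖ ⥤ DerivedCategory ℬ)
  (α : toDerived Φ ⟶ (DerivedCategory.Q (C := 𝒜)).op ⋙ RΦ) [IsTotalDerived RΦ α]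
  (RΨ : (DerivedCategory ℬ)ᵒᵖ ⥤ DerivedCategory 𝒜)
  (β : toDerived Ψ ⟶ (DerivedCategory.Q (C := ℬ)).op ⋙ RΨ)

lemma app_comp_shiftDerived_app (K : CochainComplex 𝒜 ℤ) :
    α.app (op K) ≫ (shiftDerived RΦ α).app (op (DerivedCategory.Q.obj K)) =
      DerivedCategory.Q.map (shiftOnComplexes Φ K) ≫
        (DerivedCategory.Q.commShiftIso (-1 : ℤ)).hom.app _ ≫
          (α.app (op (K⟦(-1 : ℤ)⟧)))⟦(-1 : ℤ)⟧' ≫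
            (RΦ.map ((DerivedCategory.Q.commShiftIso (-1 : ℤ)).inv.app K).op)⟦(-1 : ℤ)⟧' := by
  rw [← Functor.map_comp]
  exact Functor.rightDerived_fac_app RΦ α (quasiIsoOp 𝒜) _ _ (op K)

-- Shifting preserves adapted terms, and on a complex with adapted terms every factor in the
-- construction of `shiftDerived` is an isomorphism.
include h in
lemma DualityData.isIso_shiftDerived : IsIso (shiftDerived RΦ α) := by
  have (X : (DerivedCategory 𝒜)ᵒᵖ) : IsIso ((shiftDerived RΦ α).app X) := by
    obtain ⟨E, hE, ⟨e⟩⟩ := (isDeriving_toDerived h).exists_obj_iso X.unop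
    have h₁ := (isDeriving_toDerived h).isIso_app RΦ α hE
    have hE' : AdaptedTerms Φ (E⟦(-1 : ℤ)⟧) := fun n ↦ hE _
    have h₂ := (isDeriving_toDerived h).isIso_app RΦ α hE'
    rw [← NatTrans.isIso_app_iff_of_iso _ e.op.symm]
    have : IsIso (α.app (op E) ≫ (shiftDerived RΦ α).app (op (DerivedCategory.Q.obj E))) := by
      rw [app_comp_shiftDerived_app]
      infer_instance
    exact IsIso.of_isIso_comp_left (α.app (op E)) _
  exact NatIso.isIso_of_isIso_app _

variable [IsTotalDerived RΨ β] (h' : DualityData Ψ Φ) (Radj : RΦ.rightOp ⊣ RΨ)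

include h in
/-- The unit of the derived adjunction is compatible with the shift. -/
lemma DualityData.unit_shift (hR : UnitCompatible adj α β Radj) (X : DerivedCategory 𝒜) :
    Radj.unit.app (X⟦(-1 : ℤ)⟧) ≫
      (shiftDerived RΨ β).app (op (RΦ.obj (op (X⟦(-1 : ℤ)⟧)))) ≫
        (RΨ.map ((shiftDerived RΦ α).app (op X)).op)⟦(-1 : ℤ)⟧' =
      (Radj.unit.app X)⟦(-1 : ℤ)⟧' := by
  let τ : shiftFunctor (DerivedCategory 𝒜) (-1 : ℤ) ⟶
      (RΦ.rightOp ⋙ RΨ) ⋙ shiftFunctor (DerivedCategory 𝒜) (-1 : ℤ) :=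
    { app X := Radj.unit.app (X⟦(-1 : ℤ)⟧) ≫
        (shiftDerived RΨ β).app (op (RΦ.obj (op (X⟦(-1 : ℤ)⟧)))) ≫
          (RΨ.map ((shiftDerived RΦ α).app (op X)).op)⟦(-1 : ℤ)⟧'
      naturality X Y f := by
        have h₁ := Radj.unit.naturality (f⟦(-1 : ℤ)⟧')
        have h₂ := (shiftDerived RΨ β).naturality (RΦ.map (f⟦(-1 : ℤ)⟧').op).op
        have h₃ := (shiftDerived RΦ α).naturality f.op
        dsimp at h₁ h₂ h₃ ⊢
        rw [reassoc_of% h₁, reassoc_of% h₂, Category.assoc, Category.assoc]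
        simp only [← Functor.map_comp, ← op_comp, h₃] }
  let σ : shiftFunctor (DerivedCategory 𝒜) (-1 : ℤ) ⟶
      (RΦ.rightOp ⋙ RΨ) ⋙ shiftFunctor (DerivedCategory 𝒜) (-1 : ℤ) :=
    Functor.whiskerRight Radj.unit (shiftFunctor (DerivedCategory 𝒜) (-1 : ℤ))
  suffices τ.app X = σ.app X from this
  -- On a complex with adapted terms `RΨ(α_K)` is invertible. After composing with it, the equations
  -- characterizing the derived unit and `shiftDerived` reduce the claim to `unitOnComplexes_shift`.
  obtain ⟨K, hK, ⟨e⟩⟩ := (isDeriving_toDerived h).exists_obj_iso X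
  rw [← cancel_epi ((shiftFunctor (DerivedCategory 𝒜) (-1 : ℤ)).map e.hom), τ.naturality,
    σ.naturality]
  congr 1
  have := (isDeriving_toDerived h).isIso_app RΦ α hK
  have : IsIso ((RΨ.map (α.app (op K)).op)⟦(-1 : ℤ)⟧') := inferInstance
  rw [← cancel_mono ((RΨ.map (α.app (op K)).op)⟦(-1 : ℤ)⟧'),
    ← cancel_epi ((DerivedCategory.Q.commShiftIso (-1 : ℤ)).hom.app K)]
  let c := (DerivedCategory.Q.commShiftIso (-1 : ℤ)).app K
  have n₁ := (shiftDerived RΨ β).naturality (RΦ.map c.inv.op).op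
  have n₂ := Radj.unit.naturality c.inv
  have n₃ := (shiftDerived RΨ β).naturality (α.app (op (K⟦(-1 : ℤ)⟧))).op
  have n₄ := hR (K⟦(-1 : ℤ)⟧)
  have n₅ := app_comp_shiftDerived_app RΨ β ((onComplexes Φ).obj (op (K⟦(-1 : ℤ)⟧)))
  have n₆ := β.naturality (shiftOnComplexes Φ K).op
  have n₇ := (DerivedCategory.Q.commShiftIso (-1 : ℤ)).hom.naturality
    ((onComplexes Ψ).map (shiftOnComplexes Φ K).op)
  have n₈ := (DerivedCategory.Q.commShiftIso (-1 : ℤ)).hom.naturality (unitOnComplexes adj K)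
  dsimp [c] at n₁ n₂ n₃ n₄ n₅ n₆ n₇ n₈
  have n₉ := congrArg (fun f ↦ (RΨ.map f.op)⟦(-1 : ℤ)⟧') (app_comp_shiftDerived_app RΦ α K)
  have n₁₀ := congrArg (fun f ↦ f⟦(-1 : ℤ)⟧') (hR K)
  dsimp at n₉ n₁₀
  rw [RΨ.map_comp, Functor.map_comp] at n₉
  rw [Functor.map_comp, Functor.map_comp] at n₁₀
  dsimp [τ, σ]
  rw [Category.assoc, Category.assoc, n₉, n₁₀]
  simp only [RΨ.map_comp, Functor.map_comp, Category.assoc]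
  let c' := (DerivedCategory.Q.commShiftIso (-1 : ℤ)).app ((onComplexes Φ).obj (op (K⟦(-1 : ℤ)⟧)))
  have n₁₁ : (RΨ.map (c'.inv).op)⟦(-1 : ℤ)⟧' ≫
      (RΨ.map (c'.hom).op)⟦(-1 : ℤ)⟧' = 𝟙 _ := by
    rw [← Functor.map_comp, ← RΨ.map_comp, ← op_comp, Iso.hom_inv_id, op_id, RΨ.map_id,
      CategoryTheory.Functor.map_id]
  have n₁₂ := congrArg (fun f ↦ f⟦(-1 : ℤ)⟧') n₆
  have n₁₃ := congrArg DerivedCategory.Q.map (unitOnComplexes_shift adj K)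
  dsimp [c'] at n₁₁ n₁₂ n₁₃
  rw [Functor.map_comp, Functor.map_comp] at n₁₂ n₁₃
  rw [← reassoc_of% n₁, ← reassoc_of% n₂, Iso.hom_inv_id_app_assoc, ← reassoc_of% n₃,
    reassoc_of% n₄, reassoc_of% n₅, reassoc_of% n₁₁, ← n₁₂, ← reassoc_of% n₇,
    ← reassoc_of% n₈, reassoc_of% n₁₃]

end

end

section

variable {𝒜 : Type u₁} [Category.{v₁} 𝒜] [Abelian 𝒜] {ℬ : Type u₂} [Category.{v₂} ℬ] [Abelian ℬ]

/-! ### Distinguished triangles -/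

section

open Pretriangulated

variable {Φ : 𝒜ᵒᵖ ⥤ ℬ} {Ψ : ℬᵒᵖ ⥤ 𝒜} [Φ.Additive] [Ψ.Additive] (adj : Φ.rightOp ⊣ Ψ)
  [HasDerivedCategory.{w₁} 𝒜] [HasDerivedCategory.{w₂} ℬ]
  (h : DualityData Φ Ψ)
  (RΦ : (DerivedCategory 𝒜)ᵒᵖ ⥤ DerivedCategory ℬ)
  (α : toDerived Φ ⟶ (DerivedCategory.Q (C := 𝒜)).op ⋙ RΦ) [IsTotalDerived RΦ α]
  (RΨ : (DerivedCategory ℬ)ᵒᵖ ⥤ DerivedCategory 𝒜)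
  (β : toDerived Ψ ⟶ (DerivedCategory.Q (C := ℬ)).op ⋙ RΨ) [IsTotalDerived RΨ β]

include h in
/-- Every distinguished triangle in the derived category is induced by a short exact sequence of
complexes with adapted terms. -/
lemma DualityData.exists_shortExact (T : Triangle (DerivedCategory 𝒜)) (hT : T ∈ distTriang _) :
    ∃ (S : ShortComplex (CochainComplex 𝒜 ℤ)) (_ : S.ShortExact) (_ : AdaptedTerms Φ S.X₁)
      (_ : AdaptedTerms Φ S.X₂) (_ : AdaptedTerms Φ S.X₃)
      (e₁ : DerivedCategory.Q.obj S.X₁ ≅ T.obj₁) (e₂ : DerivedCategory.Q.obj S.X₂ ≅ T.obj₂)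
      (e₃ : DerivedCategory.Q.obj S.X₃ ≅ T.obj₃),
      DerivedCategory.Q.map S.f ≫ e₂.hom = e₁.hom ≫ T.mor₁ ∧
      DerivedCategory.Q.map S.g ≫ e₃.hom = e₂.hom ≫ T.mor₂ := by
  obtain ⟨L, hL, ⟨l⟩⟩ := (isDeriving_toDerived h).exists_obj_iso T.obj₁
  obtain ⟨K, hK, ⟨k⟩⟩ := (isDeriving_toDerived h).exists_obj_iso (T.obj₃⟦(-1 : ℤ)⟧)
  -- Rotated back, the triangle is the cone triangle of a morphism `f : P ⟶ L` of complexes with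
  -- adapted terms. Then `L ⟶ cone f ⟶ P[1]` is the desired sequence.
  obtain ⟨P, s, f, hP, hs, fac⟩ := (isDeriving_toDerived h).exists_fac
    (k.hom ≫ T.invRotate.mor₁ ≫ l.inv)
  have := h.preservesFiniteLimits
  have : IsIso (DerivedCategory.Q.map s) := (DerivedCategory.isIso_Q_map_iff_quasiIso _ s).2 hs
  let k' : DerivedCategory.Q.obj P ≅ T.obj₃⟦(-1 : ℤ)⟧ := asIso (DerivedCategory.Q.map s) ≪≫ k
  let e : DerivedCategory.Q.mapTriangle.obj (CochainComplex.mappingCone.triangle f) ≅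
      T.invRotate :=
    isoTriangleOfIso₁₂ _ _ (DerivedCategory.mappingCone_triangle_distinguished f)
      (inv_rot_of_distTriang _ hT) k' l (by
        change DerivedCategory.Q.map f ≫ l.hom = (DerivedCategory.Q.map s ≫ k.hom) ≫ _
        rw [← fac]
        have (m : T.obj₃⟦(-1 : ℤ)⟧ ⟶ T.obj₁) :
            (DerivedCategory.Q.map s ≫ k.hom ≫ m ≫ l.inv) ≫ l.hom =
              (DerivedCategory.Q.map s ≫ k.hom) ≫ m := by simp
        exact this _)
  let e' : (DerivedCategory.Q.mapTriangle.obj (CochainComplex.mappingCone.triangle f)).rotate ≅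
      T := (rotate _).mapIso e ≪≫ invRotCompRot.app T
  refine ⟨coneShortComplex f, coneShortComplex_shortExact f, hL,
    fun n ↦ adapted_mappingCone f n (n + 1) rfl (hP _) (hL _), fun n ↦ hP _,
    Triangle.π₁.mapIso e', Triangle.π₂.mapIso e',
    (DerivedCategory.Q.commShiftIso (1 : ℤ)).app P ≪≫ Triangle.π₃.mapIso e',
    e'.hom.comm₁, ?_⟩
  exact (Category.assoc _ _ _).symm.trans e'.hom.comm₂

include h α in
/-- The long exact cohomology sequence for the total derived functor of a contravariant functor. -/
lemma DualityData.exact_map (T : Triangle (DerivedCategory 𝒜)) (hT : T ∈ distTriang _) (n : ℤ) :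
    ∃ w, (ShortComplex.mk ((DerivedCategory.homologyFunctor ℬ n).map (RΦ.map T.mor₂.op))
      ((DerivedCategory.homologyFunctor ℬ n).map (RΦ.map T.mor₁.op)) w).Exact := by
  obtain ⟨S, hS, h₁, h₂, h₃, e₁, e₂, e₃, c₁, c₂⟩ := h.exists_shortExact T hT
  have := h.preservesFiniteLimits
  have ex := (onComplexes_shortExact hS h₃).homology_exact₂ n
  have i₁ := (isDeriving_toDerived h).isIso_app RΦ α h₁
  have i₂ := (isDeriving_toDerived h).isIso_app RΦ α h₂
  have i₃ := (isDeriving_toDerived h).isIso_app RΦ α h₃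
  let H := DerivedCategory.homologyFunctor ℬ n
  let a (K : CochainComplex 𝒜 ℤ) (X : DerivedCategory 𝒜) (e : DerivedCategory.Q.obj K ≅ X)
      (i : IsIso (α.app (op K))) : H.obj (RΦ.obj (op X)) ≅
        ((onComplexes Φ).obj (op K)).homology n :=
    H.mapIso (RΦ.mapIso e.op ≪≫ (asIso (α.app (op K))).symm) ≪≫
      (DerivedCategory.homologyFunctorFactors ℬ n).app _
  have ha {K L : CochainComplex 𝒜 ℤ} {X Y : DerivedCategory 𝒜} (e : DerivedCategory.Q.obj K ≅ X)
      (e' : DerivedCategory.Q.obj L ≅ Y) (i : IsIso (α.app (op K))) (i' : IsIso (α.app (op L)))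
      (f : K ⟶ L) (g : X ⟶ Y) (c : DerivedCategory.Q.map f ≫ e'.hom = e.hom ≫ g) :
      H.map (RΦ.map g.op) ≫ (a K X e i).hom = (a L Y e' i').hom ≫
        HomologicalComplex.homologyMap ((onComplexes Φ).map f.op) n := by
    have n₁ := α.naturality f.op
    have n₂ := (DerivedCategory.homologyFunctorFactors ℬ n).hom.naturality ((onComplexes Φ).map f.op)
    dsimp at n₁ n₂
    change H.map (RΦ.map g.op) ≫ H.map (RΦ.map e.hom.op ≫ inv (α.app (op K))) ≫
      (DerivedCategory.homologyFunctorFactors ℬ n).hom.app _ =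
        (H.map (RΦ.map e'.hom.op ≫ inv (α.app (op L))) ≫
          (DerivedCategory.homologyFunctorFactors ℬ n).hom.app _) ≫ _
    have n₃ : RΦ.map g.op ≫ RΦ.map e.hom.op ≫ inv (α.app (op K)) =
        (RΦ.map e'.hom.op ≫ inv (α.app (op L))) ≫
          DerivedCategory.Q.map ((onComplexes Φ).map f.op) := by
      rw [← RΦ.map_comp_assoc, ← op_comp, ← c, op_comp, RΦ.map_comp, Category.assoc, Category.assoc]
      congr 1
      rw [IsIso.eq_inv_comp, reassoc_of% n₁.symm]
      simp
    have n₄ := congrArg H.map n₃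
    rw [H.map_comp, H.map_comp (RΦ.map e'.hom.op ≫ _)] at n₄
    rw [reassoc_of% n₄]
    exact (congrArg (_ ≫ ·) n₂).trans (Category.assoc _ _ _).symm
  have w₁ := ha e₁ e₂ i₁ i₂ _ _ c₁
  have w₂ := ha e₂ e₃ i₂ i₃ _ _ c₂
  have w : H.map (RΦ.map T.mor₂.op) ≫ H.map (RΦ.map T.mor₁.op) = 0 := by
    rw [← cancel_mono (a _ _ e₁ i₁).hom, Category.assoc, w₁, reassoc_of% w₂]
    rw [← HomologicalComplex.homologyMap_comp, ← Functor.map_comp, ← op_comp, S.zero]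
    simp
  exact ⟨w, (ShortComplex.exact_iff_of_iso (ShortComplex.isoMk (a _ _ e₃ i₃) (a _ _ e₂ i₂)
    (a _ _ e₁ i₁) w₂.symm w₁.symm)).2 ex⟩

variable (Radj : RΦ.rightOp ⊣ RΨ) (h' : DualityData Ψ Φ)

-- The terms of `Φ E` are adapted to `Ψ`, so `RΨ(α_E)` and `β_{Φ E}` are both isomorphisms and the
-- compatibility of units identifies `η̂_E` with the termwise unit.
include h h' in
lemma DualityData.isIso_unit_app_iff (hR : UnitCompatible adj α β Radj)
    {E : CochainComplex 𝒜 ℤ} (hE : AdaptedTerms Φ E) :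
    IsIso (Radj.unit.app (DerivedCategory.Q.obj E)) ↔ QuasiIso (unitOnComplexes adj E) := by
  have i₁ := (isDeriving_toDerived h).isIso_app RΦ α hE
  have i₂ := (isDeriving_toDerived h').isIso_app RΨ β
    (E := (onComplexes Φ).obj (op E)) (fun n ↦ h'.adapted_obj _)
  rw [← DerivedCategory.isIso_Q_map_iff_quasiIso 𝒜]
  have := hR E
  have i₃ : IsIso (RΨ.map (α.app (op E)).op) := inferInstance
  rw [← isIso_comp_right_iff _ (RΨ.map (α.app (op E)).op), this]
  exact isIso_comp_right_iff _ (β.app (op ((onComplexes Φ).obj (op E))))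

include h h' in
/-- If the unit is an isomorphism at two of the vertices of a distinguished triangle,
then it is at the third. -/
lemma DualityData.isIso_unit_app_obj₃ (hR : UnitCompatible adj α β Radj)
    (T : Triangle (DerivedCategory 𝒜)) (hT : T ∈ distTriang _)
    (hT₁ : IsIso (Radj.unit.app T.obj₁)) (hT₂ : IsIso (Radj.unit.app T.obj₂)) :
    IsIso (Radj.unit.app T.obj₃) := by
  obtain ⟨S, hS, h₁, h₂, h₃, e₁, e₂, e₃, -, -⟩ := h.exists_shortExact T hT
  have := h.preservesFiniteLimits
  have := h'.preservesFiniteLimits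
  rw [← NatTrans.isIso_app_iff_of_iso Radj.unit e₁, h.isIso_unit_app_iff adj RΦ α RΨ β Radj h' hR h₁] at hT₁
  rw [← NatTrans.isIso_app_iff_of_iso Radj.unit e₂, h.isIso_unit_app_iff adj RΦ α RΨ β Radj h' hR h₂] at hT₂
  rw [← NatTrans.isIso_app_iff_of_iso Radj.unit e₃, h.isIso_unit_app_iff adj RΦ α RΨ β Radj h' hR h₃]
  -- After one dualization all terms have the form `Φ A`, hence are adapted to `Ψ`. The double dual
  -- is therefore short exact too, and the five lemma applies to the termwise units.
  have hS' := onComplexes_shortExact (onComplexes_shortExact hS h₃) (fun n ↦ h'.adapted_obj _)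
  let φ : S ⟶ (S.op.map (onComplexes Φ)).op.map (onComplexes Ψ) :=
    { τ₁ := unitOnComplexes adj S.X₁
      τ₂ := unitOnComplexes adj S.X₂
      τ₃ := unitOnComplexes adj S.X₃
      comm₁₂ := unitOnComplexes_naturality adj S.f
      comm₂₃ := unitOnComplexes_naturality adj S.g }
  exact HomologicalComplex.HomologySequence.quasiIso_τ₃ φ hS hS' hT₁ hT₂

end

end

section

variable {𝒜 : Type u₁} [Category.{v₁} 𝒜] [Abelian 𝒜] {ℬ : Type u₂} [Category.{v₂} ℬ] [Abelian ℬ]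

/-! ### Derived functors of objects in degree zero -/

section

variable [HasDerivedCategory.{w₁} 𝒜]

/-- In degree `n` all of `K` consists of cycles, and `L` has no boundaries there. So the only
possibly nonzero component of `g` is determined by the map on homology. -/
lemma eq_zero_of_homologyMap_eq_zero {K L : CochainComplex 𝒜 ℤ} (n : ℤ) [K.IsStrictlyLE n]
    [L.IsStrictlyGE n] (g : K ⟶ L) (h : HomologicalComplex.homologyMap g n = 0) : g = 0 := by
  have h₁ : IsIso (K.iCycles n) := K.isIso_iCycles n (n + 1) (by simp)
    ((CochainComplex.isZero_of_isStrictlyLE K n (n + 1) (by lia)).eq_of_tgt _ _)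
  have h₂ : IsIso (L.pOpcycles n) := L.isIso_pOpcycles (n - 1) n (by simp)
    ((CochainComplex.isZero_of_isStrictlyGE L n (n - 1) (by lia)).eq_of_src _ _)
  ext i
  obtain hi | rfl | hi := lt_trichotomy i n
  · exact (CochainComplex.isZero_of_isStrictlyGE L n i hi).eq_of_tgt _ _
  · rw [← cancel_epi (K.iCycles i), ← cancel_mono (L.pOpcycles i),
      ← HomologicalComplex.cyclesMap_i, Category.assoc, ← HomologicalComplex.homology_π_ι,
      ← HomologicalComplex.homologyπ_naturality_assoc, h]
    simp
  · exact (CochainComplex.isZero_of_isStrictlyLE K n i hi).eq_of_src _ _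

lemma eq_zero_of_homologyFunctor_map_eq_zero {X Y : DerivedCategory 𝒜} (n : ℤ) [X.IsLE n]
    [Y.IsGE n] (f : X ⟶ Y) (h : (DerivedCategory.homologyFunctor 𝒜 n).map f = 0) : f = 0 := by
  obtain ⟨K, _, ⟨k⟩⟩ := DerivedCategory.exists_iso_Q_obj_of_isLE X n
  obtain ⟨L, _, ⟨l⟩⟩ := DerivedCategory.exists_iso_Q_obj_of_isGE Y n
  -- The source of the fraction can again be taken strictly in degrees `≤ n`.
  obtain ⟨P, _, s, _, g, fac⟩ := DerivedCategory.right_fac_of_isStrictlyLE (k.inv ≫ f ≫ l.hom) n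
  have hg : (DerivedCategory.homologyFunctor 𝒜 n).map (DerivedCategory.Q.map g) = 0 := by
    rw [← cancel_epi ((DerivedCategory.homologyFunctor 𝒜 n).map (inv (DerivedCategory.Q.map s))),
      ← Functor.map_comp, ← fac]
    simp [h]
  have hg' : g = 0 := by
    refine eq_zero_of_homologyMap_eq_zero n g ?_
    have := DerivedCategory.homologyFunctorFactors_hom_naturality g n
    rw [hg, zero_comp] at this
    exact ((cancel_epi ((DerivedCategory.homologyFunctorFactors 𝒜 n).hom.app P)).1
      (comp_zero.trans this)).symm
  rw [← cancel_epi k.inv, ← cancel_mono l.hom, Category.assoc, fac, hg']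
  simp

/-- A morphism from an object in degrees `≤ n` to an object in degrees `≥ n` of the derived
category is determined by its effect on `Hⁿ`. -/
lemma eq_of_homologyFunctor_map_eq {X Y : DerivedCategory 𝒜} (n : ℤ) [X.IsLE n]
    [Y.IsGE n] (f g : X ⟶ Y) (h : (DerivedCategory.homologyFunctor 𝒜 n).map f =
      (DerivedCategory.homologyFunctor 𝒜 n).map g) : f = g := by
  rw [← sub_eq_zero]
  apply eq_zero_of_homologyFunctor_map_eq_zero n
  rw [Functor.map_sub, h, sub_self]

lemma homologyShiftSingle_naturality {M N : 𝒜} (f : M ⟶ N) :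
    (DerivedCategory.homologyFunctor 𝒜 1).map
        (((DerivedCategory.singleFunctor 𝒜 0).map f)⟦(-1 : ℤ)⟧') ≫ (homologyShiftSingle N).hom =
      (homologyShiftSingle M).hom ≫ f := by
  have h₁ := ((DerivedCategory.homologyFunctor 𝒜 0).shiftIso (-1 : ℤ) 1 0 (by simp)).hom.naturality
    ((DerivedCategory.singleFunctor 𝒜 0).map f)
  have h₂ := (DerivedCategory.singleFunctorCompHomologyFunctorIso 𝒜 0).hom.naturality f
  change _ ≫ _ ≫ _ = (_ ≫ _) ≫ _
  refine (Category.assoc _ _ _).symm.trans ?_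
  refine (congrArg (· ≫ _) h₁).trans ?_
  refine (Category.assoc _ _ _).trans ?_
  refine (congrArg (_ ≫ ·) h₂).trans ?_
  exact (Category.assoc _ _ _).symm

instance (M : 𝒜) : (((DerivedCategory.singleFunctor 𝒜 0).obj M)⟦(-1 : ℤ)⟧).IsGE 1 :=
  DerivedCategory.TStructure.t.isGE_shift _ 0 (-1) 1

end

section

open ZeroObject

variable {Φ : 𝒜ᵒᵖ ⥤ ℬ} {Ψ : ℬᵒᵖ ⥤ 𝒜} [Φ.Additive] [Ψ.Additive]
  (h : DualityData Φ Ψ)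

-- The resolution is `ker p ⟶ L` for an adapted cover `p : L ⟶ A`. Its dual lives in degrees `0` and
-- `1`, and left exactness identifies `Φ A` with the kernel of `Φ L ⟶ Φ (ker p)`.
include h in
lemma DualityData.exists_resolution_single (A : 𝒜) :
    ∃ (E : CochainComplex 𝒜 ℤ)
      (q : E ⟶ (HomologicalComplex.single 𝒜 (ComplexShape.up ℤ) 0).obj A),
      AdaptedTerms Φ E ∧ QuasiIso q ∧ (∀ n : ℤ, n ≠ 0 → n ≠ 1 →
        ((onComplexes Φ).obj (op E)).ExactAt n) ∧
      QuasiIsoAt ((onComplexes Φ).map q.op) 0 := by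
  have := h.preservesFiniteLimits
  obtain ⟨L, p, _, hL⟩ := h.exists_epi A
  have hL' : Adapted Φ (kernel p) := h.of_mono (kernel.ι p) hL
  let E := threeTerm (0 : (0 : 𝒜) ⟶ kernel p) (kernel.ι p) (by simp)
  let q := threeTermAugmentation (0 : (0 : 𝒜) ⟶ kernel p) (kernel.ι p) (by simp) p (by simp)
  have ex : (ShortComplex.mk (kernel.ι p) p (by simp)).Exact := ShortComplex.exact_kernel p
  have hE (n : ℤ) (hn : n ≠ 0) (hn' : n ≠ -1) : IsZero (E.X n) := by
    by_cases hn'' : n = -2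
    · subst hn''
      exact isZero_zero 𝒜
    · exact isZero_threeTerm_X _ _ _ n hn'' hn' hn
  refine ⟨E, q, fun n ↦ ?_, ?_, fun n hn hn' ↦ ?_, ?_⟩
  · by_cases h₀ : n = 0
    · subst h₀
      exact hL
    · by_cases h₁ : n = -1
      · subst h₁
        exact hL'
      · exact adapted_of_isZero (hE n h₀ h₁)
  · exact quasiIso_threeTermAugmentation _ _ _
      ((ShortComplex.exact_iff_mono _ rfl).2 (inferInstanceAs (Mono (kernel.ι p)))) _ _ ex
  · exact HomologicalComplex.ExactAt.of_isZero
      (Φ.map_isZero (hE (-n) (by lia) (by lia)).op)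
  · rw [quasiIsoAt_iff' _ (-1) 0 1 (by simp) (by simp), ShortComplex.quasiIso_iff_of_zeros]
    · have hq : q.f 0 = (show E.X 0 ⟶ A from p) ≫
        (HomologicalComplex.singleObjXSelf (ComplexShape.up ℤ) 0 A).inv :=
        threeTermAugmentation_f _ _ _ _ _
      have hw : kernel.ι p ≫ (p ≫
        (HomologicalComplex.singleObjXSelf (ComplexShape.up ℤ) 0 A).inv) = 0 := by simp
      let e : ShortComplex.mk (kernel.ι p) (p ≫
          (HomologicalComplex.singleObjXSelf (ComplexShape.up ℤ) 0 A).inv) hw ≅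
          ShortComplex.mk (kernel.ι p) p (by simp) :=
        ShortComplex.isoMk (Iso.refl _) (Iso.refl _)
          (HomologicalComplex.singleObjXSelf (ComplexShape.up ℤ) 0 A) (by simp) (by simp)
      have ex' : (ShortComplex.mk (kernel.ι p) (p ≫
        (HomologicalComplex.singleObjXSelf (ComplexShape.up ℤ) 0 A).inv) hw).Exact :=
        (ShortComplex.exact_iff_of_iso e).2 ex
      have ex'' := ex'.op.map_of_mono_of_preservesKernel Φ
        (inferInstanceAs (Mono (p ≫
          (HomologicalComplex.singleObjXSelf (ComplexShape.up ℤ) 0 A).inv).op)) inferInstance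
      have hm := mono_map_op (Φ := Φ) (p ≫
          (HomologicalComplex.singleObjXSelf (ComplexShape.up ℤ) 0 A).inv)
      have key (u : L ⟶ ((HomologicalComplex.single 𝒜 (ComplexShape.up ℤ) 0).obj A).X 0)
          (hu : u = p ≫ (HomologicalComplex.singleObjXSelf (ComplexShape.up ℤ) 0 A).inv)
          (w : Φ.map u.op ≫ Φ.map (kernel.ι p).op = 0) :
          (ShortComplex.mk (Φ.map u.op) (Φ.map (kernel.ι p).op) w).Exact ∧
            Mono (Φ.map u.op) := by
        subst hu
        exact ⟨ex'', hm⟩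
      exact key _ hq _
    · exact (Φ.map_isZero (HomologicalComplex.isZero_single_obj_X
        (ComplexShape.up ℤ) 0 A 1 (by lia)).op).eq_of_src _ _
    · exact (Φ.map_isZero (HomologicalComplex.isZero_single_obj_X
        (ComplexShape.up ℤ) 0 A (-1) (by lia)).op).eq_of_tgt _ _
    · exact (Φ.map_isZero (hE 1 (by lia) (by lia)).op).eq_of_src _ _

variable [HasDerivedCategory.{w₁} 𝒜] [HasDerivedCategory.{w₂} ℬ]
  (RΦ : (DerivedCategory 𝒜)ᵒᵖ ⥤ DerivedCategory ℬ)
  (α : toDerived Φ ⟶ (DerivedCategory.Q (C := 𝒜)).op ⋙ RΦ) [IsTotalDerived RΦ α]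

include h α in
lemma DualityData.isZero_homology_single (A : 𝒜) (n : ℤ) (h₀ : n ≠ 0) (h₁ : n ≠ 1) :
    IsZero ((DerivedCategory.homologyFunctor ℬ n).obj
      (RΦ.obj (op ((DerivedCategory.singleFunctor 𝒜 0).obj A)))) := by
  obtain ⟨E, q, hE, hq, ex, -⟩ := h.exists_resolution_single A
  have := (isDeriving_toDerived h).isIso_app RΦ α hE
  have : IsIso (DerivedCategory.Q.map q) := (DerivedCategory.isIso_Q_map_iff_quasiIso _ q).2 hq
  have := ex n h₀ h₁
  rw [HomologicalComplex.exactAt_iff_isZero_homology] at this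
  let e : RΦ.obj (op ((DerivedCategory.singleFunctor 𝒜 0).obj A)) ≅
    RΦ.obj (op (DerivedCategory.Q.obj E)) := RΦ.mapIso (asIso (DerivedCategory.Q.map q)).op
  exact this.of_iso ((DerivedCategory.homologyFunctor ℬ n).mapIso
    (e ≪≫ (asIso (α.app (op E))).symm) ≪≫
      (DerivedCategory.homologyFunctorFactors ℬ n).app _)

include h in
lemma DualityData.isIso_homology_app_single (A : 𝒜) :
    IsIso ((DerivedCategory.homologyFunctor ℬ 0).map
      (α.app (op ((HomologicalComplex.single 𝒜 (ComplexShape.up ℤ) 0).obj A)))) := by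
  obtain ⟨E, q, hE, hq, -, h₀⟩ := h.exists_resolution_single A
  have := (isDeriving_toDerived h).isIso_app RΦ α hE
  have : IsIso (DerivedCategory.Q.map q) := (DerivedCategory.isIso_Q_map_iff_quasiIso _ q).2 hq
  have i : IsIso (RΦ.map (DerivedCategory.Q.map q).op) := inferInstance
  have n₁ : α.app (op ((HomologicalComplex.single 𝒜 (ComplexShape.up ℤ) 0).obj A)) ≫
      RΦ.map (DerivedCategory.Q.map q).op =
        DerivedCategory.Q.map ((onComplexes Φ).map q.op) ≫ α.app (op E) :=
    (α.naturality q.op).symm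
  have i₁ : IsIso ((DerivedCategory.homologyFunctor ℬ 0).map
      (DerivedCategory.Q.map ((onComplexes Φ).map q.op))) := by
    rw [quasiIsoAt_iff_isIso_homologyMap] at h₀
    exact (NatIso.isIso_map_iff (DerivedCategory.homologyFunctorFactors ℬ 0)
      ((onComplexes Φ).map q.op)).2 h₀
  have i₂ : IsIso ((DerivedCategory.homologyFunctor ℬ 0).map
      (α.app (op ((HomologicalComplex.single 𝒜 (ComplexShape.up ℤ) 0).obj A)) ≫
        RΦ.map (DerivedCategory.Q.map q).op)) := by
    rw [n₁, Functor.map_comp]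
    infer_instance
  rw [Functor.map_comp] at i₂
  exact IsIso.of_isIso_comp_right _ ((DerivedCategory.homologyFunctor ℬ 0).map
    (RΦ.map (DerivedCategory.Q.map q).op))


include h α in
/-- The truncation triangle of `RΦ A` for an object `A`. -/
lemma DualityData.exists_truncation_triangle (A : 𝒜) :
    ∃ (π : RΦ.obj (op ((DerivedCategory.singleFunctor 𝒜 0).obj A)) ⟶
        ((DerivedCategory.singleFunctor ℬ 0).obj ((cohomologyOn RΦ 1).obj (op A)))⟦(-1 : ℤ)⟧)
      (δ : ((DerivedCategory.singleFunctor ℬ 0).obj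
        ((cohomologyOn RΦ 1).obj (op A)))⟦(-1 : ℤ)⟧ ⟶ (DerivedCategory.Q.obj ((onComplexes Φ).obj
          (op ((HomologicalComplex.single 𝒜 (ComplexShape.up ℤ) 0).obj A))))⟦(1 : ℤ)⟧),
      Pretriangulated.Triangle.mk
        (α.app (op ((HomologicalComplex.single 𝒜 (ComplexShape.up ℤ) 0).obj A))) π δ ∈
          Pretriangulated.distinguishedTriangles ∧
      (DerivedCategory.homologyFunctor ℬ 1).map π ≫ (homologyShiftSingle _).hom = 𝟙 _ := by
  let K := (HomologicalComplex.single 𝒜 (ComplexShape.up ℤ) 0).obj A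
  obtain ⟨Z, g, k, hT⟩ := Pretriangulated.distinguished_cocone_triangle (α.app (op K))
  have hK (n : ℤ) (hn : n ≠ 0) : IsZero ((DerivedCategory.homologyFunctor ℬ n).obj
      (DerivedCategory.Q.obj ((onComplexes Φ).obj (op K)))) := by
    refine IsZero.of_iso ?_ ((DerivedCategory.homologyFunctorFactors ℬ n).app _)
    exact (HomologicalComplex.ExactAt.of_isZero (Φ.map_isZero
      (HomologicalComplex.isZero_single_obj_X (ComplexShape.up ℤ) 0 A (-n)
        (by lia)).op)).isZero_homology
  have h₀ := h.isIso_homology_app_single RΦ α A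
  have hZ₀ : IsZero ((DerivedCategory.homologyFunctor ℬ 0).obj Z) := by
    have e₂ := DerivedCategory.HomologySequence.exact₂ _ hT 0
    have e₃ := DerivedCategory.HomologySequence.exact₃ _ hT 0 1
    refine e₃.isZero_X₂ ?_ ((hK 1 (by lia)).eq_of_tgt _ _)
    exact (DerivedCategory.HomologySequence.epi_homologyMap_mor₁_iff _ hT 0).1
      (inferInstanceAs (Epi ((DerivedCategory.homologyFunctor ℬ 0).map (α.app (op K)))))
  have hZ (n : ℤ) (hn : n ≠ 1) : IsZero ((DerivedCategory.homologyFunctor ℬ n).obj Z) := by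
    by_cases hn₀ : n = 0
    · subst hn₀
      exact hZ₀
    have e₃ := DerivedCategory.HomologySequence.exact₃ _ hT n (n + 1)
    refine e₃.isZero_X₂ ?_ ?_
    · exact (h.isZero_homology_single RΦ α A n hn₀ hn).eq_of_src _ _
    -- For `n = -1` the connecting map to `H⁰(Φ A)` vanishes because `H⁰(α_A)` is a monomorphism.
    · by_cases hn₁ : n + 1 = 0
      · obtain rfl : n = -1 := by lia
        exact (DerivedCategory.HomologySequence.mono_homologyMap_mor₁_iff _ hT (-1) 0).1
          (inferInstanceAs (Mono ((DerivedCategory.homologyFunctor ℬ 0).map (α.app (op K)))))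
      · exact (hK _ hn₁).eq_of_tgt _ _
  have : Z.IsGE 1 := (DerivedCategory.isGE_iff _ _).2 (fun n hn ↦ hZ n (by lia))
  have : Z.IsLE 1 := (DerivedCategory.isLE_iff _ _).2 (fun n hn ↦ hZ n (by lia))
  have i₁ : IsIso ((DerivedCategory.homologyFunctor ℬ 1).map g) := by
    have : Epi ((DerivedCategory.homologyFunctor ℬ 1).map g) :=
      (DerivedCategory.HomologySequence.epi_homologyMap_mor₂_iff _ hT 1 2).2
        ((hK 2 (by lia)).eq_of_tgt _ _)
    have : Mono ((DerivedCategory.homologyFunctor ℬ 1).map g) :=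
      (DerivedCategory.HomologySequence.mono_homologyMap_mor₂_iff _ hT 1).2
        ((hK 1 (by lia)).eq_of_src _ _)
    exact isIso_of_mono_of_epi _
  have : (Z⟦(1 : ℤ)⟧).IsGE 0 := DerivedCategory.TStructure.t.isGE_shift Z 1 1 0
  have : (Z⟦(1 : ℤ)⟧).IsLE 0 := DerivedCategory.TStructure.t.isLE_shift Z 1 1 0
  obtain ⟨N, ⟨e₀⟩⟩ := DerivedCategory.exists_iso_singleFunctor_obj_of_isGE_of_isLE (Z⟦(1 : ℤ)⟧) 0
  let e : Z ≅ ((DerivedCategory.singleFunctor ℬ 0).obj N)⟦(-1 : ℤ)⟧ :=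
    (shiftShiftNeg Z (1 : ℤ)).symm ≪≫ (shiftFunctor _ (-1 : ℤ)).mapIso e₀
  -- The identification of the cone with `(R¹Φ A)[-1]` is normalized by `H¹(g)` itself, which makes
  -- the resulting truncation morphism the identity on `H¹`.
  let w : (cohomologyOn RΦ 1).obj (op A) ≅ N :=
    (@asIso _ _ _ _ ((DerivedCategory.homologyFunctor ℬ 1).map g) i₁) ≪≫
      (DerivedCategory.homologyFunctor ℬ 1).mapIso e ≪≫ homologyShiftSingle N
  let e' : Z ≅ ((DerivedCategory.singleFunctor ℬ 0).obj
      ((cohomologyOn RΦ 1).obj (op A)))⟦(-1 : ℤ)⟧ :=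
    e ≪≫ (shiftFunctor _ (-1 : ℤ)).mapIso ((DerivedCategory.singleFunctor ℬ 0).mapIso w.symm)
  refine ⟨g ≫ e'.hom, e'.inv ≫ k, ?_, ?_⟩
  · refine Pretriangulated.isomorphic_distinguished _ hT _
      (Pretriangulated.Triangle.isoMk _ _ (Iso.refl _) (Iso.refl _) e'.symm ?_ ?_ ?_)
    · exact (Category.comp_id _).trans (Category.id_comp _).symm
    · change (g ≫ e'.hom) ≫ e'.inv = 𝟙 _ ≫ g
      simp
    · change (e'.inv ≫ k) ≫ (𝟙 _)⟦(1 : ℤ)⟧' = e'.inv ≫ k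
      rw [CategoryTheory.Functor.map_id, Category.comp_id]
  · have n := homologyShiftSingle_naturality w.inv
    change (DerivedCategory.homologyFunctor ℬ 1).map
      (g ≫ e.hom ≫ ((DerivedCategory.singleFunctor ℬ 0).map w.inv)⟦(-1 : ℤ)⟧') ≫ _ = _
    rw [Functor.map_comp, Functor.map_comp, Category.assoc, Category.assoc, n]
    have : w.hom = (DerivedCategory.homologyFunctor ℬ 1).map g ≫
      (DerivedCategory.homologyFunctor ℬ 1).map e.hom ≫ (homologyShiftSingle N).hom := rfl
    refine Eq.trans ?_ w.hom_inv_id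
    rw [this]
    exact ((Category.assoc _ _ _).trans (congrArg (_ ≫ ·) (Category.assoc _ _ _))).symm

end

end

section

variable {𝒜 : Type u₁} [Category.{v₁} 𝒜] [Abelian 𝒜] {ℬ : Type u₂} [Category.{v₂} ℬ] [Abelian ℬ]

/-! ### Reflexive objects -/

lemma epi_f_of_epi_homologyMap {K L : CochainComplex 𝒜 ℤ} (n : ℤ) [K.IsStrictlyLE n]
    [L.IsStrictlyGE n] [L.IsStrictlyLE n] (g : K ⟶ L)
    [Epi (HomologicalComplex.homologyMap g n)] (i : ℤ) : Epi (g.f i) := by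
  have h₂ : IsIso (L.pOpcycles n) := L.isIso_pOpcycles (n - 1) n (by simp)
    ((CochainComplex.isZero_of_isStrictlyGE L n (n - 1) (by lia)).eq_of_src _ _)
  have h₃ : IsIso (L.homologyι n) := L.isIso_homologyι n (n + 1) (by simp)
    ((CochainComplex.isZero_of_isStrictlyLE L n (n + 1) (by lia)).eq_of_tgt _ _)
  have (hi : IsZero (L.X i)) : Epi (g.f i) := ⟨fun _ _ _ ↦ hi.eq_of_src _ _⟩
  obtain hi | rfl | hi := lt_trichotomy i n
  · exact this (CochainComplex.isZero_of_isStrictlyGE L n i hi)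
  · have h₄ : K.iCycles i ≫ g.f i ≫ L.pOpcycles i =
        K.homologyπ i ≫ HomologicalComplex.homologyMap g i ≫ L.homologyι i := by
      rw [HomologicalComplex.homologyπ_naturality_assoc, HomologicalComplex.homology_π_ι,
        HomologicalComplex.cyclesMap_i_assoc]
    have h₅ : Epi (K.iCycles i ≫ g.f i ≫ L.pOpcycles i) := by
      rw [h₄]
      infer_instance
    have h₆ : Epi (g.f i ≫ L.pOpcycles i) := epi_of_epi (K.iCycles i) _
    have : g.f i = (g.f i ≫ L.pOpcycles i) ≫ inv (L.pOpcycles i) := by simp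
    rw [this]
    infer_instance
  · exact this (CochainComplex.isZero_of_isStrictlyLE L n i hi)

section

variable {Φ : 𝒜ᵒᵖ ⥤ ℬ} [Φ.Additive]

instance (K : CochainComplex 𝒜 ℤ) [K.IsStrictlyLE 0] :
    CochainComplex.IsStrictlyGE ((onComplexes Φ).obj (op K)) 0 := by
  rw [CochainComplex.isStrictlyGE_iff]
  intro i hi
  exact Φ.map_isZero (CochainComplex.isZero_of_isStrictlyLE K 0 (-i) (by lia)).op

instance (K : CochainComplex 𝒜 ℤ) [K.IsStrictlyGE 0] :
    CochainComplex.IsStrictlyLE ((onComplexes Φ).obj (op K)) 0 := by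
  rw [CochainComplex.isStrictlyLE_iff]
  intro i hi
  exact Φ.map_isZero (CochainComplex.isZero_of_isStrictlyGE K 0 (-i) (by lia)).op

end

section

variable {Φ : 𝒜ᵒᵖ ⥤ ℬ} {Ψ : ℬᵒᵖ ⥤ 𝒜} [Φ.Additive] [Ψ.Additive] (adj : Φ.rightOp ⊣ Ψ)
  [HasDerivedCategory.{w₁} 𝒜] [HasDerivedCategory.{w₂} ℬ]
  (h : DualityData Φ Ψ) (h' : DualityData Ψ Φ)
  (RΦ : (DerivedCategory 𝒜)ᵒᵖ ⥤ DerivedCategory ℬ)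
  (α : toDerived Φ ⟶ (DerivedCategory.Q (C := 𝒜)).op ⋙ RΦ) [IsTotalDerived RΦ α]
  (RΨ : (DerivedCategory ℬ)ᵒᵖ ⥤ DerivedCategory 𝒜)
  (β : toDerived Ψ ⟶ (DerivedCategory.Q (C := ℬ)).op ⋙ RΨ) [IsTotalDerived RΨ β]
  (Radj : RΦ.rightOp ⊣ RΨ)

include h α in
lemma DualityData.isZero_homology_map_shift (X : DerivedCategory 𝒜) (n m : ℤ) (hnm : n + 1 = m)
    (hX : IsZero ((DerivedCategory.homologyFunctor ℬ m).obj (RΦ.obj (op X)))) :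
    IsZero ((DerivedCategory.homologyFunctor ℬ n).obj (RΦ.obj (op (X⟦(-1 : ℤ)⟧)))) := by
  have := h.isIso_shiftDerived RΦ α
  exact hX.of_iso (((DerivedCategory.homologyFunctor ℬ m).mapIso
    ((asIso (shiftDerived RΦ α)).app (op X)) ≪≫
      ((DerivedCategory.homologyFunctor ℬ 0).shiftIso (-1 : ℤ) m n (by lia)).app _).symm)

-- By `unit_shift` the unit at `X[-1]` and the shifted unit at `X` differ by isomorphisms, and the
-- shift reflects isomorphisms.
include h in
lemma DualityData.isIso_unit_app_of_isIso_unit_app_shift (hR : UnitCompatible adj α β Radj)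
    (h' : DualityData Ψ Φ) (X : DerivedCategory 𝒜) [IsIso (Radj.unit.app (X⟦(-1 : ℤ)⟧))] :
    IsIso (Radj.unit.app X) := by
  have := h.isIso_shiftDerived RΦ α
  have := h'.isIso_shiftDerived RΨ β
  have e := h.unit_shift adj RΦ α RΨ β Radj hR X
  have : IsIso ((Radj.unit.app X)⟦(-1 : ℤ)⟧') := by
    rw [← e]
    infer_instance
  exact isIso_of_reflects_iso (Radj.unit.app X) (shiftFunctor (DerivedCategory 𝒜) (-1 : ℤ))

lemma rightOp_unit_comp_map_unit (X : DerivedCategory 𝒜) :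
    Radj.rightOp.unit.app (RΦ.obj (op X)) ≫ RΦ.map (Radj.unit.app X).op = 𝟙 _ :=
  Quiver.Hom.op_inj (Radj.left_triangle_components X)

include h h' in
/-- If `A` is a reflexive object, then the unit of the adjunction `(Φ, Ψ)` is an isomorphism
at `Φ A`. -/
lemma DualityData.isIso_unitOnComplexes_of_reflexive (hR : UnitCompatible adj α β Radj) (A : 𝒜)
    (hA : reflexiveObjects Radj A) :
    IsIso (unitOnComplexes adj.rightOp ((onComplexes Φ).obj
      (op ((HomologicalComplex.single 𝒜 (ComplexShape.up ℤ) 0).obj A)))) := by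
  have := h.preservesFiniteLimits
  let K := (HomologicalComplex.single 𝒜 (ComplexShape.up ℤ) 0).obj A
  have hK : IsIso (Radj.unit.app (DerivedCategory.Q.obj K)) := hA
  have hβ := (isDeriving_toDerived h').isIso_app RΨ β
    (E := (onComplexes Φ).obj (op K)) (fun n ↦ h'.adapted_obj _)
  obtain ⟨π, δ, hT, -⟩ := h.exists_truncation_triangle RΦ α A
  -- With `(R¹Φ A)[-2]` as first vertex of the rotated triangle, the obstruction to surjectivity of
  -- `H⁰(RΨ RΦ A) ⟶ H⁰(RΨ Φ A)` lies in `R²Ψ (R¹Φ A) = 0`.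
  obtain ⟨_, ex⟩ := h'.exact_map RΨ β _ (Pretriangulated.inv_rot_of_distTriang _ hT) 0
  have e₁ : Epi ((DerivedCategory.homologyFunctor 𝒜 0).map (RΨ.map (α.app (op K)).op)) := by
    refine ex.epi_f (IsZero.eq_of_tgt ?_ _ _)
    exact h'.isZero_homology_map_shift RΨ β _ 0 1 (by simp)
      (h'.isZero_homology_map_shift RΨ β _ 1 2 (by simp)
        (h'.isZero_homology_single RΨ β _ 2 (by lia) (by lia)))
  have e₂ : Epi ((DerivedCategory.homologyFunctor 𝒜 0).map
      (DerivedCategory.Q.map (unitOnComplexes adj K))) := by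
    have : Epi ((DerivedCategory.homologyFunctor 𝒜 0).map
        (Radj.unit.app (DerivedCategory.Q.obj K) ≫ RΨ.map (α.app (op K)).op)) := by
      rw [Functor.map_comp]
      infer_instance
    rw [hR K, Functor.map_comp] at this
    have e : (DerivedCategory.homologyFunctor 𝒜 0).map
        (DerivedCategory.Q.map (unitOnComplexes adj K)) =
      ((DerivedCategory.homologyFunctor 𝒜 0).map
        (DerivedCategory.Q.map (unitOnComplexes adj K)) ≫
          (DerivedCategory.homologyFunctor 𝒜 0).map (β.app (op ((onComplexes Φ).obj (op K))))) ≫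
        inv ((DerivedCategory.homologyFunctor 𝒜 0).map
          (β.app (op ((onComplexes Φ).obj (op K))))) := by simp
    rw [e]
    infer_instance
  -- By reflexivity `H⁰(RΨ RΦ A)` is `A`, and `H⁰(RΨ Φ A)` is `ΨΦ A` because `Φ A` is adapted to
  -- `Ψ`.
  have e₃ : Epi (HomologicalComplex.homologyMap (unitOnComplexes adj K) 0) := by
    have := DerivedCategory.homologyFunctorFactors_hom_naturality (unitOnComplexes adj K) 0
    have : Epi ((DerivedCategory.homologyFunctorFactors 𝒜 0).hom.app K ≫
        HomologicalComplex.homologyMap (unitOnComplexes adj K) 0) := by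
      rw [← this]
      have i : Epi ((DerivedCategory.homologyFunctorFactors 𝒜 0).hom.app
        ((onComplexes Ψ).obj (op ((onComplexes Φ).obj (op K))))) := inferInstance
      exact epi_comp' e₂ i
    exact epi_of_epi ((DerivedCategory.homologyFunctorFactors 𝒜 0).hom.app K) _
  -- `Φ(η_A)` is a monomorphism since `η_A` is an epimorphism, and a split epimorphism by the
  -- triangle identity. Hence it is invertible, with inverse `ξ_{Φ A}`.
  have i (n : ℤ) : IsIso ((unitOnComplexes adj.rightOp ((onComplexes Φ).obj (op K))).f n) := by
    have e₄ := epi_f_of_epi_homologyMap 0 (unitOnComplexes adj K) (-n)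
    have fac := congrArg (fun f ↦ HomologicalComplex.Hom.f f n)
      (unitOnComplexes_comp_map_unitOnComplexes adj K)
    have m : Mono (((onComplexes Φ).map (unitOnComplexes adj K).op).f n) :=
      mono_map_op ((unitOnComplexes adj K).f (-n))
    change (unitOnComplexes adj.rightOp ((onComplexes Φ).obj (op K))).f n ≫
      ((onComplexes Φ).map (unitOnComplexes adj K).op).f n = 𝟙 _ at fac
    have : IsSplitEpi (((onComplexes Φ).map (unitOnComplexes adj K).op).f n) := ⟨⟨⟨_, fac⟩⟩⟩
    have := isIso_of_mono_of_isSplitEpi (((onComplexes Φ).map (unitOnComplexes adj K).op).f n)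
    rw [← IsIso.eq_comp_inv] at fac
    rw [fac]
    infer_instance
  exact HomologicalComplex.Hom.isIso_of_components _

include h h' in
/-- The functor `R¹Φ` preserves reflexive objects. -/
lemma DualityData.reflexive_cohomologyOn (hR : UnitCompatible adj α β Radj)
    (hR' : UnitCompatible adj.rightOp β α Radj.rightOp) (A : 𝒜) (hA : reflexiveObjects Radj A) :
    reflexiveObjects Radj.rightOp ((cohomologyOn RΦ 1).obj (op A)) := by
  obtain ⟨π, δ, hT, -⟩ := h.exists_truncation_triangle RΦ α A
  have h₁ := h.isIso_unitOnComplexes_of_reflexive adj h' RΦ α RΨ β Radj hR A hA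
  -- The derived triangle identity makes `ξ̂_{RΦ A}` inverse to `RΦ(η̂_A)`.
  have h₂ : IsIso (Radj.rightOp.unit.app
      (RΦ.obj (op ((DerivedCategory.singleFunctor 𝒜 0).obj A)))) := by
    have : IsIso (Radj.unit.app ((DerivedCategory.singleFunctor 𝒜 0).obj A)) := hA
    have fac := rightOp_unit_comp_map_unit RΦ RΨ Radj ((DerivedCategory.singleFunctor 𝒜 0).obj A)
    have i : IsIso (RΦ.map (Radj.unit.app ((DerivedCategory.singleFunctor 𝒜 0).obj A)).op) :=
      inferInstance
    rw [← IsIso.eq_comp_inv] at fac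
    rw [fac]
    infer_instance
  have h₃ : IsIso (Radj.rightOp.unit.app (((DerivedCategory.singleFunctor ℬ 0).obj
      ((cohomologyOn RΦ 1).obj (op A)))⟦(-1 : ℤ)⟧)) := h'.isIso_unit_app_obj₃ adj.rightOp RΨ β RΦ α Radj.rightOp h hR' _ hT
    ((h'.isIso_unit_app_iff adj.rightOp RΨ β RΦ α Radj.rightOp h hR'
      (fun n ↦ h'.adapted_obj _)).2 inferInstance) h₂
  exact h'.isIso_unit_app_of_isIso_unit_app_shift adj.rightOp RΨ β RΦ α Radj.rightOp hR' h _

end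

end

section

variable {𝒜 : Type u₁} [Category.{v₁} 𝒜] [Abelian 𝒜] {ℬ : Type u₂} [Category.{v₂} ℬ] [Abelian ℬ]

/-! ### The natural maps -/

section

variable {Φ : 𝒜ᵒᵖ ⥤ ℬ} {Ψ : ℬᵒᵖ ⥤ 𝒜} [Φ.Additive] [Ψ.Additive] {adj : Φ.rightOp ⊣ Ψ}
  [HasDerivedCategory.{w₁} 𝒜] [HasDerivedCategory.{w₂} ℬ]
  (h : DualityData Φ Ψ) (h' : DualityData Ψ Φ)
  {RΦ : (DerivedCategory 𝒜)ᵒᵖ ⥤ DerivedCategory ℬ}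
  {α : toDerived Φ ⟶ (DerivedCategory.Q (C := 𝒜)).op ⋙ RΦ} [IsTotalDerived RΦ α]
  {RΨ : (DerivedCategory ℬ)ᵒᵖ ⥤ DerivedCategory 𝒜}
  {β : toDerived Ψ ⟶ (DerivedCategory.Q (C := ℬ)).op ⋙ RΨ} [IsTotalDerived RΨ β]
  {Radj : RΦ.rightOp ⊣ RΨ}

lemma map_comp_shiftCohomology {M N : 𝒜} (f : M ⟶ N) :
    (cohomologyOn RΦ 1).map f.op ≫ shiftCohomology RΦ α M =
      shiftCohomology RΦ α N ≫ (DerivedCategory.homologyFunctor ℬ 0).map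
        (RΦ.map (((DerivedCategory.singleFunctor 𝒜 0).map f)⟦(-1 : ℤ)⟧').op) := by
  have h₁ := (shiftDerived RΦ α).naturality ((DerivedCategory.singleFunctor 𝒜 0).map f).op
  have h₂ := ((DerivedCategory.homologyFunctor ℬ 0).shiftIso (-1 : ℤ) 1 0 (by simp)).hom.naturality
    (RΦ.map (((DerivedCategory.singleFunctor 𝒜 0).map f)⟦(-1 : ℤ)⟧').op)
  have h₃ := congrArg (DerivedCategory.homologyFunctor ℬ 1).map h₁
  rw [Functor.map_comp, Functor.map_comp] at h₃
  refine (Category.assoc _ _ _).symm.trans ((congrArg (· ≫ _) h₃).trans ?_)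
  refine (Category.assoc _ _ _).trans ((congrArg (_ ≫ ·) h₂).trans ?_)
  exact (Category.assoc _ _ _).symm

include h in
lemma DualityData.isIso_shiftCohomology (M : 𝒜) : IsIso (shiftCohomology RΦ α M) := by
  have := h.isIso_shiftDerived RΦ α
  unfold shiftCohomology
  have i : IsIso (((DerivedCategory.homologyFunctor ℬ 0).shiftIso (-1 : ℤ) 1 0 (by simp)).hom.app
    (RΦ.obj (op (((DerivedCategory.singleFunctor 𝒜 0).obj M)⟦(-1 : ℤ)⟧)))) := inferInstance
  have i' : IsIso ((DerivedCategory.homologyFunctor ℬ 1).map ((shiftDerived RΦ α).app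
    (op ((DerivedCategory.singleFunctor 𝒜 0).obj M)))) := inferInstance
  exact IsIso.comp_isIso' i' i

include h α in
lemma DualityData.isLE_one (A : 𝒜) :
    (RΦ.obj (op ((DerivedCategory.singleFunctor 𝒜 0).obj A))).IsLE 1 :=
  (DerivedCategory.isLE_iff _ _).2 (fun n hn ↦
    h.isZero_homology_single RΦ α A n (by lia) (by lia))

include h α in
/-- The truncation morphisms `π` are natural. -/
lemma DualityData.truncation_naturality {A A' : 𝒜} (f : A ⟶ A')
    (π : RΦ.obj (op ((DerivedCategory.singleFunctor 𝒜 0).obj A)) ⟶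
      ((DerivedCategory.singleFunctor ℬ 0).obj ((cohomologyOn RΦ 1).obj (op A)))⟦(-1 : ℤ)⟧)
    (hπ : (DerivedCategory.homologyFunctor ℬ 1).map π ≫ (homologyShiftSingle _).hom = 𝟙 _)
    (π' : RΦ.obj (op ((DerivedCategory.singleFunctor 𝒜 0).obj A')) ⟶
      ((DerivedCategory.singleFunctor ℬ 0).obj ((cohomologyOn RΦ 1).obj (op A')))⟦(-1 : ℤ)⟧)
    (hπ' : (DerivedCategory.homologyFunctor ℬ 1).map π' ≫ (homologyShiftSingle _).hom = 𝟙 _) :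
    RΦ.map ((DerivedCategory.singleFunctor 𝒜 0).map f).op ≫ π =
      π' ≫ ((DerivedCategory.singleFunctor ℬ 0).map ((cohomologyOn RΦ 1).map f.op))⟦(-1 : ℤ)⟧' := by
  have := h.isLE_one (RΦ := RΦ) (α := α) A'
  apply eq_of_homologyFunctor_map_eq 1
  rw [← cancel_mono (homologyShiftSingle _).hom, Functor.map_comp, Functor.map_comp,
    Category.assoc, Category.assoc, homologyShiftSingle_naturality, hπ]
  refine (Category.comp_id _).trans ?_
  refine Eq.trans ?_ (Category.assoc _ _ _)
  refine Eq.trans ?_ (congrArg (· ≫ _) hπ'.symm)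
  exact (Category.id_comp _).symm

lemma isIso_inv_app_comp_homology_map_unit (A : 𝒜) (hA : reflexiveObjects Radj A) :
    IsIso ((DerivedCategory.singleFunctorCompHomologyFunctorIso 𝒜 0).inv.app A ≫
      (DerivedCategory.homologyFunctor 𝒜 0).map
        (Radj.unit.app ((DerivedCategory.singleFunctor 𝒜 0).obj A))) := by
  have : IsIso (Radj.unit.app ((DerivedCategory.singleFunctor 𝒜 0).obj A)) := hA
  exact IsIso.comp_isIso' inferInstance inferInstance

include h α in
lemma DualityData.exists_isNaturalMap (A : 𝒜) (hA : reflexiveObjects Radj A) :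
    ∃ γ, IsNaturalMap β Radj A γ := by
  obtain ⟨π, _, _, hπ⟩ := h.exists_truncation_triangle RΦ α A
  have i := isIso_inv_app_comp_homology_map_unit A hA
  refine ⟨(shiftCohomology RΨ β ((cohomologyOn RΦ 1).obj (op A)) ≫
        (DerivedCategory.homologyFunctor 𝒜 0).map (RΨ.map π.op)) ≫ inv
        ((DerivedCategory.singleFunctorCompHomologyFunctorIso 𝒜 0).inv.app A ≫
      (DerivedCategory.homologyFunctor 𝒜 0).map
        (Radj.unit.app ((DerivedCategory.singleFunctor 𝒜 0).obj A))), π, hπ, ?_⟩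
  exact (Category.assoc _ _ _).trans ((congrArg (_ ≫ ·) (IsIso.inv_hom_id _)).trans
    (Category.comp_id _))

include h α in
/-- The natural maps `γ` are natural in `A`. -/
lemma DualityData.isNaturalMap_naturality {A A' : 𝒜} (f : A ⟶ A') (hA' : reflexiveObjects Radj A')
    {γ : (cohomologyOn RΨ 1).obj (op ((cohomologyOn RΦ 1).obj (op A))) ⟶ A}
    (hγ : IsNaturalMap β Radj A γ)
    {γ' : (cohomologyOn RΨ 1).obj (op ((cohomologyOn RΦ 1).obj (op A'))) ⟶ A'}
    (hγ' : IsNaturalMap β Radj A' γ') :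
    (cohomologyOn RΨ 1).map ((cohomologyOn RΦ 1).map f.op).op ≫ γ' = γ ≫ f := by
  obtain ⟨π, hπ, e⟩ := hγ
  obtain ⟨π', hπ', e'⟩ := hγ'
  have i := isIso_inv_app_comp_homology_map_unit A' hA'
  have n₁ := map_comp_shiftCohomology (α := β) ((cohomologyOn RΦ 1).map f.op)
  have n₂ := (DerivedCategory.singleFunctorCompHomologyFunctorIso 𝒜 0).inv.naturality f
  have n₃ := congrArg (DerivedCategory.homologyFunctor 𝒜 0).map
    (Radj.unit.naturality ((DerivedCategory.singleFunctor 𝒜 0).map f))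
  have n₄ := congrArg (fun g ↦ (DerivedCategory.homologyFunctor 𝒜 0).map (RΨ.map g.op))
    (h.truncation_naturality (α := α) f π hπ π' hπ')
  dsimp at n₂ n₃ n₄
  rw [RΨ.map_comp, RΨ.map_comp, Functor.map_comp, Functor.map_comp] at n₄
  rw [Functor.map_comp, Functor.map_comp] at n₃
  rw [← cancel_mono ((DerivedCategory.singleFunctorCompHomologyFunctorIso 𝒜 0).inv.app A' ≫
      (DerivedCategory.homologyFunctor 𝒜 0).map
        (Radj.unit.app ((DerivedCategory.singleFunctor 𝒜 0).obj A')))]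
  rw [Category.assoc, Category.assoc, e', reassoc_of% n₁, ← n₄, reassoc_of% n₂, n₃, reassoc_of% e]


/-- The naturality of the isomorphisms `H¹(X[-1]) ≅ H⁰(X)`. -/
lemma homologyFunctor_map_shift {X Y : DerivedCategory 𝒜} (f : X ⟶ Y) :
    (DerivedCategory.homologyFunctor 𝒜 1).map (f⟦(-1 : ℤ)⟧') ≫
        ((DerivedCategory.homologyFunctor 𝒜 0).shiftIso (-1 : ℤ) 1 0 (by simp)).hom.app Y =
      ((DerivedCategory.homologyFunctor 𝒜 0).shiftIso (-1 : ℤ) 1 0 (by simp)).hom.app X ≫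
        (DerivedCategory.homologyFunctor 𝒜 0).map f :=
  ((DerivedCategory.homologyFunctor 𝒜 0).shiftIso (-1 : ℤ) 1 0 (by simp)).hom.naturality f

include h h' in
/-- A truncation morphism of `RΨ M`, shifted so that it becomes a morphism
`RΨ (M[-1]) ⟶ R¹Ψ M`. -/
lemma DualityData.exists_desuspension (M : ℬ)
    (π : RΨ.obj (op ((DerivedCategory.singleFunctor ℬ 0).obj M)) ⟶
      ((DerivedCategory.singleFunctor 𝒜 0).obj ((cohomologyOn RΨ 1).obj (op M)))⟦(-1 : ℤ)⟧)
    (hπ : (DerivedCategory.homologyFunctor 𝒜 1).map π ≫ (homologyShiftSingle _).hom = 𝟙 _) :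
    ∃ j : RΨ.obj (op (((DerivedCategory.singleFunctor ℬ 0).obj M)⟦(-1 : ℤ)⟧)) ⟶
        (DerivedCategory.singleFunctor 𝒜 0).obj ((cohomologyOn RΨ 1).obj (op M)),
      π = (shiftDerived RΨ β).app (op ((DerivedCategory.singleFunctor ℬ 0).obj M)) ≫
        j⟦(-1 : ℤ)⟧' ∧
      shiftCohomology RΨ β M ≫ (DerivedCategory.homologyFunctor 𝒜 0).map j =
        (DerivedCategory.singleFunctorCompHomologyFunctorIso 𝒜 0).inv.app _ := by
  have := h'.isIso_shiftDerived RΨ β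
  obtain ⟨j, hj⟩ := (shiftFunctor (DerivedCategory 𝒜) (-1 : ℤ)).map_surjective
    (inv ((shiftDerived RΨ β).app (op ((DerivedCategory.singleFunctor ℬ 0).obj M))) ≫ π)
  have e : π = (shiftDerived RΨ β).app (op ((DerivedCategory.singleFunctor ℬ 0).obj M)) ≫
      j⟦(-1 : ℤ)⟧' := by
    rw [hj, IsIso.hom_inv_id_assoc]
  refine ⟨j, e, ?_⟩
  rw [e, Functor.map_comp] at hπ
  have n := homologyFunctor_map_shift j
  have e₂ : (shiftCohomology RΨ β M ≫ (DerivedCategory.homologyFunctor 𝒜 0).map j) ≫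
      (DerivedCategory.singleFunctorCompHomologyFunctorIso 𝒜 0).hom.app _ = 𝟙 _ := by
    refine Eq.trans ?_ hπ
    have n' := congrArg (fun k ↦ (DerivedCategory.homologyFunctor 𝒜 1).map
      ((shiftDerived RΨ β).app (op ((DerivedCategory.singleFunctor ℬ 0).obj M))) ≫ k ≫
        (DerivedCategory.singleFunctorCompHomologyFunctorIso 𝒜 0).hom.app
          ((cohomologyOn RΨ 1).obj (op M))) n
    refine Eq.trans ?_ (n'.symm.trans ?_)
    · have (X₁ X₂ X₃ X₄ X₅ : 𝒜) (a : X₁ ⟶ X₂) (b : X₂ ⟶ X₃) (c : X₃ ⟶ X₄) (d : X₄ ⟶ X₅) :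
          ((a ≫ b) ≫ c) ≫ d = a ≫ (b ≫ c) ≫ d := by simp
      exact this _ _ _ _ _ _ _ _ _
    · have (X₁ X₂ X₃ X₄ X₅ : 𝒜) (a : X₁ ⟶ X₂) (b : X₂ ⟶ X₃) (c : X₃ ⟶ X₄) (d : X₄ ⟶ X₅) :
          a ≫ (b ≫ c) ≫ d = (a ≫ b) ≫ c ≫ d := by simp
      exact this _ _ _ _ _ _ _ _ _
  exact ((Iso.eq_comp_inv
    ((DerivedCategory.singleFunctorCompHomologyFunctorIso 𝒜 0).app _)).2 e₂).trans
      (Category.id_comp _)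

include h' β in
lemma DualityData.isLE_zero (M : ℬ) :
    (RΨ.obj (op (((DerivedCategory.singleFunctor ℬ 0).obj M)⟦(-1 : ℤ)⟧))).IsLE 0 :=
  (DerivedCategory.isLE_iff _ _).2 (fun n hn ↦
    h'.isZero_homology_map_shift RΨ β _ n (n + 1) rfl
      (h'.isZero_homology_single RΨ β M (n + 1) (by lia) (by lia)))

-- Lifts the defining equation of `γ` from `H⁰` to the derived category. The source lies in degrees
-- `≤ 0` and the target, being isomorphic to `A`, in degrees `≥ 0`, so `H⁰` loses no information.
include h h' in
lemma DualityData.desuspension_comp (A : 𝒜) (hA : reflexiveObjects Radj A)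
    {γ : (cohomologyOn RΨ 1).obj (op ((cohomologyOn RΦ 1).obj (op A))) ⟶ A}
    (π : RΦ.obj (op ((DerivedCategory.singleFunctor 𝒜 0).obj A)) ⟶
      ((DerivedCategory.singleFunctor ℬ 0).obj ((cohomologyOn RΦ 1).obj (op A)))⟦(-1 : ℤ)⟧)
    (e : γ ≫ (DerivedCategory.singleFunctorCompHomologyFunctorIso 𝒜 0).inv.app A ≫
        (DerivedCategory.homologyFunctor 𝒜 0).map
          (Radj.unit.app ((DerivedCategory.singleFunctor 𝒜 0).obj A)) =
      shiftCohomology RΨ β ((cohomologyOn RΦ 1).obj (op A)) ≫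
        (DerivedCategory.homologyFunctor 𝒜 0).map (RΨ.map π.op))
    (j : RΨ.obj (op (((DerivedCategory.singleFunctor ℬ 0).obj
        ((cohomologyOn RΦ 1).obj (op A)))⟦(-1 : ℤ)⟧)) ⟶
      (DerivedCategory.singleFunctor 𝒜 0).obj
        ((cohomologyOn RΨ 1).obj (op ((cohomologyOn RΦ 1).obj (op A)))))
    (hj : shiftCohomology RΨ β _ ≫ (DerivedCategory.homologyFunctor 𝒜 0).map j =
        (DerivedCategory.singleFunctorCompHomologyFunctorIso 𝒜 0).inv.app _) :
    j ≫ (DerivedCategory.singleFunctor 𝒜 0).map γ ≫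
      Radj.unit.app ((DerivedCategory.singleFunctor 𝒜 0).obj A) = RΨ.map π.op := by
  have := h'.isLE_zero (RΨ := RΨ) (β := β) ((cohomologyOn RΦ 1).obj (op A))
  have i : IsIso (Radj.unit.app ((DerivedCategory.singleFunctor 𝒜 0).obj A)) := hA
  have : (RΨ.obj (op (RΦ.obj (op ((DerivedCategory.singleFunctor 𝒜 0).obj A))))).IsGE 0 :=
    DerivedCategory.TStructure.t.isGE_of_iso (show (DerivedCategory.singleFunctor 𝒜 0).obj A ≅
      RΨ.obj (op (RΦ.obj (op ((DerivedCategory.singleFunctor 𝒜 0).obj A)))) from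
        asIso (Radj.unit.app ((DerivedCategory.singleFunctor 𝒜 0).obj A))) 0
  have := h'.isIso_shiftCohomology (RΦ := RΨ) (α := β) ((cohomologyOn RΦ 1).obj (op A))
  have n := (DerivedCategory.singleFunctorCompHomologyFunctorIso 𝒜 0).inv.naturality γ
  dsimp at n
  refine eq_of_homologyFunctor_map_eq
    (Y := RΨ.obj (op (RΦ.obj (op ((DerivedCategory.singleFunctor 𝒜 0).obj A))))) 0 _ _ ?_
  rw [← cancel_epi (shiftCohomology RΨ β ((cohomologyOn RΦ 1).obj (op A)))]
  refine Eq.trans ?_ e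
  rw [Functor.map_comp, Functor.map_comp, reassoc_of% hj]
  exact ((Category.assoc _ _ _).symm.trans (congrArg (· ≫ _) n.symm)).trans (Category.assoc _ _ _)

include h h' in
/-- The triangle identity for the natural maps. -/
lemma DualityData.isNaturalMap_triangle (hR : UnitCompatible adj α β Radj)
    (hR' : UnitCompatible adj.rightOp β α Radj.rightOp) (A : 𝒜) (hA : reflexiveObjects Radj A)
    {γ : (cohomologyOn RΨ 1).obj (op ((cohomologyOn RΦ 1).obj (op A))) ⟶ A}
    (hγ : IsNaturalMap β Radj A γ)
    {θ : (cohomologyOn RΦ 1).obj (op ((cohomologyOn RΨ 1).obj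
      (op ((cohomologyOn RΦ 1).obj (op A))))) ⟶ (cohomologyOn RΦ 1).obj (op A)}
    (hθ : IsNaturalMap α Radj.rightOp ((cohomologyOn RΦ 1).obj (op A)) θ) :
    (cohomologyOn RΦ 1).map γ.op ≫ θ = 𝟙 _ := by
  obtain ⟨π, hπ, e⟩ := hγ
  obtain ⟨π', hπ', e'⟩ := hθ
  obtain ⟨j, rfl, hj⟩ := h.exists_desuspension (β := β) h' _ π' hπ'
  have c := h.desuspension_comp h' A hA π e j hj
  have hM := h.reflexive_cohomologyOn adj h' RΦ α RΨ β Radj hR hR' A hA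
  have i := isIso_inv_app_comp_homology_map_unit _ hM
  -- Apply `RΦ` to the lifted equation of `γ` and cancel `RΦ(η̂_A)` by the derived triangle
  -- identity.
  have c₁ : RΦ.map ((DerivedCategory.singleFunctor 𝒜 0).map γ).op ≫ RΦ.map j.op =
      π ≫ Radj.rightOp.unit.app (((DerivedCategory.singleFunctor ℬ 0).obj
        ((cohomologyOn RΦ 1).obj (op A)))⟦(-1 : ℤ)⟧) := by
    have t := rightOp_unit_comp_map_unit RΦ RΨ Radj ((DerivedCategory.singleFunctor 𝒜 0).obj A)
    have n := Radj.rightOp.unit.naturality π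
    have c₂ := congrArg (fun k ↦ RΦ.map k.op) c
    dsimp at n c₂
    rw [RΦ.map_comp, RΦ.map_comp] at c₂
    rw [n, ← c₂, Category.assoc, reassoc_of% t]
  have s := h'.unit_shift adj.rightOp RΨ β RΦ α Radj.rightOp hR'
    ((DerivedCategory.singleFunctor ℬ 0).obj ((cohomologyOn RΦ 1).obj (op A)))
  have n₁ := (shiftDerived RΦ α).naturality j.op
  dsimp at n₁ s
  have c₃ : RΦ.map ((DerivedCategory.singleFunctor 𝒜 0).map γ).op ≫
      (shiftDerived RΦ α).app (op ((DerivedCategory.singleFunctor 𝒜 0).obj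
        ((cohomologyOn RΨ 1).obj (op ((cohomologyOn RΦ 1).obj (op A)))))) ≫
      (RΦ.map ((shiftDerived RΨ β).app (op ((DerivedCategory.singleFunctor ℬ 0).obj
        ((cohomologyOn RΦ 1).obj (op A)))) ≫
        j⟦(-1 : ℤ)⟧').op)⟦(-1 : ℤ)⟧' = π ≫ (Radj.rightOp.unit.app ((DerivedCategory.singleFunctor ℬ 0).obj
        ((cohomologyOn RΦ 1).obj (op A))))⟦(-1 : ℤ)⟧' := by
    rw [← s, ← reassoc_of% c₁, reassoc_of% n₁, op_comp, RΦ.map_comp, Functor.map_comp]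
  -- It remains to take `H¹` of `c₃`. The normalization of `π` makes its contribution the canonical
  -- identification.
  have hπ₂ : (DerivedCategory.homologyFunctor ℬ 1).map π ≫
      ((DerivedCategory.homologyFunctor ℬ 0).shiftIso (-1 : ℤ) 1 0 (by simp)).hom.app _ =
        (DerivedCategory.singleFunctorCompHomologyFunctorIso ℬ 0).inv.app
          ((cohomologyOn RΦ 1).obj (op A)) :=
    ((Iso.eq_comp_inv ((DerivedCategory.singleFunctorCompHomologyFunctorIso ℬ 0).app _)).2
      ((Category.assoc _ _ _).trans hπ)).trans (Category.id_comp _)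
  have c₄ := congrArg (fun k ↦ (DerivedCategory.homologyFunctor ℬ 1).map k ≫
    ((DerivedCategory.homologyFunctor ℬ 0).shiftIso (-1 : ℤ) 1 0 (by simp)).hom.app _) c₃
  rw [Functor.map_comp, Functor.map_comp, Functor.map_comp] at c₄
  have g₁ {X₁ X₂ X₃ X₄ X₅ X₆ : ℬ} {a : X₁ ⟶ X₂} {b : X₂ ⟶ X₃} {c : X₃ ⟶ X₄} {d : X₄ ⟶ X₅}
      {c' : X₃ ⟶ X₆} {d' : X₆ ⟶ X₅} (w : c ≫ d = c' ≫ d') :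
      a ≫ (b ≫ c') ≫ d' = (a ≫ b ≫ c) ≫ d := by simp [w]
  have g₂ {X₁ X₂ X₃ X₄ X₅ : ℬ} {p : X₁ ⟶ X₂} {q : X₂ ⟶ X₃} {d : X₃ ⟶ X₄} {d' : X₂ ⟶ X₅}
      {q' : X₅ ⟶ X₄} {u : X₁ ⟶ X₅} (w : q ≫ d = d' ≫ q') (w' : p ≫ d' = u) :
      (p ≫ q) ≫ d = u ≫ q' := by simp [w, reassoc_of% w']
  -- `H⁰(ξ̂)` at `R¹Φ A` is invertible since that object is reflexive; it is the factor occurring in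
  -- the definition of `θ`.
  rw [← cancel_mono ((DerivedCategory.singleFunctorCompHomologyFunctorIso ℬ 0).inv.app _ ≫
      (DerivedCategory.homologyFunctor ℬ 0).map (Radj.rightOp.unit.app
        ((DerivedCategory.singleFunctor ℬ 0).obj ((cohomologyOn RΦ 1).obj (op A)))))]
  rw [Category.assoc, e', Category.id_comp]
  exact (g₁ (homologyFunctor_map_shift _)).trans
    (c₄.trans (g₂ (homologyFunctor_map_shift _) hπ₂))

end

end

section

variable {𝒜 : Type u₁} [Category.{v₁} 𝒜] [Abelian 𝒜] {ℬ : Type u₂} [Category.{v₂} ℬ] [Abelian ℬ]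

/-! ### Left adjoint pairs of contravariant functors on full subcategories -/

/-- A left adjoint pair of contravariant functors on full subcategories, constructed from its
units. -/
def adjunctionOfUnits {F : 𝒜ᵒᵖ ⥤ ℬ} {G : ℬᵒᵖ ⥤ 𝒜} {P : ObjectProperty 𝒜} {P' : ObjectProperty ℬ}
    (h₁ : ∀ A : P.FullSubcategoryᵒᵖ, P' ((P.ι.op ⋙ F).obj A))
    (h₂ : ∀ B : P'.FullSubcategoryᵒᵖ, P ((P'.ι.op ⋙ G).obj B))
    (γ : ∀ A : P.FullSubcategory, G.obj (op (F.obj (op A.obj))) ⟶ A.obj)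
    (θ : ∀ B : P'.FullSubcategory, F.obj (op (G.obj (op B.obj))) ⟶ B.obj)
    (hγ : ∀ {A A' : P.FullSubcategory} (f : A ⟶ A'),
      G.map (F.map f.hom.op).op ≫ γ A' = γ A ≫ f.hom)
    (hθ : ∀ {B B' : P'.FullSubcategory} (f : B ⟶ B'),
      F.map (G.map f.hom.op).op ≫ θ B' = θ B ≫ f.hom)
    (tγ : ∀ A : P.FullSubcategory, F.map (γ A).op ≫ θ ⟨F.obj (op A.obj), h₁ (op A)⟩ = 𝟙 _)
    (tθ : ∀ B : P'.FullSubcategory, G.map (θ B).op ≫ γ ⟨G.obj (op B.obj), h₂ (op B)⟩ = 𝟙 _) :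
    P'.lift (P.ι.op ⋙ F) h₁ ⊣ (P.lift (P'.ι.op ⋙ G) h₂).rightOp :=
  Adjunction.mkOfUnitCounit
    { unit :=
        { app A := Quiver.Hom.op (ObjectProperty.homMk (γ A.unop))
          naturality A A' f := Quiver.Hom.unop_inj (ObjectProperty.hom_ext _ (hγ f.unop).symm) }
      counit :=
        { app B := ObjectProperty.homMk (θ B)
          naturality B B' f := ObjectProperty.hom_ext _ (hθ f) }
      left_triangle := by
        ext A
        simpa using! tγ A.unop
      right_triangle := by
        ext B
        apply Quiver.Hom.unop_inj
        ext
        simpa using! tθ B }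

section

variable {Φ : 𝒜ᵒᵖ ⥤ ℬ} {Ψ : ℬᵒᵖ ⥤ 𝒜} [Φ.Additive] [Ψ.Additive] {adj : Φ.rightOp ⊣ Ψ}
  [HasDerivedCategory.{w₁} 𝒜] [HasDerivedCategory.{w₂} ℬ]
  (h : DualityData Φ Ψ) (h' : DualityData Ψ Φ)
  {RΦ : (DerivedCategory 𝒜)ᵒᵖ ⥤ DerivedCategory ℬ}
  {α : toDerived Φ ⟶ (DerivedCategory.Q (C := 𝒜)).op ⋙ RΦ} [IsTotalDerived RΦ α]
  {RΨ : (DerivedCategory ℬ)ᵒᵖ ⥤ DerivedCategory 𝒜}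
  {β : toDerived Ψ ⟶ (DerivedCategory.Q (C := ℬ)).op ⋙ RΨ} [IsTotalDerived RΨ β]
  {Radj : RΦ.rightOp ⊣ RΨ}

include h h' in
/-- The functors `R¹Φ` and `R¹Ψ` form a left adjoint pair on reflexive objects. -/
lemma DualityData.exists_adjunction_of_reflexive (hR : UnitCompatible adj α β Radj)
    (hR' : UnitCompatible adj.rightOp β α Radj.rightOp)
    (h₁ : ∀ A : (reflexiveObjects Radj).FullSubcategoryᵒᵖ, reflexiveObjects Radj.rightOp
      (((reflexiveObjects Radj).ι.op ⋙ cohomologyOn RΦ 1).obj A))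
    (h₂ : ∀ B : (reflexiveObjects Radj.rightOp).FullSubcategoryᵒᵖ, reflexiveObjects Radj
      (((reflexiveObjects Radj.rightOp).ι.op ⋙ cohomologyOn RΨ 1).obj B)) :
    ∃ ladj : (reflexiveObjects Radj.rightOp).lift
        ((reflexiveObjects Radj).ι.op ⋙ cohomologyOn RΦ 1) h₁ ⊣
          ((reflexiveObjects Radj).lift
            ((reflexiveObjects Radj.rightOp).ι.op ⋙ cohomologyOn RΨ 1) h₂).rightOp,
      (∀ A : (reflexiveObjects Radj).FullSubcategory,
        IsNaturalMap β Radj A.obj (ladj.unit.app (op A)).unop.hom) ∧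
      ∀ B : (reflexiveObjects Radj.rightOp).FullSubcategory,
        IsNaturalMap α Radj.rightOp B.obj (ladj.counit.app B).hom := by
  have eγ (A : (reflexiveObjects Radj).FullSubcategory) : ∃ γ, IsNaturalMap β Radj A.obj γ :=
    h.exists_isNaturalMap (α := α) A.obj A.property
  have eθ (B : (reflexiveObjects Radj.rightOp).FullSubcategory) :
      ∃ θ, IsNaturalMap α Radj.rightOp B.obj θ :=
    h'.exists_isNaturalMap (α := β) B.obj B.property
  choose γ hγ using eγ
  choose θ hθ using eθ
  exact ⟨adjunctionOfUnits h₁ h₂ γ θ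
    (fun {A A'} f ↦ h.isNaturalMap_naturality (α := α) f.hom A'.property (hγ A) (hγ A'))
    (fun {B B'} f ↦ h'.isNaturalMap_naturality (α := β) f.hom B'.property (hθ B) (hθ B'))
    (fun A ↦ h.isNaturalMap_triangle (adj := adj) h' hR hR' A.obj A.property (hγ A)
      (hθ ⟨_, h₁ (op A)⟩))
    (fun B ↦ h'.isNaturalMap_triangle (adj := adj.rightOp) h hR' hR B.obj B.property (hθ B)
      (hγ ⟨_, h₂ (op B)⟩)), hγ, hθ⟩

end

end

end DerivedDuality

end

/-! ### The main theorem -/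

theorem theorem4p5
    {𝒜 : Type u₁} [Category.{v₁} 𝒜] [Abelian 𝒜] [HasDerivedCategory.{w₁} 𝒜]
    {ℬ : Type u₂} [Category.{v₂} ℬ] [Abelian ℬ] [HasDerivedCategory.{w₂} ℬ]
    (Φ : 𝒜ᵒᵖ ⥤ ℬ) (Ψ : ℬᵒᵖ ⥤ 𝒜) [Φ.Additive] [Ψ.Additive]
    -- `(Φ, Ψ)` is a right adjoint pair of contravariant functors
    (adj : Φ.rightOp ⊣ Ψ)
    -- the subcategories by which `R*Φ` and `R†Ψ` are computed
    (b b' : DerivedDuality.Boundedness)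
    (𝓟 : ObjectProperty (HomotopyCategory 𝒜 (ComplexShape.up ℤ)))
    (𝓠 : ObjectProperty (HomotopyCategory ℬ (ComplexShape.up ℤ)))
    (h𝓟 : DerivedDuality.IsResolving Φ b 𝓟)
    (h𝓠 : DerivedDuality.IsResolving Ψ b' 𝓠)
    -- enough acyclic objects, and cohomological dimension at most one
    (h𝒜 : DerivedDuality.EnoughAcyclic Φ Ψ 𝓟 𝓠)
    (hℬ : DerivedDuality.EnoughAcyclic Ψ Φ 𝓠 𝓟)
    (hΦ : DerivedDuality.CohomologicalDimensionLE Φ 𝓟 1)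
    (hΨ : DerivedDuality.CohomologicalDimensionLE Ψ 𝓠 1) :
    -- the total derived functors exist
    (DerivedDuality.toDerived Φ).HasRightDerivedFunctor (DerivedDuality.quasiIsoOp 𝒜) ∧
    (DerivedDuality.toDerived Ψ).HasRightDerivedFunctor (DerivedDuality.quasiIsoOp ℬ) ∧
    ∀ (RΦ : (DerivedCategory 𝒜)ᵒᵖ ⥤ DerivedCategory ℬ)
      (α : DerivedDuality.toDerived Φ ⟶ (DerivedCategory.Q (C := 𝒜)).op ⋙ RΦ)
      [DerivedDuality.IsTotalDerived RΦ α]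
      (RΨ : (DerivedCategory ℬ)ᵒᵖ ⥤ DerivedCategory 𝒜)
      (β : DerivedDuality.toDerived Ψ ⟶ (DerivedCategory.Q (C := ℬ)).op ⋙ RΨ)
      [DerivedDuality.IsTotalDerived RΨ β],
    -- they form a right adjoint pair induced by `(Φ, Ψ)`
    ∃ Radj : RΦ.rightOp ⊣ RΨ,
      DerivedDuality.UnitCompatible adj α β Radj ∧
      DerivedDuality.UnitCompatible adj.rightOp β α Radj.rightOp ∧
      -- `R¹Φ` and `R¹Ψ` preserve `𝒟`-reflexive objects, and on these they form a left adjoint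
      -- pair with units `γ` and `θ`
      ∃ (h₁ : ∀ A : (DerivedDuality.reflexiveObjects Radj).FullSubcategoryᵒᵖ,
            DerivedDuality.reflexiveObjects Radj.rightOp
              (((DerivedDuality.reflexiveObjects Radj).ι.op ⋙
                DerivedDuality.cohomologyOn RΦ 1).obj A))
        (h₂ : ∀ B : (DerivedDuality.reflexiveObjects Radj.rightOp).FullSubcategoryᵒᵖ,
            DerivedDuality.reflexiveObjects Radj
              (((DerivedDuality.reflexiveObjects Radj.rightOp).ι.op ⋙
                DerivedDuality.cohomologyOn RΨ 1).obj B))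
        (ladj :
          (DerivedDuality.reflexiveObjects Radj.rightOp).lift
              ((DerivedDuality.reflexiveObjects Radj).ι.op ⋙
                DerivedDuality.cohomologyOn RΦ 1) h₁ ⊣
            ((DerivedDuality.reflexiveObjects Radj).lift
              ((DerivedDuality.reflexiveObjects Radj.rightOp).ι.op ⋙
                DerivedDuality.cohomologyOn RΨ 1) h₂).rightOp),
        (∀ A : (DerivedDuality.reflexiveObjects Radj).FullSubcategory,
          DerivedDuality.IsNaturalMap β Radj A.obj (ladj.unit.app (op A)).unop.hom) ∧
        ∀ B : (DerivedDuality.reflexiveObjects Radj.rightOp).FullSubcategory,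
          DerivedDuality.IsNaturalMap α Radj.rightOp B.obj (ladj.counit.app B).hom := by
  have h := DerivedDuality.dualityData adj h𝓟 h𝒜 hℬ hΦ
  -- The hypotheses are symmetric in the two functors, so each statement on `Ψ` is the one on `Φ`
  -- for the opposite adjunction.
  have h' := DerivedDuality.dualityData adj.rightOp h𝓠 hℬ h𝒜 hΨ
  refine ⟨(DerivedDuality.isDeriving_toDerived h).hasRightDerivedFunctor,
    (DerivedDuality.isDeriving_toDerived h').hasRightDerivedFunctor, fun RΦ α _ RΨ β _ ↦ ?_⟩
  obtain ⟨Radj, hR, hR'⟩ : ∃ Radj : RΦ.rightOp ⊣ RΨ, DerivedDuality.UnitCompatible adj α β Radj ∧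
      DerivedDuality.UnitCompatible adj.rightOp β α Radj.rightOp :=
    ⟨DerivedDuality.derivedAdjunction adj h RΦ α RΨ β h',
      DerivedDuality.unitCompatible_derivedAdjunction adj h RΦ α RΨ β h',
      DerivedDuality.unitCompatible_derivedAdjunction_rightOp adj h RΦ α RΨ β h'⟩
  have h₁ (A : (DerivedDuality.reflexiveObjects Radj).FullSubcategoryᵒᵖ) :
      DerivedDuality.reflexiveObjects Radj.rightOp
        (((DerivedDuality.reflexiveObjects Radj).ι.op ⋙
          DerivedDuality.cohomologyOn RΦ 1).obj A) :=
    h.reflexive_cohomologyOn adj h' RΦ α RΨ β Radj hR hR' _ A.unop.property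
  have h₂ (B : (DerivedDuality.reflexiveObjects Radj.rightOp).FullSubcategoryᵒᵖ) :
      DerivedDuality.reflexiveObjects Radj
        (((DerivedDuality.reflexiveObjects Radj.rightOp).ι.op ⋙
          DerivedDuality.cohomologyOn RΨ 1).obj B) :=
    h'.reflexive_cohomologyOn adj.rightOp h RΨ β RΦ α Radj.rightOp hR' hR _ B.unop.property
  exact ⟨Radj, hR, hR', h₁, h₂, h.exists_adjunction_of_reflexive h' hR hR' h₁ h₂⟩
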